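/- **Conventions.** A weighted linear graph is a path graph (a single vertex allowed) with an integer weight $w(v)$ on each vertex. For a finite disjoint union $\Gamma$ of weighted linear graphs, $d(v)$ is the degree of a vertex $v$ and $w'(v)=w(v)-d(v)$ is its adjusted weight. The lattice $Q_\Gamma$ is the free abelian group on the vertex set $V(\Gamma)$ with the symmetric bilinear form given by $Q_\Gamma(v,v)=w(v)$, $Q_\Gamma(u,v)=-1$ if $u,v$ are adjacent, and $Q_\Gamma(u,v)=0$ otherwise. $\mathbb Z^N$ denotes the standard diagonal lattice $(\mathbb Z^N,\langle 1\rangle^N)$, and $\mathrm{Aut}(\mathbb Z^N)$ the group of automorphisms of this lattice. A lattice map is a linear map preserving the bilinear forms. A lattice $L$ is *rigid* if for any positive integer $N$ and any two lattice maps $\phi,\phi':L\to\mathbb Z^N$ there is $\alpha\in\mathrm{Aut}(\mathbb Z^N)$ with $\phi'=\alpha\circ\phi$. An *embedding* of $\Gamma$ in $\mathbb Z^N$ is a function $\phi:V(\Gamma)\to\mathbb Z^N$ with $\phi(u)\cdot\phi(v)=Q_\Gamma(u,v)$ for all $u,v$; $\Gamma$ is *rigid* if for every $N$ and any two embeddings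 $\phi,\phi'$ of $\Gamma$ in $\mathbb Z^N$ there is $\alpha\in\mathrm{Aut}(\mathbb Z^N)$ with $\phi'(v)=\alpha(\phi(v))$ for all $v$. The support $\mathrm{supp}(x)$ of $x\in\mathbb Z^N$ is the set of unit vectors of $\mathbb{Z}^N$, up to sign, that pair nontrivially with $x$ (that is, the set of nonzero coordinates of $x$). An embedding $\phi$ is *standard* if $|\mathrm{supp}(\phi(u))\cap\mathrm{supp}(\phi(v))|$ equals $w(v)$ if $u=v$, $1$ if $u,v$ are adjacent, and $0$ otherwise. $\Gamma$ satisfies the *Working Conditions* if: (I) $w(v)\ge 2$ for every vertex $v$; (II) $w'(v)\le 3$ for every vertex $v$, and at most one vertex has $w'(v)>1$; (III) $\Gamma$ contains no path of three distinct, consecutively adjacent vertices all with $w'>0$; (IV) if some vertex has $w'(v)=3$, then no two adjacent vertices both have $w'=1$; (V) if $v_0,\dots,v_{k+1}$ is a path of distinct, consecutively adjacent vertices with $k\ne 0$, $w'(v_0)\ge 1$, $w'(v_1)=\dots=w'(v_k)=0$ and $w'(v_{k+1})=1$, then $k\ge w'(v_0)+1$; (VI) $\Gamma$ contains no path of distinct,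 consecutively adjacent vertices whose adjusted weights are, in order, $(1,1,0,0,1,2)$ or $(3,1,0,0,1)$. For coprime integers $p>q>0$, the canonical negative-definite plumbing $X(p,q)$, with boundary the lens space $L(p,q)$, is the plumbing of disk bundles over spheres along the linear graph with weights $-a_1,\dots,-a_n$, where $a_j\ge 2$ and $p/q=a_1-1/(a_2-1/(\cdots-1/a_n))$. The canonical negative plumbing graph of $L=\#_i L(p_i,q_i)$ is the disjoint union of these linear graphs for the pairs $(p_i,q_i)$. The intersection form of a plumbing along a weighted graph is the form on the free abelian group on the vertices which is $w(v)$ on the diagonal, $1$ on pairs of adjacent vertices and $0$ on the other pairs of vertices. **Theorem.** (1) If a finite disjoint union $\Gamma$ of weighted linear graphs satisfies the Working Conditions, then every embedding of $\Gamma$ in any $\mathbb Z^N$ is standard, the graph $\Gamma$ is rigid, and the lattice $Q_\Gamma$ is rigid. (2) Let $L=\#_i L(p_i,q_i)$ be a connected sum of finitely many lens spaces, with $p_i>q_i>0$ coprime. Suppose that the canonical negative plumbing graph of $L$ does not contain, as an induced weighted subgraph, any of the following disjoint unions of linear graphs, given by the weight sequences of their components (different components separated by $\sqcup$): $(-4)$;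 $(-5,-2)$; $(-6,-2,-2)$; $(-2)\sqcup(-2)$; $(-3)\sqcup(-2,-2)$; $(-3,-3)$; $(-3,-2,-3)$; $(-3,-2,-2,-3)$; $(-3,-5,-3,-2)$; $(-2,-2,-3,-5)$. Then the intersection form of $-\natural_i X(p_i,p_i-q_i)$ is a rigid lattice. -/

import Mathlib

/-! ### Weighted graphs and disjoint unions of linear graphs -/

/-- A simple graph with integer weights on its vertices (a plumbing graph). -/
structure WeightedGraph (V : Type*) where
  /-- The underlying graph. -/
  graph : SimpleGraph V
  /-- The weight `w(v)` of a vertex. -/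
  weight : V → ℤ

/-- The disjoint union of the linear weighted graphs given by the lists `c i`: the `i`-th component
has one vertex for each entry of `c i`, weighted by that entry, and consecutive vertices are
adjacent. -/
def linearPlumbing {k : ℕ} (c : Fin k → List ℤ) :
    WeightedGraph (Σ i : Fin k, Fin (c i).length) where
  graph :=
    { Adj := fun x y =>
        x.1 = y.1 ∧ ((x.2 : ℕ) + 1 = (y.2 : ℕ) ∨ (y.2 : ℕ) + 1 = (x.2 : ℕ))
      symm := ⟨fun _ _ h => ⟨h.1.symm, h.2.symm⟩⟩
      loopless := ⟨fun _ h => by omega⟩ }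
  weight := fun x => (c x.1).get x.2

namespace WeightedGraph

/-- `Γ` is (isomorphic, as a weighted graph, to) a finite disjoint union of weighted linear
graphs. -/
def IsLinearUnion {V : Type*} (Γ : WeightedGraph V) : Prop :=
  ∃ (k : ℕ) (c : Fin k → List ℤ) (f : Γ.graph ≃g (linearPlumbing c).graph),
    ∀ v, (linearPlumbing c).weight (f v) = Γ.weight v

/-- `Γ` contains the weighted graph `H` as an induced subgraph. -/
def ContainsInduced {V W : Type*} (Γ : WeightedGraph V) (H : WeightedGraph W) : Prop :=
  ∃ f : H.graph ↪g Γ.graph, ∀ v, Γ.weight (f v) = H.weight v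

/-- The adjusted weight `w'(v) = w(v) - d(v)`, where `d(v)` is the degree of `v`. -/
noncomputable def adjWeight {V : Type*} (Γ : WeightedGraph V) (v : V) : ℤ :=
  Γ.weight v - ((Γ.graph.neighborSet v).ncard : ℤ)

/-- `Γ` contains a path of distinct, consecutively adjacent vertices whose adjusted weights (with
respect to `Γ`) are the entries of `l`, in this order. -/
def HasAdjPath {V : Type*} (Γ : WeightedGraph V) (l : List ℤ) : Prop :=
  ∃ vs : List V, vs.Nodup ∧ vs.IsChain Γ.graph.Adj ∧ vs.map Γ.adjWeight = l

/-- The Working Conditions. -/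
structure WorkingConditions {V : Type*} (Γ : WeightedGraph V) : Prop where
  two_le_weight : ∀ v, 2 ≤ Γ.weight v
  adjWeight_le_three : ∀ v, Γ.adjWeight v ≤ 3
  at_most_one_large : ∀ u v, 1 < Γ.adjWeight u → 1 < Γ.adjWeight v → u = v
  no_three_adjacent : ∀ a b c : ℤ, 0 < a → 0 < b → 0 < c → ¬ Γ.HasAdjPath [a, b, c]
  no_one_one_of_three : (∃ v, Γ.adjWeight v = 3) → ¬ Γ.HasAdjPath [1, 1]
  long_chain : ∀ (a : ℤ) (k : ℕ), 1 ≤ a → k ≠ 0 →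
    Γ.HasAdjPath (a :: (List.replicate k 0 ++ [1])) → a + 1 ≤ (k : ℤ)
  no_110012 : ¬ Γ.HasAdjPath [1, 1, 0, 0, 1, 2]
  no_31001 : ¬ Γ.HasAdjPath [3, 1, 0, 0, 1]

/-! ### Lattices, embeddings and rigidity -/

open Classical in
/-- The Gram matrix of the lattice `Q_Γ`: `w(v)` on the diagonal, `-1` for adjacent vertices and
`0` otherwise. -/
noncomputable def latticeMatrix {V : Type*} (Γ : WeightedGraph V) : Matrix V V ℤ :=
  Matrix.of fun u v => if u = v then Γ.weight v else if Γ.graph.Adj u v then -1 else 0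

open Classical in
/-- The lattice `Q_Γ`, a symmetric bilinear form on the free abelian group `ℤ V(Γ)`. -/
noncomputable def latticeForm {V : Type*} [Fintype V] (Γ : WeightedGraph V) :
    LinearMap.BilinForm ℤ (V → ℤ) :=
  Matrix.toBilin' Γ.latticeMatrix

open Classical in
/-- The intersection form of the 4-manifold obtained by plumbing disk bundles over spheres
according to `Γ`, in the basis of `H₂` given by the spheres: the Euler numbers `w(v)` on the
diagonal, and intersection number `1` for adjacent vertices. -/
noncomputable def intersectionForm {V : Type*} [Fintype V] (Γ : WeightedGraph V) :
    LinearMap.BilinForm ℤ (V → ℤ) :=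
  Matrix.toBilin' (Matrix.of fun u v : V =>
    if u = v then Γ.weight v else if Γ.graph.Adj u v then 1 else 0)

end WeightedGraph

/-- The standard diagonal lattice `(ℤ^N, ⟨1⟩^N)`. -/
def stdLattice (N : ℕ) : LinearMap.BilinForm ℤ (Fin N → ℤ) :=
  dotProductBilin ℤ ℤ

/-- A lattice is rigid if any two lattice maps to the same `ℤ^N`, `N` positive, differ by an
automorphism of the lattice `ℤ^N`. -/
def IsRigidLattice {L : Type*} [AddCommGroup L] (B : LinearMap.BilinForm ℤ L) : Prop :=
  ∀ N : ℕ, 0 < N → ∀ φ φ' : LinearMap.BilinForm.Isometry B (stdLattice N),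
    ∃ α : LinearMap.BilinForm.IsometryEquiv (stdLattice N) (stdLattice N), ∀ x, φ' x = α (φ x)

/-- The support of a vector of `ℤ^N`. The unit vectors of `ℤ^N` up to sign are the standard basis
vectors `e_i`, so the set of unit vectors up to sign pairing nontrivially with `x` is identified
with the set of `i` such that `x i ≠ 0`. -/
def latticeSupport {N : ℕ} (x : Fin N → ℤ) : Finset (Fin N) :=
  Finset.univ.filter fun i => x i ≠ 0

namespace WeightedGraph

/-- An embedding of `Γ` in `ℤ^N`: the vertices are sent to vectors with the pairings of `Q_Γ`. -/
def IsEmbedding {V : Type*} (Γ : WeightedGraph V) {N : ℕ} (φ : V → Fin N → ℤ) : Prop :=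
  ∀ u v, stdLattice N (φ u) (φ v) = Γ.latticeMatrix u v

open Classical in
/-- An embedding is standard if the supports of the images of two vertices have `w(v)`, `1` or `0`
common elements, according to whether the vertices are equal, adjacent or neither. -/
def IsStandard {V : Type*} (Γ : WeightedGraph V) {N : ℕ} (φ : V → Fin N → ℤ) : Prop :=
  ∀ u v, ((latticeSupport (φ u) ∩ latticeSupport (φ v)).card : ℤ) =
    if u = v then Γ.weight v else if Γ.graph.Adj u v then 1 else 0

/-- `Γ` is rigid if any two embeddings of `Γ` in the same `ℤ^N` differ by an automorphism of the
lattice `ℤ^N`. -/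
def IsRigid {V : Type*} (Γ : WeightedGraph V) : Prop :=
  ∀ (N : ℕ) (φ φ' : V → Fin N → ℤ), Γ.IsEmbedding φ → Γ.IsEmbedding φ' →
    ∃ α : LinearMap.BilinForm.IsometryEquiv (stdLattice N) (stdLattice N), ∀ v, φ' v = α (φ v)

end WeightedGraph

/-! ### Canonical plumbings of connected sums of lens spaces -/

/-- The value of the continued fraction `a₁ - 1/(a₂ - 1/(⋯ - 1/aₙ))`. -/
def hjValue : List ℤ → ℚ
  | [] => 0
  | [a] => a
  | a :: b :: l => a - 1 / hjValue (b :: l)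

/-- `a` is the continued fraction expansion of `p / q` with all entries at least `2`. -/
def IsHJExpansion (p q : ℕ) (a : List ℤ) : Prop :=
  a ≠ [] ∧ (∀ x ∈ a, 2 ≤ x) ∧ hjValue a = (p : ℚ) / (q : ℚ)

theorem one_lt_hjValue : ∀ a : List ℤ, a ≠ [] → (∀ x ∈ a, 2 ≤ x) → 1 < hjValue a
  | [], h, _ => absurd rfl h
  | [a], _, h => by
      have h2 : (2 : ℤ) ≤ a := h a (by simp)
      have : (2 : ℚ) ≤ a := by exact_mod_cast h2
      simp only [hjValue]
      linarith
  | a :: b :: l, _, h => by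
      have h2 : (2 : ℤ) ≤ a := h a (by simp)
      have h3 : (2 : ℚ) ≤ a := by exact_mod_cast h2
      have h4 := one_lt_hjValue (b :: l) (by simp) (fun x hx => h x (List.mem_cons_of_mem _ hx))
      have h5 : 1 / hjValue (b :: l) < 1 := (div_lt_one (by linarith)).2 h4
      simp only [hjValue]
      linarith

theorem hjValue_bounds (a : ℤ) (l : List ℤ) (h : ∀ x ∈ a :: l, 2 ≤ x) :
    (a : ℚ) - 1 < hjValue (a :: l) ∧ hjValue (a :: l) ≤ a ∧ (hjValue (a :: l) = a → l = []) := by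
  cases l with
  | nil => simp [hjValue]
  | cons b l =>
    have h4 := one_lt_hjValue (b :: l) (by simp) (fun x hx => h x (List.mem_cons_of_mem _ hx))
    have h5 : 1 / hjValue (b :: l) < 1 := (div_lt_one (by linarith)).2 h4
    have h6 : 0 < 1 / hjValue (b :: l) := by positivity
    simp only [hjValue]
    refine ⟨by linarith, by linarith, fun h => by linarith⟩

theorem hjValue_injective : ∀ a b : List ℤ, a ≠ [] → b ≠ [] → (∀ x ∈ a, 2 ≤ x) →
    (∀ x ∈ b, 2 ≤ x) → hjValue a = hjValue b → a = b
  | [], _, h, _, _, _, _ => absurd rfl h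
  | _, [], _, h, _, _, _ => absurd rfl h
  | a :: l, b :: m, _, _, ha, hb, h => by
      obtain ⟨h1, h2, h3⟩ := hjValue_bounds a l ha
      obtain ⟨k1, k2, k3⟩ := hjValue_bounds b m hb
      have hab : a = b := by
        have e1 : (a : ℚ) < b + 1 := by linarith
        have e2 : (b : ℚ) < a + 1 := by linarith
        have e3 : a < b + 1 := by exact_mod_cast e1
        have e4 : b < a + 1 := by exact_mod_cast e2
        omega
      subst hab
      rcases l with _ | ⟨c, l⟩
      · rw [k3 (by rw [← h]; simp [hjValue])]
      · rcases m with _ | ⟨d, m⟩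
        · exact absurd (h3 (by rw [h]; simp [hjValue])) (by simp)
        · have h' : hjValue (c :: l) = hjValue (d :: m) := by
            simp only [hjValue, sub_right_inj, one_div, inv_inj] at h
            exact h
          rw [hjValue_injective (c :: l) (d :: m) (by simp) (by simp)
            (fun x hx => ha x (List.mem_cons_of_mem _ hx))
            (fun x hx => hb x (List.mem_cons_of_mem _ hx)) h']

/-- Every `p / q > 1` has exactly one continued fraction expansion with entries at least `2`. -/
theorem existsUnique_isHJExpansion (p q : ℕ) (hq : 0 < q) (hqp : q < p) :
    ∃! a : List ℤ, IsHJExpansion p q a := by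
  have hex : ∃ a : List ℤ, IsHJExpansion p q a := by
    induction q using Nat.strong_induction_on generalizing p with
    | _ q ih =>
      have hq' : (0 : ℚ) < q := by exact_mod_cast hq
      obtain ⟨c, r, hcr, hr⟩ : ∃ c r : ℕ, p + r = c * q ∧ r < q := by
        rcases Nat.eq_zero_or_pos (p % q) with h | h
        · exact ⟨p / q, 0, by have := Nat.div_add_mod p q; rw [mul_comm]; omega, hq⟩
        · refine ⟨p / q + 1, q - p % q, ?_, by omega⟩
          have h1 := Nat.div_add_mod p q
          have h2 := Nat.mod_lt p hq
          rw [add_mul, mul_comm (p / q) q]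
          omega
      have hc : 2 ≤ c := by
        by_contra hc
        have : c * q ≤ 1 * q := Nat.mul_le_mul_right q (by omega)
        omega
      have hcr' : (p : ℚ) + r = c * q := by exact_mod_cast hcr
      rcases Nat.eq_zero_or_pos r with h0 | h0
      · subst h0
        refine ⟨[(c : ℤ)], by simp, ?_, ?_⟩
        · intro x hx
          rw [List.mem_singleton] at hx
          subst hx
          exact_mod_cast hc
        · simp only [hjValue]
          rw [eq_div_iff hq'.ne']
          push_cast at hcr' ⊢
          linarith
      · obtain ⟨l, hl0, hl, hv⟩ := ih r hr q h0 hr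
        have hr' : (0 : ℚ) < r := by exact_mod_cast h0
        rcases l with _ | ⟨b, l⟩
        · exact absurd rfl hl0
        · refine ⟨(c : ℤ) :: b :: l, by simp, ?_, ?_⟩
          · intro x hx
            rcases List.mem_cons.1 hx with h | h
            · subst h
              exact_mod_cast hc
            · exact hl x h
          · simp only [hjValue]
            rw [hv]
            push_cast
            field_simp
            linarith
  obtain ⟨a, ha⟩ := hex
  exact ⟨a, ha, fun b hb => hjValue_injective b a hb.1 ha.1 hb.2.1 ha.2.1
    (hb.2.2.trans ha.2.2.symm)⟩

/-- The canonical negative plumbing graph with continued fraction expansions `a i`: a disjoint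
union of linear graphs with weights `-a i 1, -a i 2, …`. If `a i` is the expansion of `p i / q i`,
this is the plumbing graph of the boundary connected sum of the `X(p i, q i)`. -/
def canonicalPlumbing {k : ℕ} (a : Fin k → List ℤ) :
    WeightedGraph (Σ i : Fin k, Fin ((a i).map fun x => -x).length) :=
  linearPlumbing fun i => (a i).map fun x => -x

/-- The forbidden configurations. Each is a disjoint union of linear graphs, written as the list of
the weight sequences of its components. -/
def forbiddenConfigurations : List (List (List ℤ)) :=
  [[[-4]],
   [[-5, -2]],
   [[-6, -2, -2]],
   [[-2], [-2]],
   [[-3], [-2, -2]],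
   [[-3, -3]],
   [[-3, -2, -3]],
   [[-3, -2, -2, -3]],
   [[-3, -5, -3, -2]],
   [[-2, -2, -3, -5]]]

section Auxiliary

open Matrix

theorem dotProduct_self_nonneg_int {N : ℕ} (v : Fin N → ℤ) : 0 ≤ v ⬝ᵥ v :=
  Finset.sum_nonneg fun i _ => mul_self_nonneg (v i)

theorem eq_zero_of_dotProduct_self_nonpos {N : ℕ} {v : Fin N → ℤ} (h : v ⬝ᵥ v ≤ 0) : v = 0 :=
  dotProduct_self_eq_zero.1 (le_antisymm h (dotProduct_self_nonneg_int v))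

/-- A nonempty set of consecutive vertices `p + 1, …, q` of adjusted weight zero bounded by vertices
`p` and `q + 1` of positive adjusted weight, with the length forced by the working conditions. -/
structure IsRun (A B : ℤ → Prop) (a : ℤ → ℤ) (p q : ℤ) : Prop where
  left : B p
  right : B (q + 1)
  zero : ∀ j, p < j → j ≤ q → A j
  two_le : 2 ≤ q - p
  left_le : a p + 1 ≤ q - p
  right_le : a (q + 1) + 1 ≤ q - p

/-- The vectors `χ x` obtained from an embedding of a union of linear graphs by removing the
expected components along the unit vectors `U g` determined by the vertices of adjusted weight zero.
Here `A` and `B` are the sets of vertices of zero and of positive adjusted weight `a`. -/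
structure ReducedSystem {N : ℕ} (A B : ℤ → Prop) (a : ℤ → ℤ) (χ U : ℤ → Fin N → ℤ) : Prop where
  disj : ∀ n, A n → ¬ B n
  gap_norm : ∀ g, A g ∨ A (g + 1) → U g ⬝ᵥ U g = 1
  gap_orth : ∀ g h, g ≠ h → U g ⬝ᵥ U h = 0
  gap_zero : ∀ g, ¬ A g → ¬ A (g + 1) → U g = 0
  const : ∀ x n, B x → A n → χ x ⬝ᵥ U (n - 1) = χ x ⬝ᵥ U n
  run : ∀ n, A n → ∃ p q, p < n ∧ n ≤ q ∧ IsRun A B a p q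
  one_le : ∀ x, B x → 1 ≤ a x
  le_three : ∀ x, B x → a x ≤ 3
  unique : ∀ x y, B x → B y → 1 < a x → 1 < a y → x = y
  no_three : ∀ x, B x → B (x + 1) → ¬ B (x + 2)
  no_one_one : ∀ v x, B v → a v = 3 → B x → B (x + 1) → a x = 1 → a (x + 1) ≠ 1
  no_110012 : ∀ x, B x → B (x + 1) → A (x + 2) → A (x + 3) → B (x + 4) → B (x + 5) →
    a x = 1 → a (x + 1) = 1 → a (x + 4) = 1 → a (x + 5) ≠ 2
  no_210011 : ∀ x, B x → B (x + 1) → A (x + 2) → A (x + 3) → B (x + 4) → B (x + 5) →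
    a x = 2 → a (x + 1) = 1 → a (x + 4) = 1 → a (x + 5) ≠ 1
  no_31001 : ∀ x, B x → B (x + 1) → A (x + 2) → A (x + 3) → B (x + 4) →
    a x = 3 → a (x + 1) = 1 → a (x + 4) ≠ 1
  no_10013 : ∀ x, B x → A (x + 1) → A (x + 2) → B (x + 3) → B (x + 4) →
    a x = 1 → a (x + 3) = 1 → a (x + 4) ≠ 3
  prod_adj : ∀ x, B x → B (x + 1) → χ x ⬝ᵥ χ (x + 1) +
    (χ (x + 1) ⬝ᵥ U (x - 1) - χ x ⬝ᵥ U (x + 1)) = -1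
  prod_far : ∀ x y, B x → B y → x + 1 < y → χ x ⬝ᵥ χ y +
    (χ y ⬝ᵥ U (x - 1) - χ y ⬝ᵥ U x + χ x ⬝ᵥ U (y - 1) - χ x ⬝ᵥ U y) = 0
  norm_free : ∀ x, B x → ¬ B (x - 1) → ¬ B (x + 1) →
    χ x ⬝ᵥ χ x + 2 * (χ x ⬝ᵥ U (x - 1) - χ x ⬝ᵥ U x) = a x
  norm_right : ∀ x, B x → B (x + 1) →
    χ x ⬝ᵥ χ x + 2 * (χ x ⬝ᵥ U (x - 1) - χ x ⬝ᵥ U x) = a x + 1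
  norm_left : ∀ x, B x → B (x - 1) →
    χ x ⬝ᵥ χ x + 2 * (χ x ⬝ᵥ U (x - 1) - χ x ⬝ᵥ U x) = a x + 1

namespace ReducedSystem

variable {N : ℕ} {A B : ℤ → Prop} {a : ℤ → ℤ} {χ U : ℤ → Fin N → ℤ}

/-- The sum of the unit vectors of a run. -/
noncomputable def block (U : ℤ → Fin N → ℤ) (p q : ℤ) : Fin N → ℤ := ∑ g ∈ Finset.Icc p q, U g

theorem reflect (R : ReducedSystem A B a χ U) :
    ReducedSystem (fun n => A (-n)) (fun n => B (-n)) (fun n => a (-n)) (fun n => χ (-n))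
      (fun g => -U (-g - 1)) where
  disj n h := R.disj _ h
  gap_norm g h := by
    have := R.gap_norm (-g - 1) (by
      rw [show -g - 1 + 1 = -g by ring, show -g - 1 = -(g + 1) by ring]; exact h.symm)
    simpa using this
  gap_orth g h hne := by
    have := R.gap_orth (-g - 1) (-h - 1) (by omega)
    simpa using this
  gap_zero g h h' := by
    have := R.gap_zero (-g - 1) (by rwa [show -g - 1 = -(g + 1) by ring])
      (by rwa [show -g - 1 + 1 = -g by ring])
    simpa using this
  const x n hx hn := by
    have := R.const (-x) (-n) hx hn
    simp only [dotProduct_neg]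
    rw [show -(n - 1) - 1 = -n by ring, this]
  run n hn := by
    obtain ⟨p, q, h1, h2, h3⟩ := R.run (-n) hn
    refine ⟨-q - 1, -p - 1, by omega, by omega, ?_, ?_, ?_, ?_, ?_, ?_⟩
    · have := h3.right
      rwa [show q + 1 = -(-q - 1) by ring] at this
    · have := h3.left
      rwa [show p = -(-p - 1 + 1) by ring] at this
    · intro j hj hj'
      exact h3.zero _ (by omega) (by omega)
    · have := h3.two_le
      omega
    · have := h3.right_le
      rw [show q + 1 = -(-q - 1) by ring] at this
      linarith
    · have := h3.left_le
      rw [show -(-p - 1 + 1) = p by ring]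
      linarith
  one_le x h := R.one_le _ h
  le_three x h := R.le_three _ h
  unique x y hx hy h h' := by
    have := R.unique _ _ hx hy h h'
    omega
  no_three x h0 h1 h2 := by
    refine R.no_three (-(x + 2)) h2 ?_ ?_
    · rwa [show -(x + 2) + 1 = -(x + 1) by ring]
    · rwa [show -(x + 2) + 2 = -x by ring]
  no_one_one v x hv h3 h0 h1 e0 e1 := by
    refine R.no_one_one (-v) (-(x + 1)) hv h3 h1 ?_ e1 ?_
    · rwa [show -(x + 1) + 1 = -x by ring]
    · rwa [show -(x + 1) + 1 = -x by ring]
  no_110012 x h0 h1 h2 h3 h4 h5 e0 e1 e4 e5 := by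
    have := R.no_210011 (-(x + 5))
    rw [show -(x + 5) + 1 = -(x + 4) by ring, show -(x + 5) + 2 = -(x + 3) by ring,
      show -(x + 5) + 3 = -(x + 2) by ring, show -(x + 5) + 4 = -(x + 1) by ring,
      show -(x + 5) + 5 = -x by ring] at this
    exact this h5 h4 h3 h2 h1 h0 e5 e4 e1 e0
  no_210011 x h0 h1 h2 h3 h4 h5 e0 e1 e4 e5 := by
    have := R.no_110012 (-(x + 5))
    rw [show -(x + 5) + 1 = -(x + 4) by ring, show -(x + 5) + 2 = -(x + 3) by ring,
      show -(x + 5) + 3 = -(x + 2) by ring, show -(x + 5) + 4 = -(x + 1) by ring,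
      show -(x + 5) + 5 = -x by ring] at this
    exact this h5 h4 h3 h2 h1 h0 e5 e4 e1 e0
  no_31001 x h0 h1 h2 h3 h4 e0 e1 e4 := by
    have := R.no_10013 (-(x + 4))
    rw [show -(x + 4) + 1 = -(x + 3) by ring, show -(x + 4) + 2 = -(x + 2) by ring,
      show -(x + 4) + 3 = -(x + 1) by ring, show -(x + 4) + 4 = -x by ring] at this
    exact this h4 h3 h2 h1 h0 e4 e1 e0
  no_10013 x h0 h1 h2 h3 h4 e0 e3 e4 := by
    have := R.no_31001 (-(x + 4))
    rw [show -(x + 4) + 1 = -(x + 3) by ring, show -(x + 4) + 2 = -(x + 2) by ring,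
      show -(x + 4) + 3 = -(x + 1) by ring, show -(x + 4) + 4 = -x by ring] at this
    exact this h4 h3 h2 h1 h0 e4 e3 e0
  prod_adj x h0 h1 := by
    have := R.prod_adj (-(x + 1)) h1 (by rwa [show -(x + 1) + 1 = -x by ring])
    rw [show -(x + 1) + 1 = -x by ring] at this
    simp only [dotProduct_neg]
    rw [show -(x - 1) - 1 = -x by ring, dotProduct_comm (χ (-x))]
    linarith
  prod_far x y hx hy hxy := by
    have := R.prod_far (-y) (-x) hy hx (by omega)
    simp only [dotProduct_neg]
    rw [show -(x - 1) - 1 = -x by ring, show -(y - 1) - 1 = -y by ring, dotProduct_comm (χ (-x))]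
    linarith
  norm_free x hx hl hr := by
    have := R.norm_free (-x) hx (by rwa [show -x - 1 = -(x + 1) by ring])
      (by rwa [show -x + 1 = -(x - 1) by ring])
    simp only [dotProduct_neg]
    rw [show -(x - 1) - 1 = -x by ring]
    linarith
  norm_right x hx hr := by
    have := R.norm_left (-x) hx (by rwa [show -x - 1 = -(x + 1) by ring])
    simp only [dotProduct_neg]
    rw [show -(x - 1) - 1 = -x by ring]
    linarith
  norm_left x hx hr := by
    have := R.norm_right (-x) hx (by rwa [show -x + 1 = -(x - 1) by ring])
    simp only [dotProduct_neg]
    rw [show -(x - 1) - 1 = -x by ring]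
    linarith

theorem block_dotProduct_gap (R : ReducedSystem A B a χ U) {p q : ℤ} (h : IsRun A B a p q) (g : ℤ) :
    block U p q ⬝ᵥ U g = if p ≤ g ∧ g ≤ q then 1 else 0 := by
  have key : ∀ i ∈ Finset.Icc p q, U i ⬝ᵥ U g = if i = g then 1 else 0 := by
    intro i hi
    rw [Finset.mem_Icc] at hi
    split_ifs with hig
    · subst hig
      refine R.gap_norm i ?_
      rcases eq_or_lt_of_le hi.1 with h1 | h1
      · have := h.two_le
        exact Or.inr (h.zero _ (by omega) (by omega))
      · exact Or.inl (h.zero _ h1 hi.2)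
    · exact R.gap_orth _ _ hig
  rw [block, sum_dotProduct, Finset.sum_congr rfl key, Finset.sum_ite_eq']
  simp

theorem block_dotProduct_block (R : ReducedSystem A B a χ U) {p q : ℤ} (h : IsRun A B a p q) :
    block U p q ⬝ᵥ block U p q = q - p + 1 := by
  have := h.two_le
  conv_lhs => rw [block.eq_1 U p q, dotProduct_sum]
  rw [Finset.sum_congr rfl (g := fun _ => (1 : ℤ))]
  · simp
    omega
  · intro g hg
    rw [Finset.mem_Icc] at hg
    have := R.block_dotProduct_gap h g
    rw [if_pos hg] at this
    exact this

theorem coeff_eq (R : ReducedSystem A B a χ U) {p q : ℤ} (h : IsRun A B a p q) {x : ℤ} (hx : B x)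
    {g : ℤ} (hg : p ≤ g) (hg' : g ≤ q) : χ x ⬝ᵥ U g = χ x ⬝ᵥ U p := by
  induction g, hg using Int.leInduction with
  | base => rfl
  | succ n hn ih =>
    rw [← ih (by omega), ← R.const x (n + 1) hx (h.zero _ (by omega) hg')]
    congr 2; ring

theorem coeff_last (R : ReducedSystem A B a χ U) {p q : ℤ} (h : IsRun A B a p q) {x : ℤ}
    (hx : B x) :
    χ x ⬝ᵥ U q = χ x ⬝ᵥ U p :=
  R.coeff_eq h hx (by have := h.two_le; omega) le_rfl

theorem dotProduct_block (R : ReducedSystem A B a χ U) {p q : ℤ} (h : IsRun A B a p q) {x : ℤ}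
    (hx : B x) : χ x ⬝ᵥ block U p q = (q - p + 1) * (χ x ⬝ᵥ U p) := by
  have := h.two_le
  rw [block, dotProduct_sum, Finset.sum_congr rfl (g := fun _ => χ x ⬝ᵥ U p)]
  · simp
    left; omega
  · intro g hg
    rw [Finset.mem_Icc] at hg
    exact R.coeff_eq h hx hg.1 hg.2

theorem run_disjoint (R : ReducedSystem A B a χ U) {p q p' q' : ℤ} (h : IsRun A B a p q)
    (h' : IsRun A B a p' q') : (p = p' ∧ q = q') ∨ q < p' ∨ q' < p := by
  have h1 := h.two_le
  have h2 := h'.two_le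
  by_contra! hc
  obtain ⟨hc1, hc2, hc3⟩ := hc
  have e1 : p = p' := by
    rcases lt_trichotomy p p' with hlt | heq | hgt
    · exact absurd h'.left (R.disj _ (h.zero _ hlt hc2))
    · exact heq
    · exact absurd h.left (R.disj _ (h'.zero _ hgt hc3))
  have e2 := hc1 e1
  rcases lt_trichotomy q q' with hlt | heq | hgt
  · exact absurd h.right (R.disj _ (h'.zero _ (by omega) (by omega)))
  · exact e2 heq
  · exact absurd h'.right (R.disj _ (h.zero _ (by omega) (by omega)))

theorem dotProduct_block_eq_zero {v : Fin N → ℤ} (p q : ℤ)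
    (h : ∀ g, p ≤ g → g ≤ q → v ⬝ᵥ U g = 0) : v ⬝ᵥ block U p q = 0 := by
  rw [block, dotProduct_sum]
  refine Finset.sum_eq_zero fun g hg => ?_
  rw [Finset.mem_Icc] at hg
  exact h g hg.1 hg.2

theorem block_orth (R : ReducedSystem A B a χ U) {p q p' q' : ℤ} (h : IsRun A B a p q)
    (h' : IsRun A B a p' q') (hne : p ≠ p') : block U p q ⬝ᵥ block U p' q' = 0 := by
  refine dotProduct_block_eq_zero _ _ fun g hg hg' => ?_
  rw [R.block_dotProduct_gap h, if_neg]
  rcases R.run_disjoint h h' with h1 | h1 | h1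
  · exact absurd h1.1 hne
  · omega
  · omega

theorem exists_run_of_coeff_ne_zero (R : ReducedSystem A B a χ U) {v : Fin N → ℤ} {g : ℤ}
    (h : v ⬝ᵥ U g ≠ 0) : ∃ p q, p ≤ g ∧ g ≤ q ∧ IsRun A B a p q := by
  have hg : A g ∨ A (g + 1) := by
    by_contra! hc
    exact h (by rw [R.gap_zero g hc.1 hc.2, dotProduct_zero])
  rcases hg with hg | hg
  · obtain ⟨p, q, h1, h2, h3⟩ := R.run g hg
    exact ⟨p, q, h1.le, h2, h3⟩
  · obtain ⟨p, q, h1, h2, h3⟩ := R.run (g + 1) hg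
    exact ⟨p, q, by omega, by omega, h3⟩

theorem exists_left_run (R : ReducedSystem A B a χ U) {v : Fin N → ℤ} {x : ℤ} (hx : B x)
    (h : v ⬝ᵥ U (x - 1) ≠ 0) : ∃ p, IsRun A B a p (x - 1) := by
  obtain ⟨p, q, h1, h2, h3⟩ := R.exists_run_of_coeff_ne_zero h
  have : q = x - 1 := by
    by_contra hne
    exact R.disj _ (h3.zero x (by omega) (by omega)) hx
  exact ⟨p, this ▸ h3⟩

theorem exists_right_run (R : ReducedSystem A B a χ U) {v : Fin N → ℤ} {x : ℤ} (hx : B x)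
    (h : v ⬝ᵥ U x ≠ 0) : ∃ q, IsRun A B a x q := by
  obtain ⟨p, q, h1, h2, h3⟩ := R.exists_run_of_coeff_ne_zero h
  have : p = x := by
    by_contra hne
    exact R.disj _ (h3.zero x (by omega) (by omega)) hx
  exact ⟨q, this ▸ h3⟩

theorem coeff_eq_zero_of_adj (R : ReducedSystem A B a χ U) {x : ℤ} (hx : B x) (hx' : B (x + 1))
    (v : Fin N → ℤ) : v ⬝ᵥ U x = 0 := by
  rw [R.gap_zero x (fun h => R.disj _ h hx) (fun h => R.disj _ h hx'), dotProduct_zero]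

theorem bessel {L K v w : Fin N → ℤ} {l k s t : ℤ} (hL : L ⬝ᵥ L = l) (hK : K ⬝ᵥ K = k)
    (hLK : L ⬝ᵥ K = 0) (hLv : v ⬝ᵥ L = 0) (hKv : v ⬝ᵥ K = 0) (hwL : w ⬝ᵥ L = l * s)
    (hwK : w ⬝ᵥ K = k * t) (hwv : w ⬝ᵥ v = v ⬝ᵥ v) :
    l * s ^ 2 + k * t ^ 2 + v ⬝ᵥ v ≤ w ⬝ᵥ w ∧
      (w ⬝ᵥ w ≤ l * s ^ 2 + k * t ^ 2 + v ⬝ᵥ v → w = s • L + t • K + v) := by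
  have key : (w - (s • L + t • K + v)) ⬝ᵥ (w - (s • L + t • K + v)) =
      w ⬝ᵥ w - (l * s ^ 2 + k * t ^ 2 + v ⬝ᵥ v) := by
    simp only [sub_dotProduct, dotProduct_sub, add_dotProduct, dotProduct_add, smul_dotProduct,
      dotProduct_smul, smul_eq_mul, dotProduct_comm L w, dotProduct_comm K w, dotProduct_comm v w,
      dotProduct_comm L v, dotProduct_comm K v, dotProduct_comm K L, hL, hK, hLK, hLv, hKv, hwL,
      hwK, hwv]
    ring
  have := dotProduct_self_nonneg_int (w - (s • L + t • K + v))
  refine ⟨by linarith, fun h => ?_⟩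
  exact sub_eq_zero.1 (eq_zero_of_dotProduct_self_nonpos (by rw [key]; linarith))

/-- Bessel's inequality for `χ x`, the block to the left of `x`, the block to the right of `x`, and
a vector orthogonal to both. -/
theorem bessel_adjacent (R : ReducedSystem A B a χ U) {x : ℤ} (hx : B x) {v : Fin N → ℤ}
    (hv : χ x ⬝ᵥ v = v ⬝ᵥ v) (hL : ∀ p, IsRun A B a p (x - 1) → v ⬝ᵥ block U p (x - 1) = 0)
    (hR : ∀ q, IsRun A B a x q → v ⬝ᵥ block U x q = 0) :
    ∃ l k : ℤ, ∃ L K : Fin N → ℤ,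
      (χ x ⬝ᵥ U (x - 1) = 0 ∨ 3 ≤ l) ∧
      (χ x ⬝ᵥ U x = 0 ∨ 3 ≤ k) ∧ (∀ q, IsRun A B a x q → k = q - x + 1 ∧ K = block U x q) ∧
      (∀ p, IsRun A B a p (x - 1) → l = x - p ∧ L = block U p (x - 1)) ∧
      l * (χ x ⬝ᵥ U (x - 1)) ^ 2 + k * (χ x ⬝ᵥ U x) ^ 2 + v ⬝ᵥ v ≤ χ x ⬝ᵥ χ x ∧
      (χ x ⬝ᵥ χ x ≤ l * (χ x ⬝ᵥ U (x - 1)) ^ 2 + k * (χ x ⬝ᵥ U x) ^ 2 + v ⬝ᵥ v →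
        χ x = (χ x ⬝ᵥ U (x - 1)) • L + (χ x ⬝ᵥ U x) • K + v) := by
  obtain ⟨l, L, hl1, hl2, hl3, hl4, hl5, hl6⟩ : ∃ l : ℤ, ∃ L : Fin N → ℤ, L ⬝ᵥ L = l ∧ v ⬝ᵥ L = 0 ∧
      χ x ⬝ᵥ L = l * (χ x ⬝ᵥ U (x - 1)) ∧ (χ x ⬝ᵥ U (x - 1) = 0 ∨ 3 ≤ l) ∧
      (∀ p, IsRun A B a p (x - 1) → l = x - p ∧ L = block U p (x - 1)) ∧
      (∀ q, IsRun A B a x q → L ⬝ᵥ block U x q = 0) := by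
    by_cases h : ∃ p, IsRun A B a p (x - 1)
    · obtain ⟨p, hp⟩ := h
      have h2 := hp.two_le
      refine ⟨x - p, block U p (x - 1), ?_, hL p hp, ?_, Or.inr (by omega), ?_, ?_⟩
      · rw [R.block_dotProduct_block hp]; ring
      · rw [R.dotProduct_block hp hx, R.coeff_last hp hx]; ring
      · intro p' hp'
        rcases R.run_disjoint hp hp' with h | h | h
        · exact ⟨by omega, by rw [h.1]⟩
        · have := hp'.two_le; omega
        · omega
      · intro q hq
        exact R.block_orth hp hq (by omega)
    · refine ⟨0, 0, by simp, by simp, by simp, Or.inl ?_, fun p hp => absurd ⟨p, hp⟩ h, by simp⟩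
      by_contra hc
      exact h (R.exists_left_run hx hc)
  obtain ⟨k, K, hk1, hk2, hk3, hk4, hk5, hk6⟩ : ∃ k : ℤ, ∃ K : Fin N → ℤ, K ⬝ᵥ K = k ∧ v ⬝ᵥ K = 0 ∧
      χ x ⬝ᵥ K = k * (χ x ⬝ᵥ U x) ∧ (χ x ⬝ᵥ U x = 0 ∨ 3 ≤ k) ∧
      (∀ q, IsRun A B a x q → k = q - x + 1 ∧ K = block U x q) ∧ L ⬝ᵥ K = 0 := by
    by_cases h : ∃ q, IsRun A B a x q
    · obtain ⟨q, hq⟩ := h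
      have h2 := hq.two_le
      refine ⟨q - x + 1, block U x q, R.block_dotProduct_block hq, hR q hq,
        R.dotProduct_block hq hx, Or.inr (by omega), ?_, hl6 q hq⟩
      intro q' hq'
      rcases R.run_disjoint hq hq' with h | h | h
      · rw [h.2]; simp
      · omega
      · have := hq'.two_le; omega
    · refine ⟨0, 0, by simp, by simp, by simp, Or.inl ?_, fun p hp => absurd ⟨p, hp⟩ h, by simp⟩
      by_contra hc
      exact h (R.exists_right_run hx hc)
  exact ⟨l, k, L, K, hl4, hk4, hk5, hl5, bessel hl1 hk1 hk6 hl2 hk2 hl3 hk3 hv⟩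

theorem budget (R : ReducedSystem A B a χ U) {x : ℤ} (hx : B x) {v : Fin N → ℤ} {β : ℤ}
    (hβ : χ x ⬝ᵥ χ x + 2 * (χ x ⬝ᵥ U (x - 1) - χ x ⬝ᵥ U x) = β)
    (hv : χ x ⬝ᵥ v = v ⬝ᵥ v) (hL : ∀ p, IsRun A B a p (x - 1) → v ⬝ᵥ block U p (x - 1) = 0)
    (hR : ∀ q, IsRun A B a x q → v ⬝ᵥ block U x q = 0) :
    v ⬝ᵥ v + (χ x ⬝ᵥ U (x - 1)) ^ 2 + (χ x ⬝ᵥ U x) ^ 2 ≤ β ∧ (β ≤ v ⬝ᵥ v → χ x = v) := by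
  obtain ⟨l, k, L, K, h1, h2, -, -, h3, h4⟩ := R.bessel_adjacent hx hv hL hR
  set s := χ x ⬝ᵥ U (x - 1)
  set t := χ x ⬝ᵥ U x
  have e1 : s ^ 2 ≤ l * s ^ 2 + 2 * s := by
    rcases h1 with h1 | h1
    · rw [h1]; simp
    · rcases lt_trichotomy s 0 with h | h | h <;> nlinarith
  have e2 : t ^ 2 ≤ k * t ^ 2 - 2 * t := by
    rcases h2 with h2 | h2
    · rw [h2]; simp
    · rcases lt_trichotomy t 0 with h | h | h <;> nlinarith
  have e3 : v ⬝ᵥ v + s ^ 2 + t ^ 2 ≤ β := by linarith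
  refine ⟨e3, fun h => ?_⟩
  have s0 : s = 0 := by nlinarith [sq_nonneg s, sq_nonneg t]
  have t0 : t = 0 := by nlinarith [sq_nonneg s, sq_nonneg t]
  rw [s0, t0] at h4 hβ
  simpa using h4 (by linarith)

theorem budget_right (R : ReducedSystem A B a χ U) {x q : ℤ} (hq : IsRun A B a x q) {v : Fin N → ℤ}
    {β : ℤ} (hβ : χ x ⬝ᵥ χ x + 2 * (χ x ⬝ᵥ U (x - 1) - χ x ⬝ᵥ U x) = β)
    (hv : χ x ⬝ᵥ v = v ⬝ᵥ v) (hL : ∀ p, IsRun A B a p (x - 1) → v ⬝ᵥ block U p (x - 1) = 0)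
    (hR : v ⬝ᵥ block U x q = 0) :
    v ⬝ᵥ v + (χ x ⬝ᵥ U (x - 1)) ^ 2 + (q - x + 1) * (χ x ⬝ᵥ U x) ^ 2 - 2 * (χ x ⬝ᵥ U x) ≤ β ∧
      (β ≤ v ⬝ᵥ v + (q - x + 1) * (χ x ⬝ᵥ U x) ^ 2 - 2 * (χ x ⬝ᵥ U x) →
        χ x = (χ x ⬝ᵥ U x) • block U x q + v) := by
  obtain ⟨l, k, L, K, h1, h2, h5, -, h3, h4⟩ := R.bessel_adjacent hq.left hv hL (by
    intro q' hq'
    rcases R.run_disjoint hq hq' with h | h | h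
    · rwa [← h.2]
    · have := hq.two_le; omega
    · have := hq'.two_le; omega)
  obtain ⟨rfl, rfl⟩ := h5 q hq
  set s := χ x ⬝ᵥ U (x - 1)
  set t := χ x ⬝ᵥ U x
  have e1 : s ^ 2 ≤ l * s ^ 2 + 2 * s := by
    rcases h1 with h1 | h1
    · rw [h1]; simp
    · rcases lt_trichotomy s 0 with h | h | h <;> nlinarith
  have e3 : v ⬝ᵥ v + s ^ 2 + (q - x + 1) * t ^ 2 - 2 * t ≤ β := by linarith
  refine ⟨e3, fun h => ?_⟩
  have s0 : s = 0 := by nlinarith [sq_nonneg s]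
  rw [s0] at h4 hβ
  simpa using h4 (by linarith)

theorem budget_left (R : ReducedSystem A B a χ U) {x p : ℤ} (hp : IsRun A B a p (x - 1))
    {v : Fin N → ℤ} {β : ℤ} (hβ : χ x ⬝ᵥ χ x + 2 * (χ x ⬝ᵥ U (x - 1) - χ x ⬝ᵥ U x) = β)
    (hv : χ x ⬝ᵥ v = v ⬝ᵥ v) (hR : ∀ q, IsRun A B a x q → v ⬝ᵥ block U x q = 0)
    (hL : v ⬝ᵥ block U p (x - 1) = 0) :
    v ⬝ᵥ v + (χ x ⬝ᵥ U x) ^ 2 + (x - p) * (χ x ⬝ᵥ U p) ^ 2 + 2 * (χ x ⬝ᵥ U p) ≤ β ∧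
      (β ≤ v ⬝ᵥ v + (x - p) * (χ x ⬝ᵥ U p) ^ 2 + 2 * (χ x ⬝ᵥ U p) →
        χ x = (χ x ⬝ᵥ U p) • block U p (x - 1) + v) := by
  have hx : B x := by simpa using hp.right
  obtain ⟨l, k, L, K, h1, h2, -, h5, h3, h4⟩ := R.bessel_adjacent hx hv (by
    intro p' hp'
    rcases R.run_disjoint hp hp' with h | h | h
    · rwa [← h.1]
    · have := hp'.two_le; omega
    · have := hp.two_le; omega) hR
  obtain ⟨rfl, rfl⟩ := h5 p hp
  rw [R.coeff_last hp hx] at h1 h3 h4 hβ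
  set s := χ x ⬝ᵥ U p
  set t := χ x ⬝ᵥ U x
  have e1 : t ^ 2 ≤ k * t ^ 2 - 2 * t := by
    rcases h2 with h1 | h1
    · rw [h1]; simp
    · rcases lt_trichotomy t 0 with h | h | h <;> nlinarith
  have e3 : v ⬝ᵥ v + t ^ 2 + (x - p) * s ^ 2 + 2 * s ≤ β := by linarith
  refine ⟨e3, fun h => ?_⟩
  have s0 : t = 0 := by nlinarith [sq_nonneg t]
  rw [s0] at h4 hβ
  simpa using h4 (by linarith)

end ReducedSystem

namespace ReducedSystem

variable {N : ℕ} {A B : ℤ → Prop} {a : ℤ → ℤ} {χ U : ℤ → Fin N → ℤ}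

theorem one_le_sq_of_ne_zero {s : ℤ} (h : s ≠ 0) : 1 ≤ s ^ 2 := by
  have := pow_pos (abs_pos.2 h) 2
  rw [sq_abs] at this
  omega

theorem eq_one_of_mul_sq_le {m s : ℤ} (hm : 2 ≤ m) (hs : s ≠ 0)
    (h : (m + 1) * s ^ 2 - 2 * s ≤ m) : s = 1 := by
  have h1 := one_le_sq_of_ne_zero hs
  rcases lt_trichotomy s 1 with h2 | h2 | h2
  · nlinarith [show s ≤ -1 by omega]
  · exact h2
  · have h3 : 2 ≤ s := by omega
    have h4 : 2 * s ≤ s ^ 2 := by nlinarith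
    nlinarith

theorem run_lt (_ : ReducedSystem A B a χ U) {p q : ℤ} (h : IsRun A B a p q) : p < q := by
  have := h.two_le; omega

theorem perp_block {F : Fin N → ℤ} (hF : ∀ g, F ⬝ᵥ U g = 0) (p q : ℤ) : F ⬝ᵥ block U p q = 0 :=
  dotProduct_block_eq_zero _ _ fun g _ _ => hF g

theorem budget_perp (R : ReducedSystem A B a χ U) {x : ℤ} (hx : B x) {F : Fin N → ℤ} {β : ℤ}
    (hβ : χ x ⬝ᵥ χ x + 2 * (χ x ⬝ᵥ U (x - 1) - χ x ⬝ᵥ U x) = β)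
    (hF : ∀ g, F ⬝ᵥ U g = 0) (hχF : χ x ⬝ᵥ F = F ⬝ᵥ F) :
    F ⬝ᵥ F + (χ x ⬝ᵥ U (x - 1)) ^ 2 + (χ x ⬝ᵥ U x) ^ 2 ≤ β ∧ (β ≤ F ⬝ᵥ F → χ x = F) :=
  R.budget hx hβ hχF (fun _ _ => perp_block hF _ _) (fun _ _ => perp_block hF _ _)

theorem smul_block_add_dotProduct (R : ReducedSystem A B a χ U) {p q s : ℤ} (h : IsRun A B a p q)
    {F : Fin N → ℤ} (hF : ∀ g, F ⬝ᵥ U g = 0) :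
    (s • block U p q + F) ⬝ᵥ (s • block U p q + F) = (q - p + 1) * s ^ 2 + F ⬝ᵥ F := by
  simp only [add_dotProduct, dotProduct_add, smul_dotProduct, dotProduct_smul, smul_eq_mul,
    R.block_dotProduct_block h, perp_block hF, dotProduct_comm (block U p q) F]
  ring

theorem dotProduct_smul_block_add (R : ReducedSystem A B a χ U) {x p q : ℤ} (hx : B x)
    (h : IsRun A B a p q) {F : Fin N → ℤ} (hχF : χ x ⬝ᵥ F = F ⬝ᵥ F) :
    χ x ⬝ᵥ ((χ x ⬝ᵥ U p) • block U p q + F) = (q - p + 1) * (χ x ⬝ᵥ U p) ^ 2 + F ⬝ᵥ F := by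
  simp only [dotProduct_add, dotProduct_smul, smul_eq_mul, R.dotProduct_block h hx, hχF]
  ring

theorem budget_far (R : ReducedSystem A B a χ U) {x p q : ℤ} (hx : B x) (h : IsRun A B a p q)
    (hp : x ≠ p) (hq : x ≠ q + 1) {F : Fin N → ℤ} {β : ℤ}
    (hβ : χ x ⬝ᵥ χ x + 2 * (χ x ⬝ᵥ U (x - 1) - χ x ⬝ᵥ U x) = β)
    (hF : ∀ g, F ⬝ᵥ U g = 0) (hχF : χ x ⬝ᵥ F = F ⬝ᵥ F) :
    (q - p + 1) * (χ x ⬝ᵥ U p) ^ 2 + F ⬝ᵥ F + (χ x ⬝ᵥ U (x - 1)) ^ 2 + (χ x ⬝ᵥ U x) ^ 2 ≤ β ∧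
      (β ≤ (q - p + 1) * (χ x ⬝ᵥ U p) ^ 2 + F ⬝ᵥ F →
        χ x = (χ x ⬝ᵥ U p) • block U p q + F) := by
  have e := R.smul_block_add_dotProduct (s := χ x ⬝ᵥ U p) h hF
  have := R.budget hx (v := (χ x ⬝ᵥ U p) • block U p q + F) hβ
    (by rw [e, R.dotProduct_smul_block_add hx h hχF]) ?_ ?_
  · rwa [e] at this
  · intro p' hp'
    rw [add_dotProduct, smul_dotProduct, perp_block hF, R.block_orth h hp', smul_zero, add_zero]
    rintro rfl
    rcases R.run_disjoint h hp' with h1 | h1 | h1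
    · omega
    · have := R.run_lt h; omega
    · have := R.run_lt hp'; omega
  · intro q' hq'
    rw [add_dotProduct, smul_dotProduct, perp_block hF, R.block_orth h hq' hp.symm, smul_zero,
      add_zero]

/-- The weight available to `χ x` is at most `a x + 1`. -/
theorem norm_le (R : ReducedSystem A B a χ U) {x : ℤ} (hx : B x) :
    χ x ⬝ᵥ χ x + 2 * (χ x ⬝ᵥ U (x - 1) - χ x ⬝ᵥ U x) ≤ a x + 1 := by
  by_cases h1 : B (x - 1)
  · exact (R.norm_left x hx h1).le
  · by_cases h2 : B (x + 1)
    · exact (R.norm_right x hx h2).le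
    · linarith [R.norm_free x hx h1 h2]

theorem add_three_le_of_far (R : ReducedSystem A B a χ U) {x p q : ℤ} (hx : B x)
    (h : IsRun A B a p q) (hp : x ≠ p) (hq : x ≠ q + 1) (hne : χ x ⬝ᵥ U p ≠ 0) {F : Fin N → ℤ}
    (hF : ∀ g, F ⬝ᵥ U g = 0) (hχF : χ x ⬝ᵥ F = F ⬝ᵥ F) :
    (q - p + 1) + F ⬝ᵥ F ≤ χ x ⬝ᵥ χ x + 2 * (χ x ⬝ᵥ U (x - 1) - χ x ⬝ᵥ U x) := by
  have := (R.budget_far hx h hp hq rfl hF hχF).1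
  have h6 : 1 ≤ (χ x ⬝ᵥ U p) ^ 2 := one_le_sq_of_ne_zero hne
  have h7 := h.two_le
  nlinarith [sq_nonneg (χ x ⬝ᵥ U (x - 1)), sq_nonneg (χ x ⬝ᵥ U x)]

theorem exists_right_split (R : ReducedSystem A B a χ U) {x : ℤ} (hx : B x)
    (hc : χ x ⬝ᵥ U x ≠ 0) : ∃ q F, IsRun A B a x q ∧ χ x = block U x q + F ∧
      (∀ g, F ⬝ᵥ U g = 0) ∧ (B (x - 1) → F ⬝ᵥ F = a x + 2 - (q - x)) ∧
      (¬ B (x - 1) → F = 0 ∧ a x + 1 = q - x) := by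
  obtain ⟨q, hq⟩ := R.exists_right_run hx hc
  have hm := hq.two_le
  have hma := hq.left_le
  have hB : ¬ B (x + 1) := R.disj _ (hq.zero _ (by omega) (by omega))
  have hβ := R.norm_le hx
  have b0 := (R.budget_right hq (v := 0) rfl (by simp) (by simp) (by simp)).1
  rw [zero_dotProduct] at b0
  have c1 : χ x ⬝ᵥ U x = 1 := by
    have := sq_nonneg (χ x ⬝ᵥ U (x - 1))
    exact eq_one_of_mul_sq_le hm hc (by linarith)
  rw [c1] at b0
  have l0 : χ x ⬝ᵥ U (x - 1) = 0 := by
    by_cases hl : B (x - 1)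
    · exact R.coeff_eq_zero_of_adj hl (by simpa using hx) _
    · have := R.norm_free x hx hl hB
      rw [c1] at this
      by_contra hne
      have : 1 ≤ (χ x ⬝ᵥ U (x - 1)) ^ 2 := one_le_sq_of_ne_zero hne
      linarith
  have hself := R.block_dotProduct_block hq
  have hχb := R.dotProduct_block hq hx
  rw [c1] at hχb
  rw [l0, c1] at hβ
  have hFF : (χ x - block U x q) ⬝ᵥ (χ x - block U x q) = χ x ⬝ᵥ χ x - (q - x + 1) := by
    simp only [sub_dotProduct, dotProduct_sub, dotProduct_comm (block U x q) (χ x), hself, hχb]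
    ring
  refine ⟨q, χ x - block U x q, hq, by abel, ?_, ?_, ?_⟩
  · intro g
    rw [sub_dotProduct, R.block_dotProduct_gap hq]
    split_ifs with hg
    · rw [R.coeff_eq hq hx hg.1 hg.2, c1]; rfl
    · rw [sub_zero]
      by_contra hne
      obtain ⟨p', q', h1, h2, h3⟩ := R.exists_run_of_coeff_ne_zero hne
      have hne' := hne
      rw [R.coeff_eq h3 hx h1 h2] at hne
      have hpp : p' ≠ x := by
        rintro rfl
        rcases R.run_disjoint hq h3 with h | h | h
        · omega
        · omega
        · have := R.run_lt h3; omega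
      have h5 := h3.two_le
      have h6 : 1 ≤ (χ x ⬝ᵥ U p') ^ 2 := one_le_sq_of_ne_zero hne
      have hqq : q' ≠ x - 1 := by
        rintro rfl
        rw [← R.coeff_last h3 hx, l0] at hne
        exact hne rfl
      have e0 := R.smul_block_add_dotProduct (s := χ x ⬝ᵥ U p') h3 (F := 0) (by simp)
      have e1 := R.dotProduct_smul_block_add hx h3 (F := 0) (by simp)
      simp only [add_zero, dotProduct_zero] at e0 e1
      have := (R.budget_right hq (v := (χ x ⬝ᵥ U p') • block U p' q') rfl (by rw [e0, e1]) ?_ ?_).1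
      · rw [e0, c1, l0] at this
        nlinarith
      · intro p'' hp''
        rw [smul_dotProduct, R.block_orth h3 hp'', smul_zero]
        rintro rfl
        rcases R.run_disjoint h3 hp'' with h | h | h
        · exact hqq h.2
        · have := R.run_lt h3; omega
        · have := R.run_lt hp''; omega
      · rw [smul_dotProduct, R.block_orth h3 hq hpp, smul_zero]
  · intro hl
    have := R.norm_left x hx hl
    rw [c1, l0] at this
    rw [hFF]; linarith
  · intro hl
    have := R.norm_free x hx hl hB
    rw [c1, l0] at this
    have h0 := dotProduct_self_nonneg_int (χ x - block U x q)
    exact ⟨eq_zero_of_dotProduct_self_nonpos (by linarith), by linarith⟩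

theorem B_left_of_right_coeff_ne_zero (R : ReducedSystem A B a χ U) {x : ℤ} (hx : B x)
    (hc : χ x ⬝ᵥ U x ≠ 0) : B (x - 1) := by
  by_contra hl
  obtain ⟨q, F, hq, h1, -, -, h4⟩ := R.exists_right_split hx hc
  obtain ⟨rfl, h5⟩ := h4 hl
  rw [add_zero] at h1
  have hm := hq.two_le
  have hy := hq.right
  have hya := hq.right_le
  have ay : a (q + 1) = 1 := by
    have h2 := R.one_le _ hy
    by_contra hne
    have := R.unique x (q + 1) hx hy (by omega) (by omega)
    omega
  have hxy := R.prod_far x (q + 1) hx hy (by omega)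
  rw [add_sub_cancel_right, h1, dotProduct_comm, R.dotProduct_block hq hy,
    R.block_dotProduct_gap hq, R.block_dotProduct_gap hq, if_pos (by omega), if_neg (by omega)] at hxy
  have h6 : χ (q + 1) ⬝ᵥ U (x - 1) = 0 := by
    by_contra hne
    obtain ⟨p, hp⟩ := R.exists_left_run hx hne
    rw [R.coeff_last hp hy] at hne
    have := R.add_three_le_of_far hy hp (by have := R.run_lt hp; omega) (by omega) hne (F := 0)
      (by simp) (by simp)
    have h7 := R.norm_le hy
    have h9 := hp.two_le
    rw [dotProduct_zero] at this
    omega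
  rw [h6] at hxy
  have h8 : (q - x) * (χ (q + 1) ⬝ᵥ U x) = -1 := by linarith
  have : (q - x) ∣ 1 := ⟨-(χ (q + 1) ⬝ᵥ U x), by linarith⟩
  have := Int.le_of_dvd one_pos this
  omega

end ReducedSystem

namespace ReducedSystem

variable {N : ℕ} {A B : ℤ → Prop} {a : ℤ → ℤ} {χ U : ℤ → Fin N → ℤ}

theorem smul_perp {F : Fin N → ℤ} (hF : ∀ g, F ⬝ᵥ U g = 0) (t : ℤ) (g : ℤ) :
    (t • F) ⬝ᵥ U g = 0 := by
  rw [smul_dotProduct, hF, smul_zero]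

theorem smul_self {F v : Fin N → ℤ} (hF : F ⬝ᵥ F = 1) :
    v ⬝ᵥ ((F ⬝ᵥ v) • F) = ((F ⬝ᵥ v) • F) ⬝ᵥ ((F ⬝ᵥ v) • F) ∧
      ((F ⬝ᵥ v) • F) ⬝ᵥ ((F ⬝ᵥ v) • F) = (F ⬝ᵥ v) ^ 2 := by
  simp only [dotProduct_smul, smul_dotProduct, hF, smul_eq_mul, dotProduct_comm v F]
  exact ⟨by ring, by ring⟩

theorem no_31001' (R : ReducedSystem A B a χ U) {z q : ℤ} (hz : B z)
    (hq : IsRun A B a (z + 1) q) (hm : q - (z + 1) = 2) (hy : a (q + 1) = 1)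
    (h3 : a z = 3) : False := by
  obtain rfl : q = z + 3 := by omega
  have ax : a (z + 1) = 1 := by
    have h1 := R.one_le _ hq.left
    by_contra hne
    have := R.unique z (z + 1) hz hq.left (by omega) (by omega)
    omega
  have h4 := hq.right
  rw [show z + 3 + 1 = z + 4 by ring] at h4 hy
  exact R.no_31001 z hz hq.left (hq.zero _ (by omega) (by omega)) (hq.zero _ (by omega) (by omega))
    h4 h3 ax hy

theorem right_coeff_eq_zero_aux (R : ReducedSystem A B a χ U) {z q : ℤ} (hz : B z)
    (hq : IsRun A B a (z + 1) q) {F : Fin N → ℤ} (hχ : χ (z + 1) = block U (z + 1) q + F)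
    (hF : ∀ g, F ⬝ᵥ U g = 0) (hFF : F ⬝ᵥ F = 1) (hm : a (z + 1) + 1 = q - (z + 1)) : False := by
  have hx := hq.left
  have hm2 := hq.two_le
  have hy := hq.right
  have hya := hq.right_le
  have h1x := R.one_le _ hx
  have h1y := R.one_le _ hy
  have h1z := R.one_le _ hz
  have h3z := R.le_three _ hz
  have hyl : ¬ B (q + 1 - 1) := by
    rw [add_sub_cancel_right]
    exact R.disj _ (hq.zero _ (by omega) le_rfl)
  have ay : a (q + 1) = 1 := by
    by_contra hne
    have := R.unique (z + 1) (q + 1) hx hy (by omega) (by omega)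
    omega
  have hq' : IsRun A B a (z + 1) (q + 1 - 1) := by rwa [add_sub_cancel_right]
  have zU (v : Fin N → ℤ) : v ⬝ᵥ U z = 0 := R.coeff_eq_zero_of_adj hz hx v
  have hzx := R.prod_adj z hz hx
  rw [hχ, dotProduct_add, R.dotProduct_block hq hz, add_dotProduct, hF, R.block_dotProduct_gap hq,
    if_neg (by omega), dotProduct_comm _ F] at hzx
  have hxy := R.prod_far (z + 1) (q + 1) hx hy (by omega)
  rw [add_sub_cancel_right, add_sub_cancel_right, hχ, dotProduct_comm, dotProduct_add,
    R.dotProduct_block hq hy, add_dotProduct, hF, add_dotProduct, hF, R.block_dotProduct_gap hq,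
    R.block_dotProduct_gap hq, if_pos (by omega), if_neg (by omega), dotProduct_comm _ F, zU] at hxy
  have hxw (hw : B (q + 1 + 1)) : (q - (z + 1)) * (χ (q + 1 + 1) ⬝ᵥ U (z + 1)) +
      F ⬝ᵥ χ (q + 1 + 1) = 0 := by
    have := R.prod_far (z + 1) (q + 1 + 1) hx hw (by omega)
    rw [add_sub_cancel_right, add_sub_cancel_right, hχ, dotProduct_comm, dotProduct_add,
      R.dotProduct_block hq hw, add_dotProduct, hF, add_dotProduct, hF, R.block_dotProduct_gap hq,
      R.block_dotProduct_gap hq, if_neg (by omega), if_neg (by omega), dotProduct_comm _ F, zU]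
      at this
    linarith
  by_cases hdy : χ (q + 1) ⬝ᵥ U (z + 1) = 0
  · rw [hdy] at hxy
    have hFy : F ⬝ᵥ χ (q + 1) = -1 := by linarith
    have hdz : χ z ⬝ᵥ U (z + 1) = 0 := by
      by_contra hne
      have hb := (R.budget_far hz hq (by omega) (by omega) (R.norm_right z hz hx)
        (smul_perp hF (F ⬝ᵥ χ z)) (smul_self hFF).1).1
      rw [(smul_self hFF).2, zU] at hb
      have h1 := one_le_sq_of_ne_zero hne
      have h2 := sq_nonneg (F ⬝ᵥ χ z)
      have h3 := sq_nonneg (χ z ⬝ᵥ U (z - 1))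
      have h4 : a z ≥ 2 := by nlinarith
      have ax : a (z + 1) = 1 := by
        by_contra hne'
        have := R.unique z (z + 1) hz hx (by omega) (by omega)
        omega
      by_cases h5 : a z = 3
      · exact R.no_31001' hz hq (by omega) ay h5
      · have h6 : q - (z + 1) = 2 := by omega
        have h7 : a z = 2 := by omega
        rw [h6] at hb hzx
        have h8 : F ⬝ᵥ χ z ≠ 0 := by omega
        have := one_le_sq_of_ne_zero h8
        linarith
    rw [hdz] at hzx
    have hFz : F ⬝ᵥ χ z = -1 := by linarith
    by_cases hw : B (q + 1 + 1)
    · have hnorm := R.norm_right _ hy hw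
      have yU (v : Fin N → ℤ) : v ⬝ᵥ U (q + 1) = 0 := R.coeff_eq_zero_of_adj hy hw v
      have hy0 (g : ℤ) : χ (q + 1) ⬝ᵥ U g = 0 := by
        by_contra hne
        obtain ⟨p', q', h1, h2, h3⟩ := R.exists_run_of_coeff_ne_zero hne
        have hne' := hne
        rw [R.coeff_eq h3 hy h1 h2] at hne
        have h4 := R.run_lt h3
        have h5 := h3.two_le
        have hp : q + 1 ≠ p' := by
          rintro rfl
          exact R.disj _ (h3.zero (q + 1 + 1) (by omega) (by omega)) hw
        have hq1 : q + 1 ≠ q' + 1 := by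
          intro h
          obtain rfl : q = q' := by omega
          rcases R.run_disjoint h3 hq with h6 | h6 | h6
          · exact hne (by rw [h6.1, hdy])
          · omega
          · omega
        have := R.add_three_le_of_far hy h3 hp hq1 hne (F := 0) (by simp) (by simp)
        rw [dotProduct_zero] at this
        omega
      rw [hy0, hy0] at hnorm
      obtain ⟨G, hG⟩ : ∃ G, G = χ (q + 1) + F := ⟨_, rfl⟩
      have hχy : χ (q + 1) = G - F := by rw [hG]; abel
      have hGU (g : ℤ) : G ⬝ᵥ U g = 0 := by rw [hG, add_dotProduct, hF, hy0, add_zero]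
      have hFG : F ⬝ᵥ G = 0 := by rw [hG, dotProduct_add, hFy, hFF]; rfl
      have hGG : G ⬝ᵥ G = 1 := by
        rw [hχy] at hnorm
        simp only [sub_dotProduct, dotProduct_sub, dotProduct_comm G F, hFG, hFF] at hnorm
        linarith
      have hzy := R.prod_far z (q + 1) hz hy (by omega)
      rw [hy0, hy0, add_sub_cancel_right, R.coeff_last hq hz, hdz, yU, hχy, dotProduct_comm,
        sub_dotProduct, hFz] at hzy
      have hyw := R.prod_adj (q + 1) hy hw
      rw [hy0, add_sub_cancel_right, R.coeff_last hq hw, hχy, sub_dotProduct] at hyw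
      have hxw := hxw hw
      have h3w := R.le_three _ hw
      have hnw := R.norm_left (q + 1 + 1) hw (by rwa [add_sub_cancel_right])
      have hdw : χ (q + 1 + 1) ⬝ᵥ U (z + 1) = 0 := by
        by_contra hne
        have hb := (R.budget_far hw hq (by omega) (by omega) hnw
          (smul_perp hF (F ⬝ᵥ χ (q + 1 + 1))) (smul_self hFF).1).1
        rw [(smul_self hFF).2, show F ⬝ᵥ χ (q + 1 + 1) =
          -((q - (z + 1)) * (χ (q + 1 + 1) ⬝ᵥ U (z + 1))) by linarith] at hb
        have h1 := one_le_sq_of_ne_zero hne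
        have h2 := sq_nonneg (χ (q + 1 + 1) ⬝ᵥ U (q + 1 + 1 - 1))
        have h3 := sq_nonneg (χ (q + 1 + 1) ⬝ᵥ U (q + 1 + 1))
        have h4 : 4 ≤ (-((q - (z + 1)) * (χ (q + 1 + 1) ⬝ᵥ U (z + 1)))) ^ 2 := by
          rw [neg_sq, mul_pow]
          nlinarith
        nlinarith
      rw [hdw] at hxw hyw
      have hFw : F ⬝ᵥ χ (q + 1 + 1) = 0 := by linarith
      have hGw : G ⬝ᵥ χ (q + 1 + 1) = -1 := by linarith
      by_cases haz : a z = 1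
      · have hFG2 : (-(F + G)) ⬝ᵥ (-(F + G)) = 2 := by
          simp only [neg_dotProduct, dotProduct_neg, add_dotProduct, dotProduct_add, hFF, hGG, hFG,
            dotProduct_comm G F]
          norm_num
        have hχz := (R.budget_perp hz (F := -(F + G)) (R.norm_right z hz hx)
          (fun g => by rw [neg_dotProduct, add_dotProduct, hF, hGU]; rfl)
          (by rw [hFG2, dotProduct_comm, neg_dotProduct, add_dotProduct]; linarith)).2
            (by rw [hFG2, haz]; norm_num)
        have hzw := R.prod_far z (q + 1 + 1) hz hw (by omega)
        rw [zU, hχz, neg_dotProduct, neg_dotProduct, neg_dotProduct, add_dotProduct, add_dotProduct,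
          add_dotProduct, hF, hF, hGU, hGU, hFw, hGw] at hzw
        have hne : χ (q + 1 + 1) ⬝ᵥ U (z - 1) ≠ 0 := by intro h; rw [h] at hzw; norm_num at hzw
        obtain ⟨p', hp'⟩ := R.exists_left_run hz hne
        have h2 := hp'.two_le
        rw [R.coeff_last hp' hw] at hne
        have := R.add_three_le_of_far hw hp' (by omega) (by omega) hne (F := -G)
          (fun g => by rw [neg_dotProduct, hGU]; rfl)
          (by rw [neg_dotProduct, dotProduct_neg, dotProduct_neg, hGG, dotProduct_comm, hGw])
        rw [neg_dotProduct, dotProduct_neg, hGG, hnw] at this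
        have haw : a (q + 1 + 1) = 3 := by omega
        have ax : a (z + 1) = 1 := by
          by_contra hne'
          have := R.unique (q + 1 + 1) (z + 1) hw hx (by omega) (by omega)
          omega
        obtain rfl : q = z + 3 := by omega
        have := R.no_10013 (z + 1) hx (hq.zero _ (by omega) (by omega))
          (hq.zero _ (by omega) (by omega))
        rw [show z + 1 + 3 = z + 3 + 1 by ring, show z + 1 + 4 = z + 3 + 1 + 1 by ring] at this
        exact this hy hw ax ay haw
      · have ax : a (z + 1) = 1 := by
          by_contra hne'
          have := R.unique z (z + 1) hz hx (by omega) (by omega)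
          omega
        have aw : a (q + 1 + 1) = 1 := by
          have := R.one_le _ hw
          by_contra hne'
          have := R.unique z (q + 1 + 1) hz hw (by omega) (by omega)
          omega
        by_cases h5 : a z = 3
        · exact R.no_31001' hz hq (by omega) ay h5
        · obtain rfl : q = z + 3 := by omega
          have := R.no_210011 z hz hx (hq.zero _ (by omega) (by omega))
            (hq.zero _ (by omega) (by omega))
          rw [show z + 4 = z + 3 + 1 by ring, show z + 5 = z + 3 + 1 + 1 by ring] at this
          exact this hy hw (by omega) ax ay aw
    · have hχy := (R.budget_perp hy (F := -F) (R.norm_free _ hy hyl hw)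
          (fun g => by rw [neg_dotProduct, hF]; rfl)
          (by rw [neg_dotProduct, dotProduct_neg, dotProduct_neg, hFF, dotProduct_comm, hFy])).2
            (by rw [neg_dotProduct, dotProduct_neg, hFF, ay]; norm_num)
      have hzy := R.prod_far z (q + 1) hz hy (by omega)
      rw [hχy, add_sub_cancel_right, R.coeff_last hq hz, hdz, neg_dotProduct, neg_dotProduct, hF, hF,
        dotProduct_neg, dotProduct_comm, hFz] at hzy
      have hne : χ z ⬝ᵥ U (q + 1) ≠ 0 := by intro h; rw [h] at hzy; norm_num at hzy
      obtain ⟨q', hq''⟩ := R.exists_right_run hy hne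
      have h2 := hq''.two_le
      have := R.add_three_le_of_far hz hq'' (by omega) (by omega) hne (F := -F)
        (fun g => by rw [neg_dotProduct, hF]; rfl)
        (by rw [neg_dotProduct, dotProduct_neg, dotProduct_neg, hFF, dotProduct_comm, hFz])
      rw [neg_dotProduct, dotProduct_neg, hFF, R.norm_right z hz hx] at this
      have h5 : a z = 3 := by omega
      have ax : a (z + 1) = 1 := by
        by_contra hne'
        have := R.unique z (z + 1) hz hx (by omega) (by omega)
        omega
      exact R.no_31001' hz hq (by omega) ay h5
  · have hb := R.budget_left hq' rfl (smul_self hFF).1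
      (fun _ _ => perp_block (smul_perp hF (F ⬝ᵥ χ (q + 1))) _ _)
      (perp_block (smul_perp hF (F ⬝ᵥ χ (q + 1))) _ _)
    rw [(smul_self hFF).2] at hb
    have hnl := R.norm_le hy
    have h2 := sq_nonneg (χ (q + 1) ⬝ᵥ U (q + 1))
    have h3 := sq_nonneg (F ⬝ᵥ χ (q + 1))
    have hd : -(χ (q + 1) ⬝ᵥ U (z + 1)) = 1 := by
      refine eq_one_of_mul_sq_le hm2 (neg_ne_zero.2 hdy) ?_
      linarith [hb.1]
    have hd' : χ (q + 1) ⬝ᵥ U (z + 1) = -1 := by linarith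
    rw [hd'] at hxy hb
    have hFy : F ⬝ᵥ χ (q + 1) = q - (z + 1) - 1 := by linarith
    rw [hFy] at hb
    have hq2 : q = z + 3 := by
      have h4 : q - (z + 1) - 1 ≤ 1 := by nlinarith [hb.1]
      omega
    subst hq2
    have hw : B (z + 3 + 1 + 1) := by
      by_contra hw
      have := R.norm_free _ hy hyl hw
      have := hb.1
      nlinarith
    have hχy := hb.2 (by linarith)
    rw [show z + 3 - (z + 1) - 1 = 1 by ring, one_smul, add_sub_cancel_right, neg_smul, one_smul]
      at hχy
    have hyw := R.prod_adj _ hy hw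
    rw [hχy, add_dotProduct, add_dotProduct, neg_dotProduct, neg_dotProduct, hF,
      dotProduct_comm (block U _ _) (χ _), R.dotProduct_block hq hw, R.block_dotProduct_gap hq,
      if_neg (by omega), add_sub_cancel_right, R.coeff_last hq hw] at hyw
    have := hxw hw
    ring_nf at this hyw
    omega

theorem right_coeff_eq_zero (R : ReducedSystem A B a χ U) {x : ℤ} (hx : B x) :
    χ x ⬝ᵥ U x = 0 := by
  by_contra hc
  have hz := R.B_left_of_right_coeff_ne_zero hx hc
  obtain ⟨q, F, hq, h1, h2, h3, -⟩ := R.exists_right_split hx hc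
  have h3 := h3 hz
  obtain ⟨z, rfl⟩ : ∃ z, x = z + 1 := ⟨x - 1, by ring⟩
  rw [add_sub_cancel_right] at hz
  have h4 := hq.left_le
  have h5 := hq.two_le
  have h0 := dotProduct_self_nonneg_int F
  by_cases hm : a (z + 1) + 1 = q - (z + 1)
  · exact R.right_coeff_eq_zero_aux hz hq h1 h2 (by omega) hm
  · obtain rfl : F = 0 := eq_zero_of_dotProduct_self_nonpos (by omega)
    have hzx := R.prod_adj z hz hx
    rw [h1, add_zero, R.dotProduct_block hq hz, R.block_dotProduct_gap hq,
      if_neg (by omega)] at hzx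
    have : (q - (z + 1)) ∣ 1 := ⟨-(χ z ⬝ᵥ U (z + 1)), by linarith⟩
    have := Int.le_of_dvd one_pos this
    omega

theorem left_coeff_eq_zero (R : ReducedSystem A B a χ U) {x : ℤ} (hx : B x) :
    χ x ⬝ᵥ U (x - 1) = 0 := by
  have := R.reflect.right_coeff_eq_zero (x := -x) (by simpa using hx)
  simpa using this

end ReducedSystem

namespace ReducedSystem

variable {N : ℕ} {A B : ℤ → Prop} {a : ℤ → ℤ} {χ U : ℤ → Fin N → ℤ}

theorem norm_eq_of_free (R : ReducedSystem A B a χ U) {x : ℤ} (hx : B x) (hl : ¬ B (x - 1))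
    (hr : ¬ B (x + 1)) : χ x ⬝ᵥ χ x = a x := by
  have := R.norm_free x hx hl hr
  rw [R.right_coeff_eq_zero hx, R.left_coeff_eq_zero hx] at this
  simpa using this

theorem norm_eq_of_right (R : ReducedSystem A B a χ U) {x : ℤ} (hx : B x) (hr : B (x + 1)) :
    χ x ⬝ᵥ χ x = a x + 1 := by
  have := R.norm_right x hx hr
  rw [R.right_coeff_eq_zero hx, R.left_coeff_eq_zero hx] at this
  simpa using this

theorem norm_eq_of_left (R : ReducedSystem A B a χ U) {x : ℤ} (hx : B x) (hl : B (x - 1)) :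
    χ x ⬝ᵥ χ x = a x + 1 := by
  have := R.norm_left x hx hl
  rw [R.right_coeff_eq_zero hx, R.left_coeff_eq_zero hx] at this
  simpa using this

theorem norm_le_add_one (R : ReducedSystem A B a χ U) {x : ℤ} (hx : B x) :
    χ x ⬝ᵥ χ x ≤ a x + 1 := by
  have := R.norm_le hx
  rw [R.right_coeff_eq_zero hx, R.left_coeff_eq_zero hx] at this
  simpa using this

theorem three_le_norm_of_coeff_ne_zero (R : ReducedSystem A B a χ U) {x g : ℤ} (hx : B x)
    (hg : χ x ⬝ᵥ U g ≠ 0) : ∃ p q, p ≤ g ∧ g ≤ q ∧ IsRun A B a p q ∧ x ≠ p ∧ x ≠ q + 1 ∧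
      χ x ⬝ᵥ U p ≠ 0 ∧ q - p + 1 ≤ χ x ⬝ᵥ χ x := by
  obtain ⟨p, q, h1, h2, h3⟩ := R.exists_run_of_coeff_ne_zero hg
  rw [R.coeff_eq h3 hx h1 h2] at hg
  have hp : x ≠ p := by rintro rfl; exact hg (R.right_coeff_eq_zero hx)
  have hq : x ≠ q + 1 := by
    rintro rfl
    refine hg ?_
    rw [← R.coeff_last h3 hx]
    simpa using R.left_coeff_eq_zero hx
  refine ⟨p, q, h1, h2, h3, hp, hq, hg, ?_⟩
  have := R.add_three_le_of_far hx h3 hp hq hg (F := 0) (by simp) (by simp)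
  rw [R.right_coeff_eq_zero hx, R.left_coeff_eq_zero hx] at this
  simpa using this

theorem two_le_of_coeff_ne_zero (R : ReducedSystem A B a χ U) {x g : ℤ} (hx : B x)
    (hg : χ x ⬝ᵥ U g ≠ 0) : 2 ≤ a x := by
  obtain ⟨p, q, -, -, h3, -, -, -, h4⟩ := R.three_le_norm_of_coeff_ne_zero hx hg
  have := h3.two_le
  have := R.norm_le_add_one hx
  omega

theorem prod_of_ne (R : ReducedSystem A B a χ U) {x y : ℤ} (hx : B x) (hy : B y) (hne : x ≠ y)
    (h0 : ∀ g, χ y ⬝ᵥ U g = 0) : χ x ⬝ᵥ χ y + (χ x ⬝ᵥ U (y - 1) - χ x ⬝ᵥ U y) =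
      if x + 1 = y ∨ y + 1 = x then -1 else 0 := by
  split_ifs with h
  · rcases h with rfl | rfl
    · have := R.prod_adj x hx hy
      rw [h0] at this
      rw [add_sub_cancel_right, R.right_coeff_eq_zero hx]
      exact this
    · have := R.prod_adj y hy hx
      rw [h0, dotProduct_comm] at this
      have h2 := R.left_coeff_eq_zero hx
      rw [add_sub_cancel_right] at h2
      rw [h2]
      exact this
  · rcases lt_or_gt_of_ne hne with h1 | h1
    · have := R.prod_far x y hx hy (by omega)
      rw [h0, h0] at this
      linarith
    · have := R.prod_far y x hy hx (by omega)
      rw [h0, h0, dotProduct_comm] at this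
      linarith

theorem coeff_eq_zero (R : ReducedSystem A B a χ U) {x : ℤ} (hx : B x) (g : ℤ) :
    χ x ⬝ᵥ U g = 0 := by
  by_contra hg
  have hax := R.two_le_of_coeff_ne_zero hx hg
  obtain ⟨p, q, -, -, hr, hp, hq, hc, hn⟩ := R.three_le_norm_of_coeff_ne_zero hx hg
  have hn' := R.norm_le_add_one hx
  have h3 := R.le_three x hx
  have hm := hr.two_le
  have hother (y : ℤ) (hy : B y) (hne : x ≠ y) : a y = 1 := by
    have := R.one_le y hy
    by_contra h
    exact hne (R.unique x y hx hy (by omega) (by omega))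
  have hzero (y : ℤ) (hy : B y) (hne : x ≠ y) (g : ℤ) : χ y ⬝ᵥ U g = 0 := by
    by_contra h
    have := R.two_le_of_coeff_ne_zero hy h
    have := hother y hy hne
    omega
  have h1 := hr.left
  have h2 := hr.right
  have hout (h : ℤ) (hh : h < p ∨ q < h) : χ x ⬝ᵥ U h = 0 := by
    by_contra hne
    obtain ⟨p', q', h4, h5, hr', -, -, hc', -⟩ := R.three_le_norm_of_coeff_ne_zero hx hne
    have hpp : p ≠ p' := by
      rintro rfl
      rcases R.run_disjoint hr hr' with h | h | h
      · omega
      · omega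
      · have := R.run_lt hr'; omega
    have hb := (bessel (v := 0) (R.block_dotProduct_block hr) (R.block_dotProduct_block hr')
      (R.block_orth hr hr' hpp) (by simp) (by simp) (R.dotProduct_block hr hx)
      (R.dotProduct_block hr' hx) (by simp)).1
    have h6 := one_le_sq_of_ne_zero hc
    have h7 := one_le_sq_of_ne_zero hc'
    have h8 := hr'.two_le
    rw [zero_dotProduct] at hb
    nlinarith
  obtain ⟨c, hcdef⟩ : ∃ c, c = χ x ⬝ᵥ U p := ⟨_, rfl⟩
  rw [← hcdef] at hc
  have e1 := R.prod_of_ne hx h1 hp (hzero _ h1 hp)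
  have e2 := R.prod_of_ne hx h2 hq (hzero _ h2 hq)
  rw [hout (p - 1) (by omega), ← hcdef] at e1
  rw [hout (q + 1) (by omega), add_sub_cancel_right, R.coeff_last hr hx, ← hcdef] at e2
  have hcb := R.dotProduct_block hr hx
  rw [← hcdef] at hcb
  have hbb := R.block_dotProduct_block hr
  obtain ⟨ρ, hρ⟩ : ∃ ρ, ρ = χ x - c • block U p q := ⟨_, rfl⟩
  have hρρ : ρ ⬝ᵥ ρ = χ x ⬝ᵥ χ x - (q - p + 1) * c ^ 2 := by
    simp only [hρ, sub_dotProduct, dotProduct_sub, smul_dotProduct, dotProduct_smul, smul_eq_mul,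
      dotProduct_comm (block U p q) (χ x), hcb, hbb]
    ring
  have hρy (y : ℤ) (hy : B y) (hne : x ≠ y) : ρ ⬝ᵥ χ y = χ x ⬝ᵥ χ y := by
    rw [hρ, sub_dotProduct, smul_dotProduct, dotProduct_comm (block U p q),
      R.dotProduct_block hr hy, hzero y hy hne]
    simp
  have hc2 : c ^ 2 = 1 := by
    have := one_le_sq_of_ne_zero hc
    have h0 := dotProduct_self_nonneg_int ρ
    nlinarith
  have hc1 : c = 1 ∨ c = -1 := by
    have : (c - 1) * (c + 1) = 0 := by linear_combination hc2
    rcases mul_eq_zero.1 this with h | h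
    · left; omega
    · right; omega
  rw [← hρy _ h1 hp] at e1
  rw [← hρy _ h2 hq] at e2
  rw [hc2] at hρρ
  by_cases hρ0 : ρ = 0
  · rw [hρ0, zero_dotProduct] at e1 e2
    split_ifs at e1 e2 <;> omega
  · have hρ1 : 1 ≤ ρ ⬝ᵥ ρ := by
      by_contra hlt
      exact hρ0 (eq_zero_of_dotProduct_self_nonpos (by omega))
    have hx3 : a x = 3 := by omega
    obtain rfl : q = p + 2 := by omega
    have a1 := hother _ h1 hp
    have a2 := hother _ h2 hq
    have A1 := hr.zero (p + 1) (by omega) (by omega)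
    have A2 := hr.zero (p + 2) (by omega) (by omega)
    have hx1 : ¬ (x + 1 = p ∨ p + 1 = x) := by
      rintro (rfl | rfl)
      · have := R.no_31001 x hx h1
        rw [show x + 1 + 1 = x + 2 by ring] at A1
        rw [show x + 1 + 2 = x + 3 by ring] at A2
        rw [show x + 1 + 2 + 1 = x + 4 by ring] at h2 a2
        exact this A1 A2 h2 hx3 a1 a2
      · exact R.disj _ A1 hx
    have hx2 : ¬ (x + 1 = p + 2 + 1 ∨ p + 2 + 1 + 1 = x) := by
      rintro (h | rfl)
      · rw [show x = p + 2 by omega] at hx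
        exact R.disj _ A2 hx
      · have := R.no_10013 p h1 A1 A2
        rw [show p + 2 + 1 = p + 3 by ring] at h2 a2
        rw [show p + 2 + 1 + 1 = p + 4 by ring] at hx hx3
        exact this h2 hx a1 a2 hx3
    rw [if_neg hx1] at e1
    rw [if_neg hx2] at e2
    have n1 := R.norm_eq_of_free h1 (fun h => R.no_one_one x (p - 1) hx hx3 h (by simpa using h1)
      (hother _ h (by omega)) (by simpa using a1)) (R.disj _ A1)
    have n2 := R.norm_eq_of_free h2 (by simpa using R.disj _ A2)
      (fun h => R.no_one_one x (p + 2 + 1) hx hx3 h2 h a2 (hother _ h (by omega)))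
    have n12 := R.prod_of_ne h1 h2 (by omega) (hzero _ h2 hq)
    rw [hzero _ h1 hp, hzero _ h1 hp, if_neg (by omega)] at n12
    have hsq := dotProduct_self_nonneg_int (ρ - c • χ p + c • χ (p + 2 + 1))
    simp only [add_dotProduct, dotProduct_add, sub_dotProduct, dotProduct_sub, smul_dotProduct,
      dotProduct_smul, smul_eq_mul, dotProduct_comm (χ p) ρ,
      dotProduct_comm (χ (p + 2 + 1)) ρ, dotProduct_comm (χ (p + 2 + 1)) (χ p), n1, n2, a1, a2,
      show ρ ⬝ᵥ χ p = c by linarith, show ρ ⬝ᵥ χ (p + 2 + 1) = -c by linarith,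
      show χ p ⬝ᵥ χ (p + 2 + 1) = 0 by linarith] at hsq
    nlinarith

theorem prod_eq (R : ReducedSystem A B a χ U) {x y : ℤ} (hx : B x) (hy : B y) (hne : x ≠ y) :
    χ x ⬝ᵥ χ y = if x + 1 = y ∨ y + 1 = x then -1 else 0 := by
  have := R.prod_of_ne hx hy hne (R.coeff_eq_zero hy)
  rwa [R.coeff_eq_zero hx, R.coeff_eq_zero hx, sub_self, add_zero] at this

end ReducedSystem

/-- The pairing of the coordinatewise absolute values of two vectors. -/
def absDot {N : ℕ} (u v : Fin N → ℤ) : ℤ := ∑ i, |u i| * |v i|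

section AbsDot

variable {N : ℕ} {u v : Fin N → ℤ}

theorem absDot_comm (u v : Fin N → ℤ) : absDot u v = absDot v u :=
  Finset.sum_congr rfl fun _ _ => mul_comm _ _

theorem absDot_nonneg (u v : Fin N → ℤ) : 0 ≤ absDot u v :=
  Finset.sum_nonneg fun _ _ => mul_nonneg (abs_nonneg _) (abs_nonneg _)

theorem mul_eq_zero_of_absDot_eq_zero (h : absDot u v = 0) (i : Fin N) : |u i| * |v i| = 0 :=
  (Finset.sum_eq_zero_iff_of_nonneg
    fun _ _ => mul_nonneg (abs_nonneg _) (abs_nonneg _)).1 h i (Finset.mem_univ i)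

theorem even_absDot_sub (u v : Fin N → ℤ) : Even (absDot u v - u ⬝ᵥ v) := by
  rw [absDot, dotProduct, ← Finset.sum_sub_distrib]
  refine Finset.sum_induction _ _ (fun _ _ => Even.add) Even.zero fun i _ => ?_
  rw [← abs_mul]
  rcases abs_choice (u i * v i) with h | h <;> rw [h]
  · simp
  · exact ⟨-(u i * v i), by ring⟩

theorem sq_le_dotProduct_self (u : Fin N → ℤ) (s : Finset (Fin N)) :
    ∑ i ∈ s, u i ^ 2 ≤ u ⬝ᵥ u := by
  simp only [dotProduct, ← pow_two]
  exact Finset.sum_le_sum_of_subset_of_nonneg (Finset.subset_univ s) fun _ _ _ => sq_nonneg _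

theorem sq_apply_le (u : Fin N → ℤ) (i : Fin N) : u i ^ 2 ≤ u ⬝ᵥ u := by
  simpa using sq_le_dotProduct_self u {i}

theorem sq_add_sq_le (u : Fin N → ℤ) {i j : Fin N} (h : i ≠ j) :
    u i ^ 2 + u j ^ 2 ≤ u ⬝ᵥ u := by
  simpa [Finset.sum_pair h] using sq_le_dotProduct_self u {i, j}

theorem abs_apply_le_one (h : u ⬝ᵥ u ≤ 3) (i : Fin N) : |u i| ≤ 1 := by
  have := sq_apply_le u i
  rw [← sq_abs] at this
  by_contra hlt
  nlinarith

theorem exists_apply_ne_zero (h : u ⬝ᵥ u ≠ 0) : ∃ i, u i ≠ 0 := by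
  by_contra! hc
  exact h (by rw [show u = 0 from funext hc, zero_dotProduct])

theorem exists_single_of_norm_one (h : u ⬝ᵥ u = 1) : ∃ i, |u i| = 1 ∧ ∀ j, j ≠ i → u j = 0 := by
  obtain ⟨i, hi⟩ := exists_apply_ne_zero (u := u) (by omega)
  have h1 := abs_apply_le_one (u := u) (by omega) i
  have h2 := abs_pos.2 hi
  refine ⟨i, by omega, fun j hj => ?_⟩
  have h3 := sq_add_sq_le u hj
  have h4 : u i ^ 2 = 1 := by rw [← sq_abs, show |u i| = 1 by omega]; rfl
  exact pow_eq_zero_iff two_ne_zero |>.1 (le_antisymm (by omega) (sq_nonneg _))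

theorem exists_pair_of_norm_two (h : u ⬝ᵥ u = 2) :
    ∃ i j, i ≠ j ∧ |u i| = 1 ∧ |u j| = 1 ∧ ∀ k, k ≠ i → k ≠ j → u k = 0 := by
  obtain ⟨i, hi⟩ := exists_apply_ne_zero (u := u) (by omega)
  have h1 := abs_apply_le_one (u := u) (by omega) i
  have h2 := abs_pos.2 hi
  have hi1 : |u i| = 1 := by omega
  have h4 : u i ^ 2 = 1 := by rw [← sq_abs, hi1]; rfl
  obtain ⟨j, hj, hji⟩ : ∃ j, u j ≠ 0 ∧ j ≠ i := by
    by_contra! hc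
    have : u ⬝ᵥ u = u i ^ 2 := by
      rw [dotProduct, Finset.sum_eq_single i, pow_two]
      · intro k _ hk
        by_contra hne
        exact hk (hc k (left_ne_zero_of_mul hne))
      · simp
    omega
  have h5 := abs_apply_le_one (u := u) (by omega) j
  have h6 := abs_pos.2 hj
  have hj1 : |u j| = 1 := by omega
  have h7 : u j ^ 2 = 1 := by rw [← sq_abs, hj1]; rfl
  refine ⟨i, j, hji.symm, hi1, hj1, fun k hki hkj => ?_⟩
  have := sq_le_dotProduct_self u {i, j, k}
  rw [Finset.sum_insert (by simp [hji.symm, hki.symm]), Finset.sum_pair hkj.symm] at this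
  exact pow_eq_zero_iff two_ne_zero |>.1 (le_antisymm (by omega) (sq_nonneg _))

theorem absDot_of_norm_one (h : u ⬝ᵥ u = 1) (v : Fin N → ℤ) : absDot u v = |u ⬝ᵥ v| := by
  obtain ⟨i, hi, h0⟩ := exists_single_of_norm_one h
  rw [absDot, dotProduct, Finset.sum_eq_single i, Finset.sum_eq_single i, abs_mul]
  all_goals simp +contextual [h0]

theorem absDot_of_pair {i j : Fin N} (hij : i ≠ j) (hi : |u i| = 1) (hj : |u j| = 1)
    (h0 : ∀ k, k ≠ i → k ≠ j → u k = 0) (v : Fin N → ℤ) : absDot u v = |v i| + |v j| := by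
  rw [absDot, ← Finset.sum_subset (Finset.subset_univ {i, j}), Finset.sum_pair hij, hi, hj]
  · ring
  · intro k _ hk
    simp only [Finset.mem_insert, Finset.mem_singleton, not_or] at hk
    rw [h0 k hk.1 hk.2, abs_zero, zero_mul]

theorem absDot_le_two (hu : u ⬝ᵥ u = 2) (hv : ∀ i, |v i| ≤ 1) : absDot u v ≤ 2 := by
  obtain ⟨i, j, hij, hi, hj, h0⟩ := exists_pair_of_norm_two hu
  rw [absDot_of_pair hij hi hj h0]
  linarith [hv i, hv j]

/-- Orthogonal vectors of norm `2` with a common coordinate pair with every vector to numbers of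
the same parity. -/
theorem absDot_eq_zero_of_odd {w : Fin N → ℤ} (hu : u ⬝ᵥ u = 2) (hv : v ⬝ᵥ v = 2)
    (huv : u ⬝ᵥ v = 0) (hw : Odd (u ⬝ᵥ w - v ⬝ᵥ w)) : absDot u v = 0 := by
  obtain ⟨r, hr⟩ := even_absDot_sub u v
  obtain ⟨s, hs⟩ := even_absDot_sub u w
  obtain ⟨s', hs'⟩ := even_absDot_sub v w
  obtain ⟨t, ht⟩ := hw
  obtain ⟨i, j, hij, hi, hj, h0⟩ := exists_pair_of_norm_two hu
  obtain ⟨k, l, hkl, hk, hl, h0'⟩ := exists_pair_of_norm_two hv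
  rw [absDot_of_pair hij hi hj h0] at hr hs ⊢
  rw [absDot_of_pair hkl hk hl h0'] at hs'
  have yi := abs_apply_le_one (u := v) (by omega) i
  have yj := abs_apply_le_one (u := v) (by omega) j
  have yi' := abs_nonneg (v i)
  have yj' := abs_nonneg (v j)
  by_contra hc
  have ei : |v i| = 1 := by omega
  have ej : |v j| = 1 := by omega
  have mi : i = k ∨ i = l := by
    by_contra! h
    rw [h0' i h.1 h.2] at ei
    simp at ei
  have mj : j = k ∨ j = l := by
    by_contra! h
    rw [h0' j h.1 h.2] at ej
    simp at ej
  have : |w i| + |w j| = |w k| + |w l| := by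
    rcases mi with rfl | rfl <;> rcases mj with rfl | rfl
    · exact absurd rfl hij
    · rfl
    · exact add_comm _ _
    · exact absurd rfl hij
  omega

end AbsDot

namespace ReducedSystem

variable {N : ℕ} {A B : ℤ → Prop} {a : ℤ → ℤ} {χ U : ℤ → Fin N → ℤ}

theorem eq_one_of_ne (R : ReducedSystem A B a χ U) {x y : ℤ} (hx : B x) (hy : B y) (hne : x ≠ y)
    (hax : 1 < a x) : a y = 1 := by
  have := R.one_le y hy
  by_contra h
  exact hne (R.unique x y hx hy hax (by omega))

theorem norm_of_adj (R : ReducedSystem A B a χ U) {x y : ℤ} (hx : B x) (hy : B y)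
    (h : x + 1 = y ∨ y + 1 = x) : χ x ⬝ᵥ χ x = a x + 1 := by
  rcases h with rfl | rfl
  · exact R.norm_eq_of_right hx hy
  · exact R.norm_eq_of_left hx (by simpa using hy)

theorem norm_of_isolated (R : ReducedSystem A B a χ U) {x : ℤ} (hx : B x)
    (h : ¬ ∃ y, B y ∧ (x + 1 = y ∨ y + 1 = x)) : χ x ⬝ᵥ χ x = a x :=
  R.norm_eq_of_free hx (fun hl => h ⟨x - 1, hl, Or.inr (by ring)⟩)
    (fun hr => h ⟨x + 1, hr, Or.inl rfl⟩)

theorem abs_le_one (R : ReducedSystem A B a χ U) {x : ℤ} (hx : B x) (i : Fin N) :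
    |χ x i| ≤ 1 := by
  have hn := R.norm_le_add_one hx
  have h3 := R.le_three x hx
  by_cases h : χ x ⬝ᵥ χ x ≤ 3
  · exact abs_apply_le_one h i
  obtain ⟨y, hy, hxy⟩ : ∃ y, B y ∧ (x + 1 = y ∨ y + 1 = x) := by
    by_contra hc
    have := R.norm_of_isolated hx hc
    omega
  have hp := R.prod_eq hx hy (by omega)
  rw [if_pos hxy] at hp
  by_contra hlt
  have h0 (j : Fin N) (hj : j ≠ i) : χ x j = 0 := by
    have h4 := sq_add_sq_le (χ x) hj
    have h5 : 4 ≤ χ x i ^ 2 := by rw [← sq_abs]; nlinarith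
    exact pow_eq_zero_iff two_ne_zero |>.1 (le_antisymm (by omega) (sq_nonneg _))
  have h6 : χ x ⬝ᵥ χ y = χ x i * χ y i := by
    rw [dotProduct, Finset.sum_eq_single i] <;> simp +contextual [h0]
  rw [h6] at hp
  have h7 := Int.isUnit_iff.1 (IsUnit.of_mul_eq_one (-χ y i) (by linarith : χ x i * -χ y i = 1))
  rcases h7 with h7 | h7 <;> rw [h7] at hlt <;> simp at hlt

theorem not_common_neighbor (R : ReducedSystem A B a χ U) {x y z : ℤ} (hx : B x) (hy : B y)
    (hz : B z) (hxz : x ≠ z) (hxy : x + 1 = y ∨ y + 1 = x) (hyz : y + 1 = z ∨ z + 1 = y) :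
    False := by
  rcases hxy with h1 | h1 <;> rcases hyz with h2 | h2
  · subst h1 h2
    exact R.no_three x hx hy (by rwa [show x + 2 = x + 1 + 1 by ring])
  · omega
  · omega
  · subst h2 h1
    exact R.no_three z hz hy (by rwa [show z + 2 = z + 1 + 1 by ring])

theorem absDot_adj (R : ReducedSystem A B a χ U) {x y : ℤ} (hx : B x) (hy : B y)
    (hxy : x + 1 = y ∨ y + 1 = x) : absDot (χ x) (χ y) = 1 := by
  have hp := R.prod_eq hx hy (by omega)
  rw [if_pos hxy] at hp
  have he := even_absDot_sub (χ x) (χ y)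
  have h0 := absDot_nonneg (χ x) (χ y)
  have h2 : absDot (χ x) (χ y) ≤ 2 := by
    by_cases hax : a x = 1
    · exact absDot_le_two (by rw [R.norm_of_adj hx hy hxy, hax]; rfl) (R.abs_le_one hy)
    · have h1 := R.one_le x hx
      rw [absDot_comm]
      exact absDot_le_two (by
        rw [R.norm_of_adj hy hx hxy.symm, R.eq_one_of_ne hx hy (by omega) (by omega)]; rfl)
        (R.abs_le_one hx)
  rw [hp] at he
  obtain ⟨r, hr⟩ := he
  omega

/-- Nonadjacent vertices with vectors of norm `2`, one of which has a neighbour. -/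
theorem absDot_of_norm_two (R : ReducedSystem A B a χ U) {x y w : ℤ} (hx : B x) (hy : B y)
    (hw : B w) (hne : x ≠ y) (hxy : ¬ (x + 1 = y ∨ y + 1 = x)) (hyw : y + 1 = w ∨ w + 1 = y)
    (nx : χ x ⬝ᵥ χ x = 2) (ny : χ y ⬝ᵥ χ y = 2) : absDot (χ x) (χ y) = 0 := by
  have hp := R.prod_eq hx hy hne
  rw [if_neg hxy] at hp
  have hpw := R.prod_eq hx hw (by omega)
  rw [if_neg (fun h => R.not_common_neighbor hx hw hy hne h hyw.symm)] at hpw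
  have hqw := R.prod_eq hy hw (by omega)
  rw [if_pos hyw] at hqw
  exact absDot_eq_zero_of_odd nx ny hp (w := χ w) (by rw [hpw, hqw]; decide)

theorem absDot_far_of_eq_one (R : ReducedSystem A B a χ U) {x y : ℤ} (hx : B x) (hy : B y)
    (hne : x ≠ y) (hxy : ¬ (x + 1 = y ∨ y + 1 = x)) (hay : a y = 1) :
    absDot (χ x) (χ y) = 0 := by
  have hp := R.prod_eq hx hy hne
  rw [if_neg hxy] at hp
  by_cases hw : ∃ w, B w ∧ (y + 1 = w ∨ w + 1 = y)
  swap
  · rw [absDot_comm, absDot_of_norm_one (by rw [R.norm_of_isolated hy hw, hay]), dotProduct_comm, hp]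
    rfl
  obtain ⟨w, hw, hyw⟩ := hw
  have ny : χ y ⬝ᵥ χ y = 2 := by rw [R.norm_of_adj hy hw hyw, hay]; rfl
  have hwx : w ≠ x := by omega
  have hxw : ¬ (x + 1 = w ∨ w + 1 = x) := fun h =>
    R.not_common_neighbor hx hw hy hne h hyw.symm
  have h1 := R.one_le x hx
  have h3 := R.le_three x hx
  by_cases hx1 : χ x ⬝ᵥ χ x = 1
  · rw [absDot_of_norm_one hx1, hp]; rfl
  by_cases hx2 : χ x ⬝ᵥ χ x = 2
  · exact R.absDot_of_norm_two hx hy hw hne hxy hyw hx2 ny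
  have hax : 1 < a x := by
    by_contra hlt
    by_cases h : ∃ z, B z ∧ (x + 1 = z ∨ z + 1 = x)
    · obtain ⟨z, hz, h⟩ := h
      have := R.norm_of_adj hx hz h
      omega
    · have := R.norm_of_isolated hx h
      omega
  have haw := R.eq_one_of_ne hx hw hwx.symm hax
  have hax2 : a x = 2 := by
    by_contra hne2
    rcases hyw with rfl | rfl
    · exact R.no_one_one x y hx (by omega) hy hw hay haw
    · exact R.no_one_one x w hx (by omega) hw hy haw hay
  obtain ⟨z, hz, hxz⟩ : ∃ z, B z ∧ (x + 1 = z ∨ z + 1 = x) := by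
    by_contra h
    have := R.norm_of_isolated hx h
    omega
  have nx : χ x ⬝ᵥ χ x = 3 := by rw [R.norm_of_adj hx hz hxz, hax2]; rfl
  have haz := R.eq_one_of_ne hx hz (by omega) hax
  have nz : χ z ⬝ᵥ χ z = 2 := by rw [R.norm_of_adj hz hx hxz.symm, haz]; rfl
  have nw : χ w ⬝ᵥ χ w = 2 := by rw [R.norm_of_adj hw hy hyw.symm, haw]; rfl
  have hzy := R.absDot_of_norm_two hz hy hw (by omega)
    (fun h => R.not_common_neighbor hx hz hy hne hxz h) hyw nz ny
  have hzw := R.absDot_of_norm_two hz hw hy (by omega)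
    (fun h => R.not_common_neighbor hx hz hw hwx.symm hxz h) hyw.symm nz nw
  have hyw1 := R.absDot_adj hy hw hyw
  have hpw := R.prod_eq hx hw hwx.symm
  rw [if_neg hxw] at hpw
  have hpz := R.prod_eq hx hz (by omega)
  rw [if_pos hxz] at hpz
  obtain ⟨r, hr⟩ := even_absDot_sub (χ x) (χ y)
  obtain ⟨s, hs⟩ := even_absDot_sub (χ x) (χ w)
  rw [absDot_comm] at hr hs ⊢
  by_contra hc
  obtain ⟨i, j, hij, hwi, hi, hj, h0⟩ : ∃ i j, i ≠ j ∧ |χ w i| = 1 ∧ |χ y i| = 1 ∧ |χ y j| = 1 ∧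
      ∀ k, k ≠ i → k ≠ j → χ y k = 0 := by
    obtain ⟨i, j, hij, hi, hj, h0⟩ := exists_pair_of_norm_two ny
    rw [absDot_of_pair hij hi hj h0] at hyw1
    have := abs_nonneg (χ w i)
    have := abs_nonneg (χ w j)
    by_cases h : |χ w i| = 1
    · exact ⟨i, j, hij, h, hi, hj, h0⟩
    · exact ⟨j, i, hij.symm, by omega, hj, hi, fun k h1 h2 => h0 k h2 h1⟩
  obtain ⟨l, hil, hwl, h0'⟩ : ∃ l, i ≠ l ∧ |χ w l| = 1 ∧ ∀ k, k ≠ i → k ≠ l → χ w k = 0 := by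
    obtain ⟨k, l, hkl, hk, hl, h0'⟩ := exists_pair_of_norm_two nw
    by_cases h : i = k
    · subst h; exact ⟨l, hkl, hl, h0'⟩
    · by_cases h' : i = l
      · subst h'; exact ⟨k, h, hk, fun m h1 h2 => h0' m h2 h1⟩
      · rw [h0' i h h'] at hwi; simp at hwi
  rw [absDot_of_pair hij hi hj h0] at hyw1 hr hc
  rw [absDot_of_pair hil hwi hwl h0'] at hs
  have hjl : j ≠ l := by rintro rfl; omega
  have xi := R.abs_le_one hx i
  have xj := R.abs_le_one hx j
  have xl := R.abs_le_one hx l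
  have xi' := abs_nonneg (χ x i)
  have xj' := abs_nonneg (χ x j)
  have xl' := abs_nonneg (χ x l)
  have ei : |χ x i| = 1 := by omega
  have ej : |χ x j| = 1 := by omega
  have el : |χ x l| = 1 := by omega
  have zy := mul_eq_zero_of_absDot_eq_zero hzy
  have zw := mul_eq_zero_of_absDot_eq_zero hzw
  have zi : χ z i = 0 := by simpa [hi] using zy i
  have zj : χ z j = 0 := by simpa [hj] using zy j
  have zl : χ z l = 0 := by simpa [hwl] using zw l
  have x0 (k : Fin N) (h1 : k ≠ i) (h2 : k ≠ j) (h3 : k ≠ l) : χ x k = 0 := by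
    have := sq_le_dotProduct_self (χ x) {i, j, l, k}
    rw [Finset.sum_insert (by simp [hij, hil, h1.symm]),
      Finset.sum_insert (by simp [hjl, h2.symm]), Finset.sum_pair h3.symm, ← sq_abs (χ x i),
      ← sq_abs (χ x j), ← sq_abs (χ x l), ei, ej, el] at this
    exact pow_eq_zero_iff two_ne_zero |>.1 (le_antisymm (by omega) (sq_nonneg _))
  have : χ x ⬝ᵥ χ z = 0 := by
    refine Finset.sum_eq_zero fun k _ => ?_
    by_cases h1 : k = i
    · rw [h1, zi, mul_zero]
    by_cases h2 : k = j
    · rw [h2, zj, mul_zero]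
    by_cases h3 : k = l
    · rw [h3, zl, mul_zero]
    rw [x0 k h1 h2 h3, zero_mul]
  omega

theorem absDot_far (R : ReducedSystem A B a χ U) {x y : ℤ} (hx : B x) (hy : B y)
    (hne : x ≠ y) (hxy : ¬ (x + 1 = y ∨ y + 1 = x)) : absDot (χ x) (χ y) = 0 := by
  by_cases hay : a y = 1
  · exact R.absDot_far_of_eq_one hx hy hne hxy hay
  · have := R.one_le y hy
    rw [absDot_comm]
    exact R.absDot_far_of_eq_one hy hx hne.symm (by omega)
      (R.eq_one_of_ne hy hx hne.symm (by omega))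

end ReducedSystem

/-- An embedding of a finite union of linear graphs whose vertices are placed at integers, adjacent
vertices being those at distance one, together with the working conditions on the adjusted weights
`a`. -/
structure PathSystem {N : ℕ} (S : ℤ → Prop) (a : ℤ → ℤ) (f : ℤ → Fin N → ℤ) : Prop where
  bounded : ∃ M, ∀ n, S n → -M < n ∧ n < M
  norm : ∀ n, S n → ∃ l r, (S (n - 1) ∧ l = 1 ∨ ¬ S (n - 1) ∧ l = 0) ∧
    (S (n + 1) ∧ r = 1 ∨ ¬ S (n + 1) ∧ r = 0) ∧ f n ⬝ᵥ f n = a n + l + r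
  adj : ∀ n, S n → S (n + 1) → f n ⬝ᵥ f (n + 1) = -1
  far : ∀ m n, S m → S n → m + 1 < n → f m ⬝ᵥ f n = 0
  two_le : ∀ n, S n → 2 ≤ f n ⬝ᵥ f n
  le_three : ∀ n, S n → a n ≤ 3
  unique : ∀ x y, S x → S y → 1 < a x → 1 < a y → x = y
  no_three : ∀ x, S x → S (x + 1) → S (x + 2) → 0 < a x → 0 < a (x + 1) → ¬ 0 < a (x + 2)
  no_one_one : ∀ v x, S v → a v = 3 → S x → S (x + 1) → a x = 1 → a (x + 1) ≠ 1
  long_right : ∀ (x : ℤ) (k : ℕ), k ≠ 0 → (∀ j, x ≤ j → j ≤ x + k + 1 → S j) → 1 ≤ a x →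
    (∀ j, x < j → j ≤ x + k → a j = 0) → a (x + k + 1) = 1 → a x + 1 ≤ k
  long_left : ∀ (x : ℤ) (k : ℕ), k ≠ 0 → (∀ j, x ≤ j → j ≤ x + k + 1 → S j) → a x = 1 →
    (∀ j, x < j → j ≤ x + k → a j = 0) → 1 ≤ a (x + k + 1) → a (x + k + 1) + 1 ≤ k
  no_110012 : ∀ x, (∀ j, x ≤ j → j ≤ x + 5 → S j) → a x = 1 → a (x + 1) = 1 → a (x + 2) = 0 →
    a (x + 3) = 0 → a (x + 4) = 1 → a (x + 5) ≠ 2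
  no_210011 : ∀ x, (∀ j, x ≤ j → j ≤ x + 5 → S j) → a x = 2 → a (x + 1) = 1 → a (x + 2) = 0 →
    a (x + 3) = 0 → a (x + 4) = 1 → a (x + 5) ≠ 1
  no_31001 : ∀ x, (∀ j, x ≤ j → j ≤ x + 4 → S j) → a x = 3 → a (x + 1) = 1 → a (x + 2) = 0 →
    a (x + 3) = 0 → a (x + 4) ≠ 1
  no_10013 : ∀ x, (∀ j, x ≤ j → j ≤ x + 4 → S j) → a x = 1 → a (x + 1) = 0 → a (x + 2) = 0 →
    a (x + 3) = 1 → a (x + 4) ≠ 3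

namespace PathSystem

variable {N : ℕ} {S : ℤ → Prop} {a : ℤ → ℤ} {f : ℤ → Fin N → ℤ}

theorem nonneg (P : PathSystem S a f) {n : ℤ} (hn : S n) : 0 ≤ a n := by
  obtain ⟨l, r, hl, hr, h⟩ := P.norm n hn
  have := P.two_le n hn
  omega

theorem neighbors (P : PathSystem S a f) {n : ℤ} (hn : S n) (h0 : a n = 0) :
    S (n - 1) ∧ S (n + 1) ∧ f n ⬝ᵥ f n = 2 := by
  obtain ⟨l, r, hl, hr, h⟩ := P.norm n hn
  have := P.two_le n hn
  refine ⟨?_, ?_, by omega⟩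
  · rcases hl with h | h
    · exact h.1
    · omega
  · rcases hr with h | h
    · exact h.1
    · omega

theorem exists_right_end (P : PathSystem S a f) {n : ℤ} (hn : S n) (h0 : a n = 0) :
    ∃ q, n ≤ q ∧ (∀ j, n ≤ j → j ≤ q → S j ∧ a j = 0) ∧ S (q + 1) ∧ 1 ≤ a (q + 1) := by
  obtain ⟨M, hM⟩ := P.bounded
  have hex : ∃ k : ℕ, ¬ (S (n + k) ∧ a (n + k) = 0) := by
    refine ⟨(M - n).toNat, fun h => ?_⟩
    have := hM _ h.1
    have := hM _ hn
    omega
  classical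
  have h1 := Nat.find_spec hex
  have h2 : ∀ m < Nat.find hex, S (n + m) ∧ a (n + m) = 0 := fun m hm => by
    by_contra hc
    exact Nat.find_min hex hm hc
  set k := Nat.find hex
  have hk : k ≠ 0 := by
    intro hk
    rw [hk] at h1
    simp [hn, h0] at h1
  have h3 (j : ℤ) (hj : n ≤ j) (hj' : j ≤ n + k - 1) : S j ∧ a j = 0 := by
    have := h2 (j - n).toNat (by omega)
    rwa [show n + ((j - n).toNat : ℤ) = j by omega] at this
  obtain ⟨h4, h5⟩ := h3 (n + k - 1) (by omega) le_rfl
  have h6 := (P.neighbors h4 h5).2.1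
  refine ⟨n + k - 1, by omega, h3, h6, ?_⟩
  rw [sub_add_cancel] at h6 ⊢
  have := P.nonneg h6
  have : a (n + k) ≠ 0 := fun h => h1 ⟨h6, h⟩
  omega

theorem exists_left_end (P : PathSystem S a f) {n : ℤ} (hn : S n) (h0 : a n = 0) :
    ∃ p, p < n ∧ (∀ j, p < j → j ≤ n → S j ∧ a j = 0) ∧ S p ∧ 1 ≤ a p := by
  obtain ⟨M, hM⟩ := P.bounded
  have hex : ∃ k : ℕ, ¬ (S (n - k) ∧ a (n - k) = 0) := by
    refine ⟨(M + n).toNat, fun h => ?_⟩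
    have := hM _ h.1
    have := hM _ hn
    omega
  classical
  have h1 := Nat.find_spec hex
  have h2 : ∀ m < Nat.find hex, S (n - m) ∧ a (n - m) = 0 := fun m hm => by
    by_contra hc
    exact Nat.find_min hex hm hc
  set k := Nat.find hex
  have hk : k ≠ 0 := by
    intro hk
    rw [hk] at h1
    simp [hn, h0] at h1
  have h3 (j : ℤ) (hj : n - k < j) (hj' : j ≤ n) : S j ∧ a j = 0 := by
    have := h2 (n - j).toNat (by omega)
    rwa [show n - ((n - j).toNat : ℤ) = j by omega] at this
  obtain ⟨h4, h5⟩ := h3 (n - k + 1) (by omega) (by omega)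
  have h6 := (P.neighbors h4 h5).1
  rw [add_sub_cancel_right] at h6
  refine ⟨n - k, by omega, h3, h6, ?_⟩
  have := P.nonneg h6
  have : a (n - k) ≠ 0 := fun h => h1 ⟨h6, h⟩
  omega

theorem exists_run (P : PathSystem S a f) {n : ℤ} (hn : S n) (h0 : a n = 0) :
    ∃ p q, p < n ∧ n ≤ q ∧ IsRun (fun n => S n ∧ a n = 0) (fun n => S n ∧ 1 ≤ a n) a p q := by
  obtain ⟨q, hq, hq1, hq2, hq3⟩ := P.exists_right_end hn h0
  obtain ⟨p, hp, hp1, hp2, hp3⟩ := P.exists_left_end hn h0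
  have hz (j : ℤ) (hj : p < j) (hj' : j ≤ q) : S j ∧ a j = 0 := by
    rcases le_total j n with h | h
    · exact hp1 j hj h
    · exact hq1 j h hj'
  obtain ⟨k, hk⟩ : ∃ k : ℕ, q = p + k := ⟨(q - p).toNat, by omega⟩
  subst hk
  have hS (j : ℤ) (hj : p ≤ j) (hj' : j ≤ p + k + 1) : S j := by
    rcases eq_or_lt_of_le hj with h | h
    · rwa [← h]
    · rcases eq_or_lt_of_le hj' with h' | h'
      · rwa [h']
      · exact (hz j h (by omega)).1
  have key : a p + 1 ≤ k ∧ a (p + k + 1) + 1 ≤ k := by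
    by_cases h1 : a (p + k + 1) = 1
    · have := P.long_right p k (by omega) hS hp3 (fun j h h' => (hz j h h').2) h1
      omega
    · have h2 : a p = 1 := by
        by_contra h3
        have := P.unique _ _ hp2 hq2 (by omega) (by omega)
        omega
      have := P.long_left p k (by omega) hS h2 (fun j h h' => (hz j h h').2) hq3
      omega
  exact ⟨p, p + k, hp, hq, ⟨hp2, hp3⟩, ⟨hq2, hq3⟩, hz, by omega, by omega, by omega⟩

theorem exists_zero_neighbor (P : PathSystem S a f) {n : ℤ} (hn : S n) (h0 : a n = 0) :
    (S (n - 1) ∧ a (n - 1) = 0) ∨ (S (n + 1) ∧ a (n + 1) = 0) := by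
  obtain ⟨p, q, h1, h2, h3⟩ := P.exists_run hn h0
  have := h3.two_le
  by_cases h : p < n - 1
  · exact Or.inl (h3.zero _ h (by omega))
  · exact Or.inr (h3.zero _ (by omega) (by omega))

theorem absDot_far_zero (P : PathSystem S a f) {m n : ℤ} (hm : S m) (h0 : a m = 0) (hn : S n)
    (h0' : a n = 0) (hmn : m + 1 < n) : absDot (f m) (f n) = 0 := by
  obtain ⟨h1, -, h2⟩ := P.neighbors hm h0
  refine absDot_eq_zero_of_odd h2 (P.neighbors hn h0').2.2 (P.far m n hm hn hmn) (w := f (m - 1)) ?_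
  have e1 := P.adj (m - 1) h1 (by simpa using hm)
  rw [sub_add_cancel, dotProduct_comm] at e1
  rw [e1, dotProduct_comm, P.far _ _ h1 hn (by omega)]
  decide

theorem dotProduct_of_single {u : Fin N → ℤ} {i : Fin N} (h : ∀ j, j ≠ i → u j = 0)
    (v : Fin N → ℤ) : v ⬝ᵥ u = v i * u i := by
  rw [dotProduct, Finset.sum_eq_single i] <;> simp +contextual [h]

theorem dotProduct_unit_eq_zero {u v w : Fin N → ℤ} (hu : u ⬝ᵥ u = 1) (hvw : absDot v w = 0)
    (hv : v ⬝ᵥ u ≠ 0) : w ⬝ᵥ u = 0 := by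
  obtain ⟨i, hi, h0⟩ := exists_single_of_norm_one hu
  rw [dotProduct_of_single h0] at hv ⊢
  have := mul_eq_zero_of_absDot_eq_zero hvw i
  rw [mul_eq_zero, abs_eq_zero, abs_eq_zero] at this
  rcases this with h | h
  · exact absurd (by rw [h, zero_mul]) hv
  · rw [h, zero_mul]

theorem exists_shared (P : PathSystem S a f) {n : ℤ} (hn : S n) (h0 : a n = 0) (hn' : S (n + 1))
    (h0' : a (n + 1) = 0) : ∃ u, u ⬝ᵥ u = 1 ∧ f n ⬝ᵥ u = -1 ∧ f (n + 1) ⬝ᵥ u = 1 ∧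
      ∀ m, S m → a m = 0 → m ≠ n → m ≠ n + 1 → f m ⬝ᵥ u = 0 := by
  suffices h : ∃ u, u ⬝ᵥ u = 1 ∧ f n ⬝ᵥ u = -1 ∧ f (n + 1) ⬝ᵥ u = 1 by
    obtain ⟨u, h1, h2, h3⟩ := h
    refine ⟨u, h1, h2, h3, fun m hm hm0 hne hne' => ?_⟩
    rcases lt_or_gt_of_ne hne with hlt | hgt
    · have := P.absDot_far_zero hm hm0 hn' h0' (by omega)
      rw [absDot_comm] at this
      exact dotProduct_unit_eq_zero h1 this (by omega)
    · exact dotProduct_unit_eq_zero h1 (P.absDot_far_zero hn h0 hm hm0 (by omega)) (by omega)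
  have n1 := (P.neighbors hn h0).2.2
  have n2 := (P.neighbors hn' h0').2.2
  have hp := P.adj n hn hn'
  obtain ⟨i, j, hij, hi, hj, hij0⟩ := exists_pair_of_norm_two n2
  have hp' : f n ⬝ᵥ f (n + 1) = f n i * f (n + 1) i + f n j * f (n + 1) j := by
    rw [dotProduct, ← Finset.sum_subset (Finset.subset_univ {i, j}), Finset.sum_pair hij]
    intro k _ hk
    simp only [Finset.mem_insert, Finset.mem_singleton, not_or] at hk
    rw [hij0 k hk.1 hk.2, mul_zero]
  rw [hp] at hp'
  have bi := abs_apply_le_one (u := f n) (by omega) i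
  have bj := abs_apply_le_one (u := f n) (by omega) j
  rw [abs_le] at bi bj
  have key : ∀ k, |f (n + 1) k| = 1 → f n k * f (n + 1) k = -1 →
      ∃ u, u ⬝ᵥ u = 1 ∧ f n ⬝ᵥ u = -1 ∧ f (n + 1) ⬝ᵥ u = 1 := by
    intro k hk hk'
    have hk2 : f (n + 1) k * f (n + 1) k = 1 := by rw [← abs_mul_abs_self, hk]; rfl
    refine ⟨Pi.single k (f (n + 1) k), ?_, ?_, ?_⟩
    · rw [dotProduct_single, Pi.single_eq_same, hk2]
    · rw [dotProduct_single, hk']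
    · rw [dotProduct_single, hk2]
  by_cases hk : f n i * f (n + 1) i = -1
  · exact key i hi hk
  · refine key j hj ?_
    rcases (abs_eq zero_le_one).1 hi with h1 | h1 <;> rcases (abs_eq zero_le_one).1 hj with h2 | h2 <;>
      rw [h1, h2] at hp' <;> rw [h1] at hk <;> rw [h2] <;> omega

/-- Each vertex of adjusted weight zero is the difference of the unit vectors associated to the
gaps on its two sides. -/
theorem exists_gap_vectors (P : PathSystem S a f) : ∃ U : ℤ → Fin N → ℤ,
    (∀ g, ¬ (S g ∧ a g = 0) → ¬ (S (g + 1) ∧ a (g + 1) = 0) → U g = 0) ∧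
    (∀ g, (S g ∧ a g = 0) ∨ (S (g + 1) ∧ a (g + 1) = 0) → U g ⬝ᵥ U g = 1) ∧
    (∀ g, S g → a g = 0 → f g ⬝ᵥ U g = -1) ∧
    (∀ g, S (g + 1) → a (g + 1) = 0 → f (g + 1) ⬝ᵥ U g = 1) ∧
    (∀ g n, S n → a n = 0 → n ≠ g → n ≠ g + 1 → f n ⬝ᵥ U g = 0) := by
  have hex (g : ℤ) : ∃ u : Fin N → ℤ,
      (¬ (S g ∧ a g = 0) → ¬ (S (g + 1) ∧ a (g + 1) = 0) → u = 0) ∧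
      ((S g ∧ a g = 0) ∨ (S (g + 1) ∧ a (g + 1) = 0) → u ⬝ᵥ u = 1) ∧
      (S g → a g = 0 → f g ⬝ᵥ u = -1) ∧
      (S (g + 1) → a (g + 1) = 0 → f (g + 1) ⬝ᵥ u = 1) ∧
      (∀ n, S n → a n = 0 → n ≠ g → n ≠ g + 1 → f n ⬝ᵥ u = 0) := by
    by_cases h1 : S g ∧ a g = 0
    · by_cases h2 : S (g + 1) ∧ a (g + 1) = 0
      · obtain ⟨u, e1, e2, e3, e4⟩ := P.exists_shared h1.1 h1.2 h2.1 h2.2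
        exact ⟨u, fun h => absurd h1 h, fun _ => e1, fun _ _ => e2, fun _ _ => e3, e4⟩
      · obtain ⟨h3, h4⟩ := (P.exists_zero_neighbor h1.1 h1.2).resolve_right h2
        obtain ⟨g, rfl⟩ : ∃ h, g = h + 1 := ⟨g - 1, by ring⟩
        rw [add_sub_cancel_right] at h3 h4
        obtain ⟨u, e1, e2, e3, e4⟩ := P.exists_shared h3 h4 h1.1 h1.2
        have hn := (P.neighbors h1.1 h1.2).2.2
        refine ⟨u - f (g + 1), fun h => absurd h1 h, fun _ => ?_, fun _ _ => ?_,
          fun h h' => absurd ⟨h, h'⟩ h2, fun n hn hn0 hne hne' => ?_⟩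
        · simp only [sub_dotProduct, dotProduct_sub, dotProduct_comm u (f _), e1, e3, hn]
          norm_num
        · rw [dotProduct_sub, e3, hn]; norm_num
        · rw [dotProduct_sub]
          by_cases hng : n = g
          · subst hng
            rw [e2, P.adj n h3 h1.1]; norm_num
          · rw [e4 n hn hn0 hng hne]
            rcases lt_or_gt_of_ne hne with h | h
            · rw [P.far n (g + 1) hn h1.1 (by omega)]; norm_num
            · rw [dotProduct_comm, P.far (g + 1) n h1.1 hn (by omega)]; norm_num
    · by_cases h2 : S (g + 1) ∧ a (g + 1) = 0
      · have h3 := (P.exists_zero_neighbor h2.1 h2.2).resolve_left (by simpa using h1)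
        obtain ⟨u, e1, e2, e3, e4⟩ := P.exists_shared h2.1 h2.2 h3.1 h3.2
        have hn := (P.neighbors h2.1 h2.2).2.2
        refine ⟨u + f (g + 1), fun _ h => absurd h2 h, fun _ => ?_,
          fun h h' => absurd ⟨h, h'⟩ h1, fun _ _ => ?_, fun n hn hn0 hne hne' => ?_⟩
        · simp only [add_dotProduct, dotProduct_add, dotProduct_comm u (f _), e1, e2, hn]
          norm_num
        · rw [dotProduct_add, e2, hn]; norm_num
        · rw [dotProduct_add]
          by_cases hng : n = g + 1 + 1
          · subst hng
            rw [e3, dotProduct_comm, P.adj _ h2.1 h3.1]; norm_num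
          · rw [e4 n hn hn0 hne' hng]
            rcases lt_or_gt_of_ne hne' with h | h
            · rw [P.far n (g + 1) hn h2.1 (by omega)]; norm_num
            · rw [dotProduct_comm, P.far (g + 1) n h2.1 hn (by omega)]; norm_num
      · refine ⟨0, fun _ _ => rfl, fun h => (h.elim h1 h2).elim, fun h h' => absurd ⟨h, h'⟩ h1,
          fun h h' => absurd ⟨h, h'⟩ h2, fun _ _ _ _ _ => dotProduct_zero _⟩
  choose U h1 h2 h3 h4 h5 using hex
  exact ⟨U, h1, h2, h3, h4, h5⟩

theorem exists_orthonormal_gap_vectors (P : PathSystem S a f) : ∃ U : ℤ → Fin N → ℤ,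
    (∀ g, ¬ (S g ∧ a g = 0) → ¬ (S (g + 1) ∧ a (g + 1) = 0) → U g = 0) ∧
    (∀ g, (S g ∧ a g = 0) ∨ (S (g + 1) ∧ a (g + 1) = 0) → U g ⬝ᵥ U g = 1) ∧
    (∀ g h, g ≠ h → U g ⬝ᵥ U h = 0) ∧
    (∀ n, S n → a n = 0 → f n = U (n - 1) - U n) := by
  obtain ⟨U, h1, h2, h3, h4, h5⟩ := P.exists_gap_vectors
  have hlt (g h : ℤ) (hgh : g < h) : U g ⬝ᵥ U h = 0 := by
    by_cases hg : (S g ∧ a g = 0) ∨ (S (g + 1) ∧ a (g + 1) = 0)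
    swap
    · rw [not_or] at hg
      rw [h1 g hg.1 hg.2, zero_dotProduct]
    by_cases hh : (S h ∧ a h = 0) ∨ (S (h + 1) ∧ a (h + 1) = 0)
    swap
    · rw [not_or] at hh
      rw [h1 h hh.1 hh.2, dotProduct_zero]
    obtain ⟨i, hi, hi0⟩ := exists_single_of_norm_one (h2 g hg)
    obtain ⟨j, hj, hj0⟩ := exists_single_of_norm_one (h2 h hh)
    rw [dotProduct_of_single hj0]
    by_cases hij : j = i
    swap
    · rw [hi0 j hij, zero_mul]
    exfalso
    subst hij
    have hi' : U g j ≠ 0 := by intro h; rw [h] at hi; simp at hi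
    have hj' : U h j ≠ 0 := by intro h; rw [h] at hj; simp at hj
    have hiff (n : ℤ) : f n ⬝ᵥ U g = 0 ↔ f n ⬝ᵥ U h = 0 := by
      rw [dotProduct_of_single hi0, dotProduct_of_single hj0]
      simp [hi', hj']
    have k1 : ¬ (S g ∧ a g = 0) := fun hk => by
      have e1 := h3 g hk.1 hk.2
      have e2 := (hiff g).2 (h5 h g hk.1 hk.2 (by omega) (by omega))
      omega
    have k2 : ¬ (S (h + 1) ∧ a (h + 1) = 0) := fun hk => by
      have e1 := h4 h hk.1 hk.2
      have e2 := (hiff (h + 1)).1 (h5 g (h + 1) hk.1 hk.2 (by omega) (by omega))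
      omega
    have k3 := hg.resolve_left k1
    have k4 := hh.resolve_right k2
    have k5 : g + 1 = h := by
      by_contra hne
      have e1 := h4 g k3.1 k3.2
      have e2 := (hiff (g + 1)).2 (h5 h (g + 1) k3.1 k3.2 hne (by omega))
      omega
    subst k5
    rcases P.exists_zero_neighbor k3.1 k3.2 with h | h
    · exact k1 (by simpa using h)
    · exact k2 h
  have horth (g h : ℤ) (hne : g ≠ h) : U g ⬝ᵥ U h = 0 := by
    rcases lt_or_gt_of_ne hne with h | h
    · exact hlt _ _ h
    · rw [dotProduct_comm]; exact hlt _ _ h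
  refine ⟨U, h1, h2, horth, fun n hn h0 => ?_⟩
  have e1 := h3 n hn h0
  have e2 := h4 (n - 1) (by simpa using hn) (by simpa using h0)
  have e3 := h2 n (Or.inl ⟨hn, h0⟩)
  have e4 := h2 (n - 1) (Or.inr (by simpa using ⟨hn, h0⟩))
  have e5 := horth (n - 1) n (by omega)
  have e6 := (P.neighbors hn h0).2.2
  rw [sub_add_cancel] at e2
  have : f n - (U (n - 1) - U n) = 0 := by
    apply eq_zero_of_dotProduct_self_nonpos
    simp only [sub_dotProduct, dotProduct_sub, dotProduct_comm (U _) (f _),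
      dotProduct_comm (U n) (U (n - 1)), e1, e2, e3, e4, e5, e6]
    norm_num
  exact sub_eq_zero.1 this

theorem exists_reducedSystem (P : PathSystem S a f) : ∃ χ U : ℤ → Fin N → ℤ,
    ReducedSystem (fun n => S n ∧ a n = 0) (fun n => S n ∧ 1 ≤ a n) a χ U ∧
    (∀ n, f n = U (n - 1) - U n + χ n) ∧ (∀ n, S n → a n = 0 → χ n = 0) := by
  obtain ⟨U, h1, h2, h3, h4⟩ := P.exists_orthonormal_gap_vectors
  have hf (n : ℤ) : f n = U (n - 1) - U n + (f n - U (n - 1) + U n) := by abel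
  have hχ (n : ℤ) (hn : S n) (h0 : a n = 0) : f n - U (n - 1) + U n = 0 := by
    rw [h4 n hn h0]; abel
  refine ⟨fun n => f n - U (n - 1) + U n, U, ?_, hf, hχ⟩
  generalize hχdef : (fun n => f n - U (n - 1) + U n) = χ
  have hf (n : ℤ) : f n = χ n + U (n - 1) - U n := by rw [← hχdef]; simp only; abel
  have hU (x : ℤ) (hx : 1 ≤ a x) (hx' : 1 ≤ a (x + 1)) : U x = 0 :=
    h1 x (fun h => by omega) (fun h => by omega)
  have hnorm (x : ℤ) : f x ⬝ᵥ f x = χ x ⬝ᵥ χ x + 2 * (χ x ⬝ᵥ U (x - 1) - χ x ⬝ᵥ U x) +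
      U (x - 1) ⬝ᵥ U (x - 1) + U x ⬝ᵥ U x := by
    rw [hf x]
    simp only [sub_dotProduct, dotProduct_sub, add_dotProduct, dotProduct_add,
      dotProduct_comm (U _) (χ _), dotProduct_comm (U x) (U (x - 1)), h3 (x - 1) x (by omega)]
    ring
  have hUr (x r : ℤ) (hx : 1 ≤ a x) (h0 : S (x + 1) → a (x + 1) = 0)
      (hr : S (x + 1) ∧ r = 1 ∨ ¬ S (x + 1) ∧ r = 0) : U x ⬝ᵥ U x = r := by
    rcases hr with ⟨h, rfl⟩ | ⟨h, rfl⟩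
    · exact h2 x (Or.inr ⟨h, h0 h⟩)
    · rw [h1 x (fun h => by omega) (fun h' => h h'.1), zero_dotProduct]
  have hUl (x l : ℤ) (hx : 1 ≤ a x) (h0 : S (x - 1) → a (x - 1) = 0)
      (hl : S (x - 1) ∧ l = 1 ∨ ¬ S (x - 1) ∧ l = 0) : U (x - 1) ⬝ᵥ U (x - 1) = l := by
    rcases hl with ⟨h, rfl⟩ | ⟨h, rfl⟩
    · exact h2 _ (Or.inl ⟨h, h0 h⟩)
    · rw [h1 (x - 1) (fun h' => h h'.1) (fun h => by rw [sub_add_cancel] at h; omega),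
        zero_dotProduct]
  have hzero (x : ℤ) (hx : S x) (h : ¬ (S x ∧ 1 ≤ a x)) : a x = 0 := by
    have := P.nonneg hx
    by_contra h'
    exact h ⟨hx, by omega⟩
  refine
    { disj := fun n h h' => by omega
      gap_norm := h2
      gap_orth := h3
      gap_zero := h1
      const := ?_
      run := fun n hn => P.exists_run hn.1 hn.2
      one_le := fun x h => h.2
      le_three := fun x h => P.le_three x h.1
      unique := fun x y hx hy => P.unique x y hx.1 hy.1
      no_three := fun x h0 h1 h2 => P.no_three x h0.1 h1.1 h2.1 h0.2 h1.2 h2.2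
      no_one_one := fun v x hv h h0 h1 => P.no_one_one v x hv.1 h h0.1 h1.1
      no_110012 := ?_
      no_210011 := ?_
      no_31001 := ?_
      no_10013 := ?_
      prod_adj := ?_
      prod_far := ?_
      norm_free := ?_
      norm_right := ?_
      norm_left := ?_ }
  · rintro x n ⟨hx, hx1⟩ ⟨hn, hn0⟩
    have e1 : χ x ⬝ᵥ f n = 0 := by
      have hUn : ∀ g, U g ⬝ᵥ f n = U g ⬝ᵥ U (n - 1) - U g ⬝ᵥ U n := fun g => by
        rw [h4 n hn hn0, dotProduct_sub]
      have hχx : χ x = f x - U (x - 1) + U x := by rw [← hχdef]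
      rw [hχx, add_dotProduct, sub_dotProduct, hUn, hUn]
      rcases lt_trichotomy x n with h | h | h
      · by_cases h' : x + 1 = n
        · subst h'
          rw [P.adj x hx hn, add_sub_cancel_right, h2 x (Or.inr ⟨hn, hn0⟩), h3 _ _ (by omega),
            h3 _ _ (by omega), h3 _ _ (by omega)]
          norm_num
        · rw [P.far x n hx hn (by omega), h3 _ _ (by omega),
            h3 _ _ (by omega), h3 _ _ (by omega), h3 _ _ (by omega)]
          norm_num
      · subst h; omega
      · by_cases h' : n + 1 = x
        · subst h'
          rw [dotProduct_comm, P.adj n hn hx, add_sub_cancel_right, h2 n (Or.inl ⟨hn, hn0⟩),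
            h3 _ _ (by omega), h3 _ _ (by omega), h3 _ _ (by omega)]
          norm_num
        · rw [dotProduct_comm, P.far n x hn hx (by omega), h3 _ _ (by omega),
            h3 _ _ (by omega), h3 _ _ (by omega), h3 _ _ (by omega)]
          norm_num
    rw [h4 n hn hn0, dotProduct_sub] at e1
    linarith
  · intro x k0 k1 k2 k3 k4 k5 e0 e1 e4
    refine P.no_110012 x (fun j hj hj' => ?_) e0 e1 k2.2 k3.2 e4
    obtain rfl | rfl | rfl | rfl | rfl | rfl : j = x ∨ j = x + 1 ∨ j = x + 2 ∨ j = x + 3 ∨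
      j = x + 4 ∨ j = x + 5 := by omega
    exacts [k0.1, k1.1, k2.1, k3.1, k4.1, k5.1]
  · intro x k0 k1 k2 k3 k4 k5 e0 e1 e4
    refine P.no_210011 x (fun j hj hj' => ?_) e0 e1 k2.2 k3.2 e4
    obtain rfl | rfl | rfl | rfl | rfl | rfl : j = x ∨ j = x + 1 ∨ j = x + 2 ∨ j = x + 3 ∨
      j = x + 4 ∨ j = x + 5 := by omega
    exacts [k0.1, k1.1, k2.1, k3.1, k4.1, k5.1]
  · intro x k0 k1 k2 k3 k4 e0 e1
    refine P.no_31001 x (fun j hj hj' => ?_) e0 e1 k2.2 k3.2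
    obtain rfl | rfl | rfl | rfl | rfl : j = x ∨ j = x + 1 ∨ j = x + 2 ∨ j = x + 3 ∨
      j = x + 4 := by omega
    exacts [k0.1, k1.1, k2.1, k3.1, k4.1]
  · intro x k0 k1 k2 k3 k4 e0 e3
    refine P.no_10013 x (fun j hj hj' => ?_) e0 k1.2 k2.2 e3
    obtain rfl | rfl | rfl | rfl | rfl : j = x ∨ j = x + 1 ∨ j = x + 2 ∨ j = x + 3 ∨
      j = x + 4 := by omega
    exacts [k0.1, k1.1, k2.1, k3.1, k4.1]
  · rintro x ⟨hx, hx1⟩ ⟨hy, hy1⟩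
    have := P.adj x hx hy
    rw [hf x, hf (x + 1), add_sub_cancel_right, hU x hx1 hy1] at this
    simp only [sub_dotProduct, dotProduct_sub, add_dotProduct, dotProduct_add, dotProduct_zero,
      zero_dotProduct, dotProduct_comm (U _) (χ _), h3 (x - 1) (x + 1) (by omega)] at this
    linarith
  · rintro x y ⟨hx, hx1⟩ ⟨hy, hy1⟩ hxy
    have := P.far x y hx hy hxy
    rw [hf x, hf y] at this
    simp only [sub_dotProduct, dotProduct_sub, add_dotProduct, dotProduct_add,
      dotProduct_comm (U _) (χ _), h3 (x - 1) (y - 1) (by omega), h3 (x - 1) y (by omega),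
      h3 x (y - 1) (by omega), h3 x y (by omega)] at this
    linarith
  · rintro x ⟨hx, hx1⟩ hl hr
    obtain ⟨l, r, hl', hr', h⟩ := P.norm x hx
    have e1 := hnorm x
    rw [hUl x l hx1 (fun h => hzero _ h hl) hl', hUr x r hx1 (fun h => hzero _ h hr) hr'] at e1
    linarith
  · rintro x ⟨hx, hx1⟩ ⟨hr, hr1⟩
    obtain ⟨l, r, hl', hr', h⟩ := P.norm x hx
    have e1 := hnorm x
    have e2 : r = 1 := by tauto
    rw [hUl x l hx1 (fun h => hzero _ h fun h' => P.no_three (x - 1) h (by simpa using hx)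
      (by rw [show x - 1 + 2 = x + 1 by ring]; exact hr) h'.2
      (by rw [sub_add_cancel]; exact hx1)
      (by rw [show x - 1 + 2 = x + 1 by ring]; exact hr1)) hl'] at e1
    rw [hU x hx1 hr1, zero_dotProduct] at e1
    rw [hU x hx1 hr1]
    linarith
  · rintro x ⟨hx, hx1⟩ ⟨hl, hl1⟩
    obtain ⟨l, r, hl', hr', h⟩ := P.norm x hx
    have e1 := hnorm x
    have e2 : l = 1 := by tauto
    rw [hUr x r hx1 (fun h => hzero _ h fun h' => P.no_three (x - 1) hl (by simpa using hx)
      (by rw [show x - 1 + 2 = x + 1 by ring]; exact h) hl1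
      (by rw [sub_add_cancel]; exact hx1)
      (by rw [show x - 1 + 2 = x + 1 by ring]; exact h'.2)) hr'] at e1
    have e3 := hU (x - 1) hl1 (by rwa [sub_add_cancel])
    rw [e3, zero_dotProduct] at e1
    rw [e3]
    linarith

theorem absDot_unit {u : Fin N → ℤ} (hu : u ⬝ᵥ u = 1 ∨ u = 0) (v : Fin N → ℤ) :
    absDot u v = |u ⬝ᵥ v| := by
  rcases hu with hu | rfl
  · exact absDot_of_norm_one hu v
  · simp [absDot]

theorem absDot_add_le (u u' v : Fin N → ℤ) : absDot (u + u') v ≤ absDot u v + absDot u' v := by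
  rw [absDot, absDot, absDot, ← Finset.sum_add_distrib]
  refine Finset.sum_le_sum fun i _ => ?_
  rw [← add_mul]
  exact mul_le_mul_of_nonneg_right (abs_add_le _ _) (abs_nonneg _)

theorem absDot_neg (u v : Fin N → ℤ) : absDot (-u) v = absDot u v := by
  simp [absDot]

theorem absDot_combination_le (u u' w v : Fin N → ℤ) :
    absDot (u - u' + w) v ≤ absDot u v + absDot u' v + absDot w v := by
  have h1 := absDot_add_le (u - u') w v
  have h2 := absDot_add_le u (-u') v
  rw [← sub_eq_add_neg, absDot_neg] at h2
  linarith

/-- The images of the vertices have entries in `{-1, 0, 1}`, adjacent vertices share exactly one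
coordinate and nonadjacent vertices share none. -/
theorem standard (P : PathSystem S a f) : (∀ n i, S n → |f n i| ≤ 1) ∧
    (∀ n, S n → S (n + 1) → absDot (f n) (f (n + 1)) = 1) ∧
    (∀ m n, S m → S n → m + 1 < n → absDot (f m) (f n) = 0) := by
  obtain ⟨χ, U, R, hf, hχ0⟩ := P.exists_reducedSystem
  have hU (g : ℤ) : U g ⬝ᵥ U g = 1 ∨ U g = 0 := by
    by_cases h : (S g ∧ a g = 0) ∨ (S (g + 1) ∧ a (g + 1) = 0)
    · exact Or.inl (R.gap_norm g h)
    · rw [not_or] at h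
      exact Or.inr (R.gap_zero g h.1 h.2)
  have hsplit (n : ℤ) (hn : S n) : χ n = 0 ∨ (S n ∧ 1 ≤ a n) := by
    have := P.nonneg hn
    by_cases h : a n = 0
    · exact Or.inl (hχ0 n hn h)
    · exact Or.inr ⟨hn, by omega⟩
  have hUU (g h : ℤ) (hne : g ≠ h) : absDot (U g) (U h) = 0 := by
    rw [absDot_unit (hU g), R.gap_orth g h hne]; rfl
  have hUU' (g : ℤ) : absDot (U g) (U g) ≤ 1 := by
    rw [absDot_unit (hU g)]
    rcases hU g with h | h <;> rw [h]
    · rfl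
    · simp
  have hUχ (g n : ℤ) (hn : S n) : absDot (U g) (χ n) = 0 := by
    rw [absDot_unit (hU g), dotProduct_comm]
    rcases hsplit n hn with h | h
    · rw [h]; simp
    · rw [R.coeff_eq_zero h]; rfl
  have hfv (n : ℤ) (v : Fin N → ℤ) :
      absDot (f n) v ≤ absDot (U (n - 1)) v + absDot (U n) v + absDot (χ n) v := by
    rw [hf n]
    exact absDot_combination_le _ _ _ _
  have hχχ (m n : ℤ) (hm : S m) (hn : S n) (hmn : m + 1 < n) : absDot (χ m) (χ n) = 0 := by
    rcases hsplit m hm with h | h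
    · rw [h]; simp [absDot]
    rcases hsplit n hn with h' | h'
    · rw [h']; simp [absDot]
    exact R.absDot_far h h' (by omega) (by omega)
  have hbound (m n : ℤ) (hm : S m) (hn : S n) : absDot (f m) (f n) ≤
      absDot (U (m - 1)) (U (n - 1)) + absDot (U (m - 1)) (U n) + absDot (U m) (U (n - 1)) +
      absDot (U m) (U n) + absDot (χ m) (χ n) := by
    have e1 := hfv m (f n)
    have e2 := hfv n (U (m - 1))
    have e3 := hfv n (U m)
    have e4 := hfv n (χ m)
    rw [absDot_comm (f n), absDot_comm (U _) (U _), absDot_comm (U n) (U _),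
      absDot_comm (χ n) (U _), hUχ _ _ hn] at e2 e3
    rw [absDot_comm (f n), hUχ _ _ hm, hUχ _ _ hm, absDot_comm (χ n)] at e4
    linarith
  refine ⟨fun n i hn => ?_, fun n hn hn' => ?_, fun m n hm hn hmn => ?_⟩
  · have h1 : |f n i| ≤ |U (n - 1) i| + |U n i| + |χ n i| := by
      rw [hf n]
      simp only [Pi.add_apply, Pi.sub_apply]
      exact (abs_add_le _ _).trans (by gcongr; exact abs_sub _ _)
    have e1 := mul_eq_zero_of_absDot_eq_zero (hUU (n - 1) n (by omega)) i
    have e2 := mul_eq_zero_of_absDot_eq_zero (hUχ (n - 1) n hn) i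
    have e3 := mul_eq_zero_of_absDot_eq_zero (hUχ n n hn) i
    have hUle (g : ℤ) : |U g i| ≤ 1 := by
      refine abs_apply_le_one ?_ i
      rcases hU g with h | h
      · omega
      · simp [h]
    have b1 := hUle (n - 1)
    have b2 := hUle n
    have b3 : |χ n i| ≤ 1 := by
      rcases hsplit n hn with h | h
      · simp [h]
      · exact R.abs_le_one h i
    rw [mul_eq_zero] at e1 e2 e3
    omega
  · have h1 := hbound n (n + 1) hn hn'
    rw [add_sub_cancel_right, hUU _ _ (by omega), hUU (n - 1) (n + 1) (by omega),
      hUU n (n + 1) (by omega)] at h1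
    obtain ⟨r, hr⟩ := even_absDot_sub (f n) (f (n + 1))
    rw [P.adj n hn hn'] at hr
    have h2 := absDot_nonneg (f n) (f (n + 1))
    suffices h : absDot (U n) (U n) + absDot (χ n) (χ (n + 1)) ≤ 1 by omega
    rcases hsplit n hn with h | h
    · rw [h]; simpa [absDot] using hUU' n
    rcases hsplit (n + 1) hn' with h' | h'
    · rw [h']; simpa [absDot] using hUU' n
    rw [R.absDot_adj h h' (Or.inl rfl), R.gap_zero n (fun h'' => R.disj _ h'' h)
      (fun h'' => R.disj _ h'' h')]
    simp [absDot]
  · have h1 := hbound m n hm hn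
    rw [hUU _ _ (by omega), hUU _ _ (by omega), hUU _ _ (by omega), hUU _ _ (by omega),
      hχχ m n hm hn hmn] at h1
    have := absDot_nonneg (f m) (f n)
    omega

end PathSystem

theorem linearPlumbing_exists_pos {k : ℕ} (c : Fin k → List ℤ) :
    ∃ pos : (Σ i : Fin k, Fin (c i).length) → ℤ, Function.Injective pos ∧
      ∀ u v, (linearPlumbing c).graph.Adj u v ↔ pos u + 1 = pos v ∨ pos v + 1 = pos u := by
  obtain ⟨M, hM⟩ : ∃ M : ℕ, ∀ i, (c i).length ≤ M :=
    ⟨∑ i, (c i).length, fun i => Finset.single_le_sum (f := fun i => (c i).length)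
      (fun _ _ => Nat.zero_le _) (Finset.mem_univ i)⟩
  have key : ∀ u v : (Σ i : Fin k, Fin (c i).length), (u.1 : ℕ) < v.1 →
      ((u.1 : ℕ) * (M + 1) + u.2 : ℤ) + 1 < (v.1 : ℕ) * (M + 1) + v.2 := by
    rintro ⟨i, s⟩ ⟨j, t⟩ hij
    simp only at hij ⊢
    have hs : (s : ℕ) < M := lt_of_lt_of_le s.2 (hM i)
    have h1 : ((i : ℕ) + 1) * (M + 1) ≤ (j : ℕ) * (M + 1) := Nat.mul_le_mul_right _ hij
    have h2 : (i : ℕ) * (M + 1) + s + 1 < (j : ℕ) * (M + 1) + t := by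
      rw [add_mul] at h1; omega
    exact_mod_cast h2
  refine ⟨fun u => (u.1 : ℕ) * (M + 1) + u.2, ?_, ?_⟩
  · intro u v huv
    simp only at huv
    rcases lt_trichotomy (u.1 : ℕ) v.1 with h | h | h
    · have := key u v h; omega
    · obtain ⟨i, s⟩ := u
      obtain ⟨j, t⟩ := v
      obtain rfl : i = j := Fin.ext h
      simp only at huv
      obtain rfl : s = t := Fin.ext (by omega)
      rfl
    · have := key v u h; omega
  · intro u v
    simp only [linearPlumbing]
    rcases lt_trichotomy (u.1 : ℕ) v.1 with h | h | h
    · have := key u v h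
      refine ⟨fun h' => ?_, fun h' => by omega⟩
      rw [h'.1] at h; omega
    · obtain ⟨i, s⟩ := u
      obtain ⟨j, t⟩ := v
      obtain rfl : i = j := Fin.ext h
      simp only [true_and]
      omega
    · have := key v u h
      refine ⟨fun h' => ?_, fun h' => by omega⟩
      rw [h'.1] at h; omega

theorem card_support_inter {N : ℕ} {u v : Fin N → ℤ} (hu : ∀ i, |u i| ≤ 1) (hv : ∀ i, |v i| ≤ 1) :
    ((latticeSupport u ∩ latticeSupport v).card : ℤ) = absDot u v := by
  rw [latticeSupport, latticeSupport, ← Finset.filter_and, Finset.card_filter, absDot]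
  push_cast
  refine Finset.sum_congr rfl fun i _ => ?_
  have e (x : ℤ) (hx : |x| ≤ 1) (h : x ≠ 0) : |x| = 1 := by
    have := abs_pos.2 h; omega
  by_cases h1 : u i = 0
  · simp [h1]
  by_cases h2 : v i = 0
  · simp [h2]
  simp [h1, h2, e _ (hu i) h1, e _ (hv i) h2]

theorem absDot_self {N : ℕ} (u : Fin N → ℤ) : absDot u u = u ⬝ᵥ u :=
  Finset.sum_congr rfl fun _ _ => abs_mul_abs_self _

theorem stdLattice_apply {N : ℕ} (x y : Fin N → ℤ) : stdLattice N x y = x ⬝ᵥ y := rfl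

namespace WeightedGraph

variable {V : Type*} {Γ : WeightedGraph V}

theorem IsLinearUnion.exists_pos (h : Γ.IsLinearUnion) : ∃ pos : V → ℤ, Function.Injective pos ∧
    ∀ u v, Γ.graph.Adj u v ↔ pos u + 1 = pos v ∨ pos v + 1 = pos u := by
  obtain ⟨k, c, f, -⟩ := h
  obtain ⟨pos, h1, h2⟩ := linearPlumbing_exists_pos c
  refine ⟨pos ∘ f, h1.comp f.injective, fun u v => ?_⟩
  rw [← f.map_adj_iff]
  exact h2 _ _

theorem HasAdjPath.reverse {l : List ℤ} (h : Γ.HasAdjPath l) : Γ.HasAdjPath l.reverse := by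
  obtain ⟨vs, h1, h2, h3⟩ := h
  refine ⟨vs.reverse, List.nodup_reverse.2 h1, ?_, by rw [List.map_reverse, h3]⟩
  rw [List.isChain_reverse]
  exact h2.imp fun _ _ h => h.symm

section Position

variable {pos : V → ℤ}

theorem hasAdjPath_of_pos
    (hadj : ∀ u v, Γ.graph.Adj u v ↔ pos u + 1 = pos v ∨ pos v + 1 = pos u)
    (l : List ℤ) (n : ℤ)
    (h : ∀ (j : ℕ) (hj : j < l.length), ∃ v, pos v = n + j ∧ Γ.adjWeight v = l[j]) :
    Γ.HasAdjPath l := by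
  choose g hg hg' using h
  refine ⟨List.ofFn fun j : Fin l.length => g j j.2, ?_, ?_, ?_⟩
  · rw [List.nodup_ofFn]
    intro i j hij
    have h1 := hg i i.2
    have h2 := hg j j.2
    simp only at hij
    rw [hij] at h1
    exact Fin.ext (by omega)
  · rw [List.isChain_iff_getElem]
    intro i hi
    rw [List.length_ofFn] at hi
    simp only [List.getElem_ofFn]
    rw [hadj, hg, hg]
    left; push_cast; ring
  · rw [List.map_ofFn]
    apply List.ext_getElem
    · simp
    · intro i h1 h2
      simp [hg']

open Classical in
/-- Transport of a function on the vertices to positions. -/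
noncomputable def atPos {α : Type*} [Zero α] (pos : V → ℤ) (φ : V → α) (n : ℤ) : α :=
  if h : ∃ v, pos v = n then φ h.choose else 0

theorem atPos_pos (hinj : Function.Injective pos) {α : Type*} [Zero α] (φ : V → α) (v : V) :
    atPos pos φ (pos v) = φ v := by
  have h : ∃ u, pos u = pos v := ⟨v, rfl⟩
  rw [atPos, dif_pos h, hinj h.choose_spec]

theorem neighborSet_ncard (hinj : Function.Injective pos)
    (hadj : ∀ u v, Γ.graph.Adj u v ↔ pos u + 1 = pos v ∨ pos v + 1 = pos u)
    (v : V) : ∃ l r : ℤ,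
    ((∃ u, pos u = pos v - 1) ∧ l = 1 ∨ (¬ ∃ u, pos u = pos v - 1) ∧ l = 0) ∧
    ((∃ u, pos u = pos v + 1) ∧ r = 1 ∨ (¬ ∃ u, pos u = pos v + 1) ∧ r = 0) ∧
    ((Γ.graph.neighborSet v).ncard : ℤ) = l + r := by
  have h1 (n : ℤ) : ∃ l : ℤ, ((∃ u, pos u = n) ∧ l = 1 ∨ (¬ ∃ u, pos u = n) ∧ l = 0) ∧
      (({u | pos u = n} : Set V).ncard : ℤ) = l ∧ ({u | pos u = n} : Set V).Finite := by
    by_cases h : ∃ u, pos u = n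
    · obtain ⟨u, rfl⟩ := h
      have : {w | pos w = pos u} = {u} := by
        ext w; simp [hinj.eq_iff]
      exact ⟨1, Or.inl ⟨⟨u, rfl⟩, rfl⟩, by rw [this]; simp, by rw [this]; simp⟩
    · have : {w | pos w = n} = ∅ := by
        ext w
        simp only [Set.mem_ofPred_eq, Set.mem_empty_iff_false, iff_false]
        exact fun hw => h ⟨w, hw⟩
      exact ⟨0, Or.inr ⟨h, rfl⟩, by rw [this]; simp, by rw [this]; simp⟩
  obtain ⟨l, hl, hl', fl⟩ := h1 (pos v - 1)
  obtain ⟨r, hr, hr', fr⟩ := h1 (pos v + 1)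
  refine ⟨l, r, hl, hr, ?_⟩
  have : Γ.graph.neighborSet v = {u | pos u = pos v - 1} ∪ {u | pos u = pos v + 1} := by
    ext u
    rw [SimpleGraph.mem_neighborSet, hadj]
    simp only [Set.mem_union, Set.mem_ofPred_eq]
    omega
  rw [this, Set.ncard_union_eq _ fl fr]
  · push_cast
    rw [hl', hr']
  · rw [Set.disjoint_left]
    intro u hu hu'
    simp only [Set.mem_ofPred_eq] at hu hu'
    omega

theorem WorkingConditions.pathSystem (hinj : Function.Injective pos)
    (hadj : ∀ u v, Γ.graph.Adj u v ↔ pos u + 1 = pos v ∨ pos v + 1 = pos u)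
    [Fintype V] (hΓ : Γ.WorkingConditions) {N : ℕ}
    {φ : V → Fin N → ℤ} (hφ : Γ.IsEmbedding φ) :
    PathSystem (fun n => ∃ v, pos v = n) (atPos pos Γ.adjWeight) (atPos pos φ) := by
  have hself (v : V) : φ v ⬝ᵥ φ v = Γ.weight v := by
    have := hφ v v
    rw [stdLattice_apply] at this
    rw [this]; simp [latticeMatrix]
  have ha := atPos_pos hinj Γ.adjWeight
  have hf := atPos_pos hinj φ
  have hpath (l : List ℤ) (n : ℤ) (h : ∀ (j : ℕ) (hj : j < l.length),
      (∃ v, pos v = n + j) ∧ atPos pos Γ.adjWeight (n + j) = l[j]) : Γ.HasAdjPath l := by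
    refine hasAdjPath_of_pos hadj l n fun j hj => ?_
    obtain ⟨⟨v, hv⟩, h2⟩ := h j hj
    exact ⟨v, hv, by rw [← h2, ← hv, ha]⟩
  have h110012 (x : ℤ) (h : ∀ j, x ≤ j → j ≤ x + 5 → ∃ v, pos v = j) (l : List ℤ)
      (hl : l.length = 6) (hj : ∀ (j : ℕ) (hj : j < l.length),
        atPos pos Γ.adjWeight (x + j) = l[j]) : Γ.HasAdjPath l :=
    hpath l x fun j hj' => ⟨h _ (by omega) (by omega), hj j hj'⟩
  have h31001 (x : ℤ) (h : ∀ j, x ≤ j → j ≤ x + 4 → ∃ v, pos v = j) (l : List ℤ)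
      (hl : l.length = 5) (hj : ∀ (j : ℕ) (hj : j < l.length),
        atPos pos Γ.adjWeight (x + j) = l[j]) : Γ.HasAdjPath l :=
    hpath l x fun j hj' => ⟨h _ (by omega) (by omega), hj j hj'⟩
  have hlong (x : ℤ) (k : ℕ) (h : ∀ j, x ≤ j → j ≤ x + k + 1 → ∃ v, pos v = j)
      (h0 : ∀ j, x < j → j ≤ x + k → atPos pos Γ.adjWeight j = 0) : Γ.HasAdjPath
        (atPos pos Γ.adjWeight x :: (List.replicate k 0 ++ [atPos pos Γ.adjWeight (x + k + 1)])) := by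
    refine hpath _ x fun j hj => ⟨h _ (by omega) ?_, ?_⟩
    · simp only [List.length_cons, List.length_append, List.length_replicate, List.length_nil] at hj
      omega
    · rcases j with _ | j
      · simp
      · simp only [List.length_cons, List.length_append, List.length_replicate,
          List.length_nil] at hj
        simp only [List.getElem_cons_succ]
        by_cases hjk : j < k
        · rw [List.getElem_append_left (by simpa using hjk), List.getElem_replicate]
          exact h0 _ (by omega) (by omega)
        · obtain rfl : j = k := by omega
          rw [List.getElem_append_right (by simp)]
          simp only [List.length_replicate, Nat.sub_self, List.getElem_cons_zero]
          congr 1; push_cast; ring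
  refine
    { bounded := ?_
      norm := ?_
      adj := ?_
      far := ?_
      two_le := ?_
      le_three := ?_
      unique := ?_
      no_three := ?_
      no_one_one := ?_
      long_right := ?_
      long_left := ?_
      no_110012 := ?_
      no_210011 := ?_
      no_31001 := ?_
      no_10013 := ?_ }
  · refine ⟨∑ v, |pos v| + 1, ?_⟩
    rintro _ ⟨v, rfl⟩
    have h := Finset.single_le_sum (f := fun v => |pos v|) (fun _ _ => abs_nonneg _)
      (Finset.mem_univ v)
    have h1 := neg_abs_le (pos v)
    have h2 := le_abs_self (pos v)
    constructor <;> linarith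
  · rintro _ ⟨v, rfl⟩
    obtain ⟨l, r, h1, h2, h3⟩ := neighborSet_ncard hinj hadj v
    refine ⟨l, r, h1, h2, ?_⟩
    rw [ha, hf, hself, adjWeight, h3]
    ring
  · rintro _ ⟨u, rfl⟩ ⟨v, hv⟩
    rw [← hv, hf, hf, ← stdLattice_apply, hφ, latticeMatrix, Matrix.of_apply, if_neg, if_pos]
    · rw [hadj]; exact Or.inl hv.symm
    · rintro rfl; omega
  · rintro _ _ ⟨u, rfl⟩ ⟨v, rfl⟩ huv
    rw [hf, hf, ← stdLattice_apply, hφ, latticeMatrix, Matrix.of_apply, if_neg, if_neg]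
    · rw [hadj]; omega
    · rintro rfl; omega
  · rintro _ ⟨v, rfl⟩
    rw [hf, hself]
    exact hΓ.two_le_weight v
  · rintro _ ⟨v, rfl⟩
    rw [ha]
    exact hΓ.adjWeight_le_three v
  · rintro _ _ ⟨u, rfl⟩ ⟨v, rfl⟩
    rw [ha, ha]
    intro h h'
    rw [hΓ.at_most_one_large u v h h']
  · intro x h0 h1 h2 p0 p1 p2
    refine hΓ.no_three_adjacent _ _ _ p0 p1 p2 (hpath _ x fun j hj => ?_)
    simp only [List.length_cons, List.length_nil] at hj
    interval_cases j
    · simpa using h0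
    · simpa using h1
    · simpa using h2
  · rintro _ x ⟨v, rfl⟩ h3 h0 h1 e0 e1
    rw [ha] at h3
    refine hΓ.no_one_one_of_three ⟨v, h3⟩ (hpath _ x fun j hj => ?_)
    simp only [List.length_cons, List.length_nil] at hj
    interval_cases j
    · simpa using ⟨h0, e0⟩
    · simpa using ⟨h1, e1⟩
  · intro x k hk h h1 h0 hr
    have := hlong x k h h0
    rw [hr] at this
    exact hΓ.long_chain _ k h1 hk this
  · intro x k hk h hl h0 h1
    have := (hlong x k h h0).reverse
    rw [hl] at this
    refine hΓ.long_chain _ k h1 hk ?_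
    simpa using this
  · intro x h e0 e1 e2 e3 e4 e5
    refine hΓ.no_110012 (h110012 x h _ rfl fun j hj => ?_)
    simp only [List.length_cons, List.length_nil] at hj
    interval_cases j <;> simpa
  · intro x h e0 e1 e2 e3 e4 e5
    refine hΓ.no_110012 ((h110012 x h [2, 1, 0, 0, 1, 1] rfl fun j hj => ?_).reverse)
    simp only [List.length_cons, List.length_nil] at hj
    interval_cases j <;> simpa
  · intro x h e0 e1 e2 e3 e4
    refine hΓ.no_31001 (h31001 x h _ rfl fun j hj => ?_)
    simp only [List.length_cons, List.length_nil] at hj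
    interval_cases j <;> simpa
  · intro x h e0 e1 e2 e3 e4
    refine hΓ.no_31001 ((h31001 x h [1, 0, 0, 1, 3] rfl fun j hj => ?_).reverse)
    simp only [List.length_cons, List.length_nil] at hj
    interval_cases j <;> simpa

theorem WorkingConditions.entries_and_absDot (hinj : Function.Injective pos)
    (hadj : ∀ u v, Γ.graph.Adj u v ↔ pos u + 1 = pos v ∨ pos v + 1 = pos u)
    [Fintype V] (hΓ : Γ.WorkingConditions) {N : ℕ}
    {φ : V → Fin N → ℤ} (hφ : Γ.IsEmbedding φ) : (∀ v i, |φ v i| ≤ 1) ∧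
      (∀ u v, Γ.graph.Adj u v → absDot (φ u) (φ v) = 1) ∧
      (∀ u v, u ≠ v → ¬ Γ.graph.Adj u v → absDot (φ u) (φ v) = 0) := by
  obtain ⟨h1, h2, h3⟩ := (hΓ.pathSystem hinj hadj hφ).standard
  have hf := atPos_pos hinj φ
  refine ⟨fun v i => ?_, fun u v huv => ?_, fun u v hne huv => ?_⟩
  · have := h1 (pos v) i ⟨v, rfl⟩
    rwa [hf] at this
  · rcases (hadj u v).1 huv with h | h
    · have := h2 (pos u) ⟨u, rfl⟩ ⟨v, h.symm⟩
      rwa [h, hf, hf] at this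
    · have := h2 (pos v) ⟨v, rfl⟩ ⟨u, h.symm⟩
      rwa [h, hf, hf, absDot_comm] at this
  · rw [hadj] at huv
    rcases lt_or_gt_of_ne (hinj.ne hne) with h | h
    · have := h3 (pos u) (pos v) ⟨u, rfl⟩ ⟨v, rfl⟩ (by omega)
      rwa [hf, hf] at this
    · have := h3 (pos v) (pos u) ⟨v, rfl⟩ ⟨u, rfl⟩ (by omega)
      rwa [hf, hf, absDot_comm] at this

end Position

theorem WorkingConditions.isStandard [Fintype V] (hΓ : Γ.WorkingConditions)
    (hlin : Γ.IsLinearUnion) {N : ℕ} {φ : V → Fin N → ℤ} (hφ : Γ.IsEmbedding φ) :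
    Γ.IsStandard φ := by
  obtain ⟨pos, hinj, hadj⟩ := hlin.exists_pos
  obtain ⟨h1, h2, h3⟩ := hΓ.entries_and_absDot hinj hadj hφ
  intro u v
  rw [card_support_inter (h1 u) (h1 v)]
  split_ifs with h h'
  · subst h
    rw [absDot_self, ← stdLattice_apply, hφ, latticeMatrix, Matrix.of_apply, if_pos rfl]
  · exact h2 u v h'
  · exact h3 u v h h'

end WeightedGraph

/-- Two families of finite sets indexed by the same type agree up to a permutation of the indices
if every finite set is contained in equally many members of both. -/
theorem exists_perm_of_card_superset {ι V : Type*} [Fintype ι] [Fintype V]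
    [DecidableEq V] (f g : ι → Finset V)
    (h : ∀ K, (Finset.univ.filter fun i => K ⊆ f i).card =
      (Finset.univ.filter fun i => K ⊆ g i).card) :
    ∃ σ : Equiv.Perm ι, ∀ i, g (σ i) = f i := by
  classical
  have hsum (f : ι → Finset V) (K : Finset V) : (Finset.univ.filter fun i => K ⊆ f i).card =
      (Finset.univ.filter fun i => f i = K).card +
      ∑ L ∈ Finset.univ.filter (fun L => K ⊂ L), (Finset.univ.filter fun i => f i = L).card := by
    have e : Finset.univ.filter (fun i => K ⊆ f i) = Finset.univ.filter (fun i => f i = K) ∪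
        Finset.univ.filter (fun i => K ⊂ f i) := by
      ext i
      simp only [Finset.mem_filter, Finset.mem_univ, true_and, Finset.mem_union]
      exact ⟨fun h => h.eq_or_ssubset.imp Eq.symm id,
        fun h => h.elim (fun h => h.ge) fun h => h.subset⟩
    rw [e, Finset.card_union_of_disjoint, Finset.card_eq_sum_card_fiberwise (f := f)
      (s := Finset.univ.filter fun i => K ⊂ f i) (t := Finset.univ.filter (fun L => K ⊂ L))]
    · congr 1
      refine Finset.sum_congr rfl fun L hL => ?_
      congr 1
      ext i
      simp only [Finset.mem_filter, Finset.mem_univ, true_and] at hL ⊢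
      exact ⟨fun h => h.2, fun h => ⟨h ▸ hL, h⟩⟩
    · intro i hi
      simpa using hi
    · rw [Finset.disjoint_left]
      intro i hi hi'
      simp only [Finset.mem_filter, Finset.mem_univ, true_and] at hi hi'
      exact hi'.ne hi.symm
  have hfib : ∀ K : Finset V, (Finset.univ.filter fun i => f i = K).card =
      (Finset.univ.filter fun i => g i = K).card := by
    intro K
    refine Finset.strongDownwardInductionOn (n := Fintype.card V) K (fun K ih _ => ?_)
      (Finset.card_le_univ K)
    have h1 := h K
    rw [hsum f K, hsum g K, Finset.sum_congr rfl (g := fun L =>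
      (Finset.univ.filter fun i => g i = L).card)] at h1
    · exact Nat.add_right_cancel h1
    · intro L hL
      exact ih (Finset.card_le_univ L) (by simpa using hL)
  have e (K : Finset V) : Nonempty ({i // f i = K} ≃ {i // g i = K}) := by
    refine ⟨Fintype.equivOfCardEq ?_⟩
    rw [Fintype.card_subtype, Fintype.card_subtype, hfib]
  exact ⟨Equiv.ofFiberEquiv fun K => (e K).some, fun i => Equiv.ofFiberEquiv_map _ i⟩

/-- The automorphism of `ℤ^N` given by a permutation of the coordinates and signs. -/
def signedPerm {N : ℕ} (σ : Equiv.Perm (Fin N)) (ε : Fin N → ℤ) (hε : ∀ i, ε i * ε i = 1) :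
    LinearMap.BilinForm.IsometryEquiv (stdLattice N) (stdLattice N) where
  toFun x i := ε (σ.symm i) * x (σ.symm i)
  invFun x i := ε i * x (σ i)
  map_add' x y := by ext i; simp [mul_add]
  map_smul' c x := by ext i; simp [mul_left_comm]
  left_inv x := by ext i; simp [← mul_assoc, hε]
  right_inv x := by ext i; simp [← mul_assoc, hε]
  map_app' x y := by
    rw [stdLattice_apply, stdLattice_apply]
    refine Fintype.sum_equiv σ.symm _ _ fun i => ?_
    linear_combination (x (σ.symm i) * y (σ.symm i)) * hε (σ.symm i)

namespace WeightedGraph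

variable {V : Type*} {Γ : WeightedGraph V}

theorem IsStandard.abs_le_one {N : ℕ} {φ : V → Fin N → ℤ} (hs : Γ.IsStandard φ)
    (hφ : Γ.IsEmbedding φ) (v : V) (i : Fin N) (hi : φ v i ≠ 0) : φ v i * φ v i = 1 := by
  have h1 := hs v v
  have h2 := hφ v v
  rw [if_pos rfl, Finset.inter_self] at h1
  rw [stdLattice_apply, latticeMatrix, Matrix.of_apply, if_pos rfl, ← h1] at h2
  rw [dotProduct, latticeSupport, Finset.card_filter] at h2
  push_cast at h2
  have hle : ∀ j ∈ Finset.univ, (if φ v j ≠ 0 then (1 : ℤ) else 0) ≤ φ v j * φ v j := by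
    intro j _
    split_ifs with h
    · have := mul_self_pos.2 h; omega
    · exact mul_self_nonneg _
  have := (Finset.sum_eq_sum_iff_of_le hle).1 h2.symm i (Finset.mem_univ i)
  rw [if_pos hi] at this
  exact this.symm

theorem IsStandard.mul_eq_neg_one {N : ℕ} {φ : V → Fin N → ℤ} (hs : Γ.IsStandard φ)
    (hφ : Γ.IsEmbedding φ) {u v : V} (huv : u ≠ v) {i : Fin N} (hu : φ u i ≠ 0) (hv : φ v i ≠ 0) :
    Γ.graph.Adj u v ∧ φ u i * φ v i = -1 := by
  have h1 := hs u v
  have h2 := hφ u v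
  have hi : i ∈ latticeSupport (φ u) ∩ latticeSupport (φ v) := by
    simp [latticeSupport, hu, hv]
  rw [if_neg huv] at h1
  by_cases hadj : Γ.graph.Adj u v
  swap
  · rw [if_neg hadj] at h1
    have := Finset.card_pos.2 ⟨i, hi⟩
    omega
  refine ⟨hadj, ?_⟩
  rw [if_pos hadj] at h1
  obtain ⟨j, hj⟩ := Finset.card_eq_one.1 (by exact_mod_cast h1)
  rw [hj, Finset.mem_singleton] at hi
  subst hi
  rw [stdLattice_apply, latticeMatrix, Matrix.of_apply, if_neg huv, if_pos hadj, dotProduct,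
    Finset.sum_eq_single i] at h2
  · exact h2
  · intro k _ hk
    by_contra hne
    refine hk (Finset.mem_singleton.1 (hj ▸ ?_))
    simp [latticeSupport, left_ne_zero_of_mul hne, right_ne_zero_of_mul hne]
  · simp

/-- The number of coordinates common to the supports of a set of vertices does not depend on the
standard embedding. -/
theorem card_common_support_eq [Fintype V] [DecidableEq V] (hlin : Γ.IsLinearUnion) {N : ℕ}
    {φ φ' : V → Fin N → ℤ} (hs : Γ.IsStandard φ) (hs' : Γ.IsStandard φ') (K : Finset V) :
    (Finset.univ.filter fun i => K ⊆ Finset.univ.filter fun v => φ v i ≠ 0).card =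
      (Finset.univ.filter fun i => K ⊆ Finset.univ.filter fun v => φ' v i ≠ 0).card := by
  have hsub (φ : V → Fin N → ℤ) (u v : V) (hu : u ∈ K) (hv : v ∈ K) :
      (Finset.univ.filter fun i => K ⊆ Finset.univ.filter fun v => φ v i ≠ 0) ⊆
        latticeSupport (φ u) ∩ latticeSupport (φ v) := by
    intro i hi
    simp only [Finset.mem_filter, Finset.mem_univ, true_and] at hi
    have h1 := hi hu
    have h2 := hi hv
    simp only [Finset.mem_filter, Finset.mem_univ, true_and] at h1 h2
    simp [latticeSupport, h1, h2]
  by_cases hbad : ∃ u ∈ K, ∃ v ∈ K, u ≠ v ∧ ¬ Γ.graph.Adj u v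
  · obtain ⟨u, hu, v, hv, huv, hadj⟩ := hbad
    have h0 (φ : V → Fin N → ℤ) (hs : Γ.IsStandard φ) :
        (Finset.univ.filter fun i => K ⊆ Finset.univ.filter fun v => φ v i ≠ 0).card = 0 := by
      have h1 := hs u v
      rw [if_neg huv, if_neg hadj] at h1
      have h2 := Finset.card_le_card (hsub φ u v hu hv)
      omega
    rw [h0 φ hs, h0 φ' hs']
  push Not at hbad
  have hpair (u v : V) (hK : K = {u, v}) (φ : V → Fin N → ℤ) :
      (Finset.univ.filter fun i => K ⊆ Finset.univ.filter fun v => φ v i ≠ 0) =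
        latticeSupport (φ u) ∩ latticeSupport (φ v) := by
    refine Finset.Subset.antisymm (hsub φ u v (by simp [hK]) (by simp [hK])) fun i hi => ?_
    simp only [latticeSupport, Finset.mem_inter, Finset.mem_filter, Finset.mem_univ,
      true_and] at hi
    simp only [Finset.mem_filter, Finset.mem_univ, true_and]
    intro w hw
    rw [hK, Finset.mem_insert, Finset.mem_singleton] at hw
    rcases hw with rfl | rfl <;> simp [hi]
  rcases K.eq_empty_or_nonempty with rfl | ⟨u, hu⟩
  · simp
  obtain ⟨v, hK⟩ : ∃ v, K = {u, v} := by
    by_cases h : ∃ v ∈ K, v ≠ u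
    · obtain ⟨v, hv, hvu⟩ := h
      refine ⟨v, ?_⟩
      ext w
      rw [Finset.mem_insert, Finset.mem_singleton]
      refine ⟨fun hw => ?_, fun hw => by rcases hw with rfl | rfl <;> assumption⟩
      by_contra! hne
      obtain ⟨pos, hinj, hadj⟩ := hlin.exists_pos
      have h1 := (hadj _ _).1 (hbad u hu v hv hvu.symm)
      have h2 := (hadj _ _).1 (hbad u hu w hw hne.1.symm)
      have h3 := (hadj _ _).1 (hbad v hv w hw hne.2.symm)
      omega
    · push Not at h
      refine ⟨u, ?_⟩
      ext w
      rw [Finset.pair_eq_singleton, Finset.mem_singleton]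
      exact ⟨fun hw => h w hw, fun hw => hw ▸ hu⟩
  rw [hpair u v hK, hpair u v hK]
  have h1 := hs u v
  rw [← hs' u v] at h1
  exact_mod_cast h1

theorem exists_isometryEquiv_of_isStandard [Fintype V] (hlin : Γ.IsLinearUnion) {N : ℕ}
    {φ φ' : V → Fin N → ℤ} (hφ : Γ.IsEmbedding φ) (hφ' : Γ.IsEmbedding φ') (hs : Γ.IsStandard φ)
    (hs' : Γ.IsStandard φ') :
    ∃ α : LinearMap.BilinForm.IsometryEquiv (stdLattice N) (stdLattice N),
      ∀ v, φ' v = α (φ v) := by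
  classical
  obtain ⟨σ, hσ⟩ := exists_perm_of_card_superset (fun i => Finset.univ.filter fun v => φ v i ≠ 0)
    (fun i => Finset.univ.filter fun v => φ' v i ≠ 0) (card_common_support_eq hlin hs hs')
  have hσ' (v : V) (i : Fin N) : φ' v (σ i) ≠ 0 ↔ φ v i ≠ 0 := by
    have := congrArg (v ∈ ·) (hσ i)
    simpa using this
  have hsign (i : Fin N) : ∃ ε : ℤ, ε * ε = 1 ∧ ∀ v, φ' v (σ i) = ε * φ v i := by
    by_cases h : ∃ u, φ u i ≠ 0
    · obtain ⟨u, hu⟩ := h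
      have hu' := (hσ' u i).2 hu
      have e1 := hs.abs_le_one hφ u i hu
      have e2 := hs'.abs_le_one hφ' u (σ i) hu'
      refine ⟨φ' u (σ i) * φ u i, by linear_combination φ u i * φ u i * e2 + e1, fun v => ?_⟩
      by_cases huv : u = v
      · subst huv
        linear_combination -φ' u (σ i) * e1
      by_cases hv : φ v i = 0
      · have := (hσ' v i).not.2 (not_not.2 hv)
        rw [hv, mul_zero]
        exact not_not.1 this
      · have e3 := (hs.mul_eq_neg_one hφ huv hu hv).2
        have e4 := (hs'.mul_eq_neg_one hφ' huv hu' ((hσ' v i).2 hv)).2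
        linear_combination φ' u (σ i) * e4 - φ' v (σ i) * e2 - φ' u (σ i) * e3
    · push Not at h
      refine ⟨1, rfl, fun v => ?_⟩
      have := (hσ' v i).not.2 (not_not.2 (h v))
      rw [h v, mul_zero]
      exact not_not.1 this
  choose ε h1 h2 using hsign
  refine ⟨signedPerm σ ε h1, fun v => ?_⟩
  ext i
  change _ = ε (σ.symm i) * φ v (σ.symm i)
  rw [← h2, Equiv.apply_symm_apply]

theorem WorkingConditions.isRigid [Fintype V] (hΓ : Γ.WorkingConditions)
    (hlin : Γ.IsLinearUnion) : Γ.IsRigid := fun _ _ _ hφ hφ' =>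
  exists_isometryEquiv_of_isStandard hlin hφ hφ' (hΓ.isStandard hlin hφ) (hΓ.isStandard hlin hφ')

theorem IsRigid.isRigidLattice [Fintype V] (h : Γ.IsRigid) : IsRigidLattice Γ.latticeForm := by
  classical
  intro N _ φ φ'
  have hemb (φ : LinearMap.BilinForm.Isometry Γ.latticeForm (stdLattice N)) :
      Γ.IsEmbedding fun v => φ (Pi.single v 1) := by
    intro u v
    rw [φ.map_app, latticeForm]
    convert Matrix.toBilin'_single Γ.latticeMatrix u v
  obtain ⟨α, hα⟩ := h N _ _ (hemb φ) (hemb φ')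
  refine ⟨α, fun x => ?_⟩
  have : φ'.toLinearMap = α.toLinearEquiv.toLinearMap ∘ₗ φ.toLinearMap := by
    refine (Pi.basisFun ℤ V).ext fun v => ?_
    rw [Pi.basisFun_apply]
    exact hα v
  exact congrArg (fun f => f x) this

end WeightedGraph

/-- Increase the first entry of a list by one. -/
def incHead : List ℤ → List ℤ
  | [] => []
  | h :: t => (h + 1) :: t

/-- The adjusted weights of the linear graph dual to the linear graph with weights `-a`: every
entry `m + 3` of `a` contributes `m` zeros, and every maximal run of `k ≥ 0` entries `2` between
entries larger than `2` contributes one entry `k + 1`. -/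
def dualAdj : List ℤ → List ℤ
  | [] => [1]
  | x :: a => if x = 2 then incHead (dualAdj a)
      else 1 :: (List.replicate (x - 3).toNat 0 ++ dualAdj a)

/-- The weights of the vertices of a linear graph with the given adjusted weights, the first of
which has a further neighbour on its left. -/
def addDegreeTail : List ℤ → List ℤ
  | [] => []
  | [h] => [h + 1]
  | h :: t => (h + 2) :: addDegreeTail t

/-- The weights of the vertices of a linear graph with the given adjusted weights. -/
def addDegree : List ℤ → List ℤ
  | [] => []
  | [h] => [h]
  | h :: t => (h + 1) :: addDegreeTail t

theorem dualAdj_two (a : List ℤ) : dualAdj (2 :: a) = incHead (dualAdj a) := by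
  simp [dualAdj]

theorem dualAdj_add_three (m : ℕ) (a : List ℤ) :
    dualAdj (((m : ℤ) + 3) :: a) = 1 :: (List.replicate m 0 ++ dualAdj a) := by
  rw [dualAdj, if_neg (by omega)]
  simp

theorem exists_eq_add_three {x : ℤ} (hx : 2 ≤ x) (h : x ≠ 2) : ∃ m : ℕ, x = m + 3 :=
  ⟨(x - 3).toNat, by omega⟩

/-- Induction over lists with entries at least two. -/
theorem list_two_le_induction {P : ∀ a : List ℤ, (∀ x ∈ a, 2 ≤ x) → Prop}
    (nil : ∀ h, P [] h) (two : ∀ a ha, P a ha → ∀ h, P (2 :: a) h)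
    (large : ∀ (m : ℕ) a ha, P a ha → ∀ h, P (((m : ℤ) + 3) :: a) h) (a : List ℤ)
    (ha : ∀ x ∈ a, 2 ≤ x) : P a ha := by
  induction a with
  | nil => exact nil _
  | cons x a ih =>
    have h1 : ∀ y ∈ a, 2 ≤ y := fun y hy => ha y (List.mem_cons_of_mem _ hy)
    by_cases hx : x = 2
    · subst hx; exact two a h1 (ih h1) _
    · obtain ⟨m, rfl⟩ := exists_eq_add_three (ha x (by simp)) hx
      exact large m a h1 (ih h1) _

theorem dualAdj_eq_cons {a : List ℤ} (ha : ∀ x ∈ a, 2 ≤ x) :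
    ∃ h t, dualAdj a = h :: t ∧ 1 ≤ h := by
  induction a, ha using list_two_le_induction with
  | nil _ => exact ⟨1, [], rfl, le_rfl⟩
  | two a _ ih _ =>
    obtain ⟨h, t, h1, h2⟩ := ih
    exact ⟨h + 1, t, by rw [dualAdj_two, h1, incHead], by omega⟩
  | large m a _ ih _ => exact ⟨1, _, dualAdj_add_three m a, le_rfl⟩

theorem addDegreeTail_eq (w : List ℤ) : addDegreeTail w = incHead (addDegree w) := by
  match w with
  | [] => rfl
  | [h] => rfl
  | h :: h' :: t => simp [addDegreeTail, addDegree, incHead, add_assoc]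

theorem addDegree_incHead (w : List ℤ) : addDegree (incHead w) = incHead (addDegree w) := by
  match w with
  | [] => rfl
  | [h] => rfl
  | h :: h' :: t => rfl

theorem addDegreeTail_replicate (m : ℕ) {w : List ℤ} (hw : w ≠ []) :
    addDegreeTail (List.replicate m 0 ++ w) = List.replicate m 2 ++ addDegreeTail w := by
  induction m with
  | zero => rfl
  | succ m ih =>
    rw [List.replicate_succ, List.replicate_succ, List.cons_append, List.cons_append, ← ih,
      addDegreeTail]
    · rfl
    · simp [hw]

theorem addDegree_dualAdj_two (a : List ℤ) :
    addDegree (dualAdj (2 :: a)) = addDegreeTail (dualAdj a) := by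
  rw [dualAdj_two, addDegree_incHead, addDegreeTail_eq]

theorem addDegree_dualAdj_large (m : ℕ) {a : List ℤ} (ha : ∀ x ∈ a, 2 ≤ x) :
    addDegree (dualAdj (((m : ℤ) + 3) :: a)) =
      2 :: (List.replicate m 2 ++ addDegreeTail (dualAdj a)) := by
  obtain ⟨h, t, h1, -⟩ := dualAdj_eq_cons ha
  rw [dualAdj_add_three, addDegree, addDegreeTail_replicate m (by simp [h1])]
  · rfl
  · simp [h1]

theorem hjValue_cons (x : ℤ) (l : List ℤ) : hjValue (x :: l) = x - 1 / hjValue l := by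
  cases l <;> simp [hjValue]

theorem hjValue_incHead {l : List ℤ} (h : l ≠ []) : hjValue (incHead l) = hjValue l + 1 := by
  cases l with
  | nil => exact absurd rfl h
  | cons x l => rw [incHead, hjValue_cons, hjValue_cons]; push_cast; ring

theorem hjValue_replicate_two {r : ℚ} (hr : r < 1) {l : List ℤ}
    (hl : hjValue l = (2 - r) / (1 - r)) (n : ℕ) :
    hjValue (List.replicate n 2 ++ l) = (n + 2 - r) / (n + 1 - r) := by
  induction n with
  | zero => simp [hl]
  | succ n ih =>
    have h1 : (0 : ℚ) ≤ n := Nat.cast_nonneg n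
    have h2 : (n : ℚ) + 2 - r ≠ 0 := by linarith
    have h3 : (n : ℚ) + 1 - r ≠ 0 := by linarith
    have h4 : (n : ℚ) + 1 + 1 - r ≠ 0 := by linarith
    rw [List.replicate_succ, List.cons_append, hjValue_cons, ih]
    push_cast
    rw [one_div_div]
    field_simp
    ring

theorem addDegree_dualAdj_ne_nil {a : List ℤ} (ha : ∀ x ∈ a, 2 ≤ x) :
    addDegree (dualAdj a) ≠ [] := by
  obtain ⟨h, t, h1, -⟩ := dualAdj_eq_cons ha
  rw [h1]
  cases t <;> simp [addDegree]

/-- The reciprocals of the values of the two continued fractions add up to one. -/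
theorem hjValue_addDegree_dualAdj (a : List ℤ) (ha : ∀ x ∈ a, 2 ≤ x) :
    0 ≤ 1 / hjValue a ∧ 1 / hjValue a < 1 ∧
      hjValue (addDegree (dualAdj a)) = 1 / (1 - 1 / hjValue a) := by
  induction a, ha using list_two_le_induction with
  | nil _ => simp [hjValue, dualAdj, addDegree]
  | two a ha ih _ =>
    obtain ⟨h0, h1, h2⟩ := ih
    rw [addDegree_dualAdj_two, addDegreeTail_eq, hjValue_incHead (addDegree_dualAdj_ne_nil ha), h2,
      hjValue_cons]
    set r := 1 / hjValue a
    have h3 : 1 - r ≠ 0 := by linarith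
    have h4 : 2 - r ≠ 0 := by linarith
    push_cast
    refine ⟨div_nonneg one_pos.le (by linarith), (div_lt_one (by linarith)).2 (by linarith), ?_⟩
    have h5 : 1 - 1 / (2 - r) = (1 - r) / (2 - r) := by field_simp; ring
    rw [h5, one_div_div]
    field_simp
    ring
  | large m a ha ih _ =>
    obtain ⟨h0, h1, h2⟩ := ih
    have h3 : hjValue (addDegreeTail (dualAdj a)) =
        (2 - 1 / hjValue a) / (1 - 1 / hjValue a) := by
      rw [addDegreeTail_eq, hjValue_incHead (addDegree_dualAdj_ne_nil ha), h2]
      have : 1 - 1 / hjValue a ≠ 0 := by linarith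
      field_simp
      ring
    have h4 := hjValue_replicate_two h1 h3 (m + 1)
    rw [addDegree_dualAdj_large m ha, ← List.cons_append, ← List.replicate_succ, h4, hjValue_cons]
    set r := 1 / hjValue a
    have hm : (0 : ℚ) ≤ m := Nat.cast_nonneg m
    push_cast
    have h5 : (m : ℚ) + 3 - r ≠ 0 := by linarith
    refine ⟨div_nonneg one_pos.le (by linarith), (div_lt_one (by linarith)).2 (by linarith), ?_⟩
    have h6 : 1 - 1 / ((m : ℚ) + 3 - r) = (m + 1 + 1 - r) / (m + 3 - r) := by field_simp; ring
    rw [h6, one_div_div]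
    congr 1
    ring

theorem two_le_addDegreeTail_dualAdj (a : List ℤ) (ha : ∀ x ∈ a, 2 ≤ x) :
    ∀ x ∈ addDegreeTail (dualAdj a), 2 ≤ x := by
  induction a, ha using list_two_le_induction with
  | nil _ => simp [dualAdj, addDegreeTail]
  | two a ha ih _ =>
    obtain ⟨h, t, h1, h2⟩ := dualAdj_eq_cons ha
    rw [addDegreeTail_eq, addDegree_dualAdj_two]
    intro x hx
    generalize addDegreeTail (dualAdj a) = l at ih hx
    cases l with
    | nil => simp [incHead] at hx
    | cons y l =>
      rw [incHead, List.mem_cons] at hx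
      rcases hx with rfl | hx
      · have := ih y (by simp); omega
      · exact ih x (List.mem_cons_of_mem _ hx)
  | large m a ha ih _ =>
    rw [addDegreeTail_eq, addDegree_dualAdj_large m ha, incHead]
    intro x hx
    simp only [List.mem_cons, List.mem_append, List.mem_replicate] at hx
    rcases hx with rfl | ⟨-, rfl⟩ | hx
    · norm_num
    · norm_num
    · exact ih x hx

theorem two_le_addDegree_dualAdj {a : List ℤ} (ha : ∀ x ∈ a, 2 ≤ x) (hne : a ≠ []) :
    ∀ x ∈ addDegree (dualAdj a), 2 ≤ x := by
  rcases a with _ | ⟨y, a⟩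
  · exact absurd rfl hne
  have ha' : ∀ x ∈ a, 2 ≤ x := fun x hx => ha x (List.mem_cons_of_mem _ hx)
  have ih := two_le_addDegreeTail_dualAdj a ha'
  by_cases hy : y = 2
  · rw [hy, addDegree_dualAdj_two]; exact ih
  · obtain ⟨m, rfl⟩ := exists_eq_add_three (ha y (by simp)) hy
    rw [addDegree_dualAdj_large m ha']
    intro x hx
    simp only [List.mem_cons, List.mem_append, List.mem_replicate] at hx
    rcases hx with rfl | ⟨-, rfl⟩ | hx
    · norm_num
    · norm_num
    · exact ih x hx

theorem IsHJExpansion.eq_addDegree_dualAdj {p q : ℕ} {a b : List ℤ} (hq : 0 < q) (hqp : q < p)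
    (ha : IsHJExpansion p q a) (hb : IsHJExpansion p (p - q) b) :
    b = addDegree (dualAdj a) := by
  obtain ⟨ha0, ha2, hav⟩ := ha
  obtain ⟨hb0, hb2, hbv⟩ := hb
  refine hjValue_injective _ _ hb0 (addDegree_dualAdj_ne_nil ha2) hb2
    (two_le_addDegree_dualAdj ha2 ha0) ?_
  rw [(hjValue_addDegree_dualAdj a ha2).2.2, hbv, hav, Nat.cast_sub hqp.le]
  have h1 : (0 : ℚ) < q := by exact_mod_cast hq
  have h2 : (q : ℚ) < p := by exact_mod_cast hqp
  have h3 : (p : ℚ) ≠ 0 := by linarith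
  have h4 : (p : ℚ) - q ≠ 0 := by linarith
  have h5 : 1 - 1 / ((p : ℚ) / q) = (p - q) / p := by field_simp
  rw [h5, one_div_div]

theorem length_addDegreeTail (w : List ℤ) : (addDegreeTail w).length = w.length := by
  induction w with
  | nil => rfl
  | cons h t ih => cases t <;> simp_all [addDegreeTail]

theorem length_addDegree (w : List ℤ) : (addDegree w).length = w.length := by
  match w with
  | [] => rfl
  | [h] => rfl
  | h :: h' :: t => simp [addDegree, length_addDegreeTail]

theorem getElem_addDegreeTail (w : List ℤ) (j : ℕ) (hj : j < (addDegreeTail w).length)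
    (hj' : j < w.length) :
    (addDegreeTail w)[j] = w[j] + 1 + if j + 1 < w.length then 1 else 0 := by
  induction w generalizing j with
  | nil => simp at hj'
  | cons h t ih =>
    cases t with
    | nil =>
      simp only [List.length_cons, List.length_nil] at hj'
      obtain rfl : j = 0 := by omega
      simp [addDegreeTail]
    | cons h' t =>
      rcases j with _ | j
      · simp [addDegreeTail]; ring
      · simp only [addDegreeTail, List.getElem_cons_succ]
        rw [ih j _ (by simpa using hj')]
        simp

theorem getElem_addDegree (w : List ℤ) (j : ℕ) (hj : j < (addDegree w).length)
    (hj' : j < w.length) : (addDegree w)[j] =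
      w[j] + (if 0 < j then 1 else 0) + if j + 1 < w.length then 1 else 0 := by
  match w with
  | [] => simp at hj'
  | [h] =>
    simp only [List.length_cons, List.length_nil] at hj'
    obtain rfl : j = 0 := by omega
    simp [addDegree]
  | h :: h' :: t =>
    rcases j with _ | j
    · simp [addDegree]
    · simp only [addDegree, List.getElem_cons_succ]
      rw [getElem_addDegreeTail _ _ _ (by simpa using hj')]
      simp

theorem eq_nil_of_dualAdj_eq {a : List ℤ} (ha : ∀ x ∈ a, 2 ≤ x) (h : dualAdj a = [1]) :
    a = [] := by
  rcases a with _ | ⟨y, a⟩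
  · rfl
  have ha' : ∀ x ∈ a, 2 ≤ x := fun x hx => ha x (List.mem_cons_of_mem _ hx)
  obtain ⟨u, t, h1, h2⟩ := dualAdj_eq_cons ha'
  by_cases hy : y = 2
  · rw [hy, dualAdj_two, h1, incHead, List.cons.injEq] at h
    omega
  · obtain ⟨m, rfl⟩ := exists_eq_add_three (ha y (by simp)) hy
    rw [dualAdj_add_three, h1] at h
    simp at h

theorem replicate_zero_append_eq {m : ℕ} {w w1 w2 : List ℤ} {α : ℤ} (hα : 1 ≤ α)
    (h : List.replicate m 0 ++ w = w1 ++ α :: w2) :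
    ∃ w1', w1 = List.replicate m 0 ++ w1' ∧ w = w1' ++ α :: w2 := by
  induction m generalizing w1 with
  | zero => exact ⟨w1, rfl, by simpa using h⟩
  | succ m ih =>
    rw [List.replicate_succ, List.cons_append] at h
    rcases w1 with _ | ⟨y, w1⟩
    · rw [List.nil_append, List.cons.injEq] at h
      omega
    · rw [List.cons_append, List.cons.injEq] at h
      obtain ⟨w1', h1, h2⟩ := ih h.2
      exact ⟨w1', by rw [List.replicate_succ, List.cons_append, ← h1, h.1], h2⟩

/-- A positive entry `α` of the dual adjusted weights comes from `α - 1` consecutive entries `2`. -/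
theorem dualAdj_split {a : List ℤ} (ha : ∀ x ∈ a, 2 ≤ x) {w1 w2 : List ℤ} {α : ℤ} (hα : 1 ≤ α)
    (h : dualAdj a = w1 ++ α :: w2) : ∃ a1 a2, a = a1 ++ (List.replicate (α - 1).toNat 2 ++ a2) ∧
      dualAdj a1 = w1 ++ [1] ∧ dualAdj a2 = 1 :: w2 := by
  induction a, ha using list_two_le_induction generalizing w1 α with
  | nil _ =>
    rcases w1 with _ | ⟨y, w1⟩
    · simp only [dualAdj, List.nil_append, List.cons.injEq] at h
      obtain ⟨rfl, rfl⟩ := h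
      exact ⟨[], [], rfl, rfl, rfl⟩
    · simp [dualAdj] at h
  | two a ha ih _ =>
    obtain ⟨u, t, h1, h2⟩ := dualAdj_eq_cons ha
    rw [dualAdj_two, h1, incHead] at h
    rcases w1 with _ | ⟨y, w1⟩
    · rw [List.nil_append, List.cons.injEq] at h
      obtain ⟨rfl, rfl⟩ := h
      obtain ⟨a1, a2, h3, h4, h5⟩ := ih (w1 := []) h2 h1
      have ha1 : a1 = [] := eq_nil_of_dualAdj_eq
        (fun x hx => ha x (by rw [h3]; exact List.mem_append_left _ hx)) h4
      refine ⟨[], a2, ?_, rfl, h5⟩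
      rw [h3, ha1, List.nil_append, List.nil_append,
        show (u + 1 - 1).toNat = (u - 1).toNat + 1 by omega, List.replicate_succ, List.cons_append]
    · rw [List.cons_append, List.cons.injEq] at h
      obtain ⟨rfl, rfl⟩ := h
      obtain ⟨a1, a2, h3, h4, h5⟩ := ih (w1 := u :: w1) hα h1
      exact ⟨2 :: a1, a2, by rw [h3]; rfl, by rw [dualAdj_two, h4]; rfl, h5⟩
  | large m a ha ih _ =>
    have h' := h
    rw [dualAdj_add_three] at h
    rcases w1 with _ | ⟨y, w1⟩
    · rw [List.nil_append, List.cons.injEq] at h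
      obtain ⟨rfl, -⟩ := h
      exact ⟨[], _, rfl, rfl, h'⟩
    · rw [List.cons_append, List.cons.injEq] at h
      obtain ⟨rfl, h⟩ := h
      obtain ⟨w1', rfl, h2⟩ := replicate_zero_append_eq hα h
      obtain ⟨a1, a2, h3, h4, h5⟩ := ih hα h2
      exact ⟨(m + 3) :: a1, a2, by rw [h3]; rfl, by rw [dualAdj_add_three, h4]; simp, h5⟩

theorem dualAdj_split_head {a : List ℤ} (ha : ∀ x ∈ a, 2 ≤ x) {w2 : List ℤ} {α : ℤ} (hα : 1 ≤ α)
    (h : dualAdj a = α :: w2) : ∃ a2, a = List.replicate (α - 1).toNat 2 ++ a2 ∧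
      dualAdj a2 = 1 :: w2 := by
  obtain ⟨a1, a2, h1, h2, h3⟩ := dualAdj_split ha (w1 := []) hα h
  have := eq_nil_of_dualAdj_eq
    (fun x hx => ha x (by rw [h1]; exact List.mem_append_left _ hx)) h2
  exact ⟨a2, by rw [h1, this]; rfl, h3⟩

theorem dualAdj_split_zeros {a : List ℤ} (ha : ∀ x ∈ a, 2 ≤ x) {w : List ℤ} {β : ℤ} (hβ : 1 ≤ β)
    {k : ℕ} (h : dualAdj a = 1 :: (List.replicate k 0 ++ β :: w)) :
    ∃ a', a = ((k : ℤ) + 3) :: a' ∧ dualAdj a' = β :: w := by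
  rcases a with _ | ⟨y, a⟩
  · simp [dualAdj] at h
  have ha' : ∀ x ∈ a, 2 ≤ x := fun x hx => ha x (List.mem_cons_of_mem _ hx)
  obtain ⟨u, t, h1, h2⟩ := dualAdj_eq_cons ha'
  by_cases hy : y = 2
  · rw [hy, dualAdj_two, h1, incHead, List.cons.injEq] at h
    omega
  · obtain ⟨m, rfl⟩ := exists_eq_add_three (ha y (by simp)) hy
    rw [dualAdj_add_three, List.cons.injEq] at h
    obtain ⟨w1', h3, h4⟩ := replicate_zero_append_eq hβ h.2
    rcases w1' with _ | ⟨z, w1'⟩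
    · rw [List.append_nil, List.replicate_left_inj] at h3
      exact ⟨a, by rw [h3], h4⟩
    · rw [h1, List.cons_append, List.cons.injEq] at h4
      have : z ∈ List.replicate k (0 : ℤ) := by rw [h3]; simp
      have := List.eq_of_mem_replicate this
      omega

namespace WeightedGraph

variable {V : Type*} {Γ : WeightedGraph V} {k : ℕ} {comp : V → Fin k} {idx : V → ℕ}

theorem chain_monotone
    (hadj : ∀ u v, Γ.graph.Adj u v ↔ comp u = comp v ∧ (idx u + 1 = idx v ∨ idx v + 1 = idx u))
    (hinj : ∀ u v, comp u = comp v → idx u = idx v → u = v) (vs : List V) (hne : vs ≠ [])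
    (hnd : vs.Nodup) (hch : vs.IsChain Γ.graph.Adj) :
    ∃ (i : Fin k) (n ε : ℤ), (ε = 1 ∨ ε = -1) ∧
      ∀ (j : ℕ) (hj : j < vs.length), comp vs[j] = i ∧ (idx vs[j] : ℤ) = n + ε * j := by
  match vs with
  | [] => exact absurd rfl hne
  | [u] =>
    refine ⟨comp u, idx u, 1, Or.inl rfl, fun j hj => ?_⟩
    simp only [List.length_cons, List.length_nil] at hj
    obtain rfl : j = 0 := by omega
    simp
  | u :: v :: t =>
    rw [List.isChain_cons_cons] at hch
    rw [List.nodup_cons] at hnd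
    obtain ⟨i, n, ε, hε, h⟩ := chain_monotone hadj hinj (v :: t) (by simp) hnd.2 hch.2
    obtain ⟨h0, h0'⟩ := h 0 (by simp)
    simp only [List.getElem_cons_zero, Nat.cast_zero, mul_zero, add_zero] at h0 h0'
    obtain ⟨h1, h2⟩ := (hadj u v).1 hch.1
    by_cases hu : (idx u : ℤ) = n - ε
    · refine ⟨i, n - ε, ε, hε, fun j hj => ?_⟩
      rcases j with _ | j
      · simpa using ⟨h1.trans h0, hu⟩
      · obtain ⟨h3, h4⟩ := h j (by simpa using hj)
        rw [List.getElem_cons_succ]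
        refine ⟨h3, ?_⟩
        rw [h4]; push_cast; ring
    · have hu' : (idx u : ℤ) = n + ε := by omega
      rcases t with _ | ⟨w, t⟩
      · refine ⟨i, n + ε, -ε, by omega, fun j hj => ?_⟩
        simp only [List.length_cons, List.length_nil] at hj
        obtain rfl | rfl : j = 0 ∨ j = 1 := by omega
        · simpa using ⟨h1.trans h0, hu'⟩
        · simpa using ⟨h0, h0'⟩
      · exfalso
        obtain ⟨h3, h4⟩ := h 1 (by simp)
        simp only [List.getElem_cons_succ, List.getElem_cons_zero, Nat.cast_one, mul_one] at h3 h4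
        have : u = w := hinj u w (by rw [h1, h0, h3]) (by omega)
        exact hnd.1 (by simp [this])

theorem infix_of_getElem? {l w : List ℤ} {n : ℕ}
    (h : ∀ (j : ℕ) (hj : j < l.length), w[n + j]? = some l[j]) : l <:+: w := by
  have : l = (w.drop n).take l.length := by
    apply List.ext_getElem?
    intro j
    by_cases hj : j < l.length
    · rw [List.getElem?_take_of_lt hj, List.getElem?_drop, h j hj, List.getElem?_eq_getElem hj]
    · rw [List.getElem?_eq_none (by omega), List.getElem?_eq_none]
      rw [List.length_take]; omega
  rw [this]
  exact (List.take_prefix _ _).isInfix.trans (List.drop_suffix _ _).isInfix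

/-- A path of vertices in a union of linear graphs is read off as a segment of the list of adjusted
weights of one of the components, in one of the two directions. -/
theorem HasAdjPath.infix
    (hadj : ∀ u v, Γ.graph.Adj u v ↔ comp u = comp v ∧ (idx u + 1 = idx v ∨ idx v + 1 = idx u))
    (hinj : ∀ u v, comp u = comp v → idx u = idx v → u = v) {W : Fin k → List ℤ}
    (hW : ∀ v, (W (comp v))[idx v]? = some (Γ.adjWeight v)) {l : List ℤ} (hl : l ≠ [])
    (h : Γ.HasAdjPath l) : ∃ i, l <:+: W i ∨ l.reverse <:+: W i := by
  obtain ⟨vs, hnd, hch, rfl⟩ := h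
  obtain ⟨i, n, ε, hε, hm⟩ := chain_monotone hadj hinj vs (by simpa using hl) hnd hch
  have hlen : 0 < vs.length := List.length_pos_iff.2 (by simpa using hl)
  refine ⟨i, ?_⟩
  rcases hε with rfl | rfl
  · left
    obtain ⟨h1, h2⟩ := hm 0 hlen
    refine infix_of_getElem? (n := n.toNat) fun j hj => ?_
    rw [List.length_map] at hj
    obtain ⟨h3, h4⟩ := hm j hj
    rw [List.getElem_map, ← hW, h3]
    congr 1
    omega
  · right
    obtain ⟨h1, h2⟩ := hm (vs.length - 1) (by omega)
    refine infix_of_getElem? (n := idx vs[vs.length - 1]) fun j hj => ?_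
    rw [List.length_reverse, List.length_map] at hj
    obtain ⟨h3, h4⟩ := hm (vs.length - 1 - j) (by omega)
    rw [List.getElem_reverse, List.getElem_map, ← hW]
    simp only [List.length_map]
    rw [h3]
    congr 1
    omega

end WeightedGraph

open WeightedGraph

/-- Placing the components of a union of linear graphs at mutually nonadjacent segments of the
components of a canonical plumbing. -/
theorem containsInduced_of_positions {k : ℕ} (a : Fin k → List ℤ) (H : List (List ℤ))
    (i : Fin H.length → Fin k) (p : Fin H.length → ℕ → ℕ)
    (hp : ∀ (j) (t : ℕ) (ht : t < (H.get j).length), (a (i j))[p j t]? = some (-(H.get j)[t]))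
    (hin : ∀ j t t', t < (H.get j).length → t' < (H.get j).length →
      (p j t + 1 = p j t' ∨ p j t' + 1 = p j t ↔ t + 1 = t' ∨ t' + 1 = t) ∧
      (p j t = p j t' → t = t'))
    (hout : ∀ j j', j ≠ j' → i j = i j' → ∀ t t', t < (H.get j).length → t' < (H.get j').length →
      p j t + 1 < p j' t' ∨ p j' t' + 1 < p j t) :
    (canonicalPlumbing a).ContainsInduced (linearPlumbing H.get) := by
  have hlt (j) (t : ℕ) (ht : t < (H.get j).length) :
      p j t < ((a (i j)).map fun x => -x).length := by
    obtain ⟨h, -⟩ := List.getElem?_eq_some_iff.1 (hp j t ht)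
    rwa [List.length_map]
  refine ⟨⟨⟨fun v => ⟨i v.1, ⟨p v.1 v.2, hlt v.1 v.2 v.2.2⟩⟩, ?_⟩, ?_⟩, ?_⟩
  · rintro ⟨j, t⟩ ⟨j', t'⟩ h
    have h1 : i j = i j' := congrArg Sigma.fst h
    have h2 : p j t = p j' t' := by
      have := congrArg (fun v : (Σ i : Fin k, Fin ((a i).map fun x => -x).length) => (v.2 : ℕ)) h
      exact this
    by_cases hj : j = j'
    · subst hj
      rw [Fin.ext ((hin j t t' t.2 t'.2).2 h2)]
    · have := hout j j' hj h1 t t' t.2 t'.2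
      omega
  · rintro ⟨j, t⟩ ⟨j', t'⟩
    change (i j = i j' ∧ (p j t + 1 = p j' t' ∨ p j' t' + 1 = p j t)) ↔
      (j = j' ∧ ((t : ℕ) + 1 = t' ∨ (t' : ℕ) + 1 = t))
    by_cases hj : j = j'
    · subst hj
      simpa only [true_and] using (hin j t t' t.2 t'.2).1
    · refine ⟨fun h => ?_, fun h => absurd h.1 hj⟩
      have := hout j j' hj h.1 t t' t.2 t'.2
      omega
  · rintro ⟨j, t⟩
    obtain ⟨h, h'⟩ := List.getElem?_eq_some_iff.1 (hp j t t.2)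
    refine (List.getElem_map (fun x : ℤ => -x) (h := hlt j t t.2)).trans ?_
    rw [h', neg_neg]
    rfl

theorem getElem?_of_append_eq {w s l u : List ℤ} (h : w = s ++ (l ++ u)) (t : ℕ)
    (ht : t < l.length) :
    w[s.length + t]? = some l[t] := by
  rw [h, List.getElem?_append_right (by omega), Nat.add_sub_cancel_left,
    List.getElem?_append_left ht, List.getElem?_eq_getElem ht]

theorem containsInduced_of_infix {k : ℕ} {a : Fin k → List ℤ} {i : Fin k} {l : List ℤ}
    (h : l.map (fun x => -x) <:+: a i ∨ (l.map (fun x => -x)).reverse <:+: a i) :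
    (canonicalPlumbing a).ContainsInduced (linearPlumbing [l].get) := by
  have hget (j : Fin [l].length) : [l].get j = l := by
    rw [show j = ⟨0, by simp⟩ from Fin.ext (by have := j.2; simp at this ⊢)]; rfl
  rcases h with ⟨s, u, h⟩ | ⟨s, u, h⟩ <;> rw [List.append_assoc] at h
  · refine containsInduced_of_positions a [l] (fun _ => i) (fun _ t => s.length + t) ?_ ?_ ?_
    · intro j t ht
      simp only [hget] at ht ⊢
      rw [getElem?_of_append_eq h.symm t (by simpa using ht), List.getElem_map]
    · intro j t t' _ _
      exact ⟨by omega, by omega⟩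
    · intro j j' hne
      exact absurd (Fin.ext (by have := j.2; have := j'.2; simp at *)) hne
  · refine containsInduced_of_positions a [l] (fun _ => i)
      (fun _ t => s.length + (l.length - 1 - t)) ?_ ?_ ?_
    · intro j t ht
      simp only [hget] at ht ⊢
      rw [getElem?_of_append_eq h.symm _ (by simp; omega), List.getElem_reverse, List.getElem_map]
      simp only [List.length_map]
      congr 3
      omega
    · intro j t t' h1 h2
      simp only [hget] at h1 h2
      exact ⟨by omega, by omega⟩
    · intro j j' hne
      exact absurd (Fin.ext (by have := j.2; have := j'.2; simp at *)) hne

theorem containsInduced_pair {k : ℕ} {a : Fin k → List ℤ} {i₁ i₂ : Fin k}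
    {l₁ l₂ s₁ s₂ u₁ u₂ : List ℤ}
    (h₁ : a i₁ = s₁ ++ (l₁.map (fun x => -x) ++ u₁))
    (h₂ : a i₂ = s₂ ++ (l₂.map (fun x => -x) ++ u₂))
    (h : i₁ = i₂ → s₁.length + l₁.length < s₂.length ∨ s₂.length + l₂.length < s₁.length) :
    (canonicalPlumbing a).ContainsInduced (linearPlumbing [l₁, l₂].get) := by
  refine containsInduced_of_positions a [l₁, l₂] (fun j => if (j : ℕ) = 0 then i₁ else i₂)
    (fun j t => (if (j : ℕ) = 0 then s₁.length else s₂.length) + t) ?_ ?_ ?_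
  · intro j
    match j with
    | ⟨0, _⟩ =>
      intro t ht
      have ht' : t < l₁.length := ht
      have := getElem?_of_append_eq h₁ t (by simpa using ht')
      rw [List.getElem_map] at this
      exact this
    | ⟨1, _⟩ =>
      intro t ht
      have ht' : t < l₂.length := ht
      have := getElem?_of_append_eq h₂ t (by simpa using ht')
      rw [List.getElem_map] at this
      exact this
  · intro j t t' _ _
    exact ⟨by omega, by omega⟩
  · intro j j'
    match j, j' with
    | ⟨0, _⟩, ⟨0, _⟩ => exact fun h => absurd rfl h
    | ⟨1, _⟩, ⟨1, _⟩ => exact fun h => absurd rfl h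
    | ⟨0, _⟩, ⟨1, _⟩ =>
      intro _ hi t t' ht ht'
      have h1 : t < l₁.length := ht
      have h2 : t' < l₂.length := ht'
      have := h hi
      change s₁.length + t + 1 < s₂.length + t' ∨ s₂.length + t' + 1 < s₁.length + t
      omega
    | ⟨1, _⟩, ⟨0, _⟩ =>
      intro _ hi t t' ht ht'
      have h1 : t < l₂.length := ht
      have h2 : t' < l₁.length := ht'
      have := h hi.symm
      change s₂.length + t + 1 < s₁.length + t' ∨ s₁.length + t' + 1 < s₂.length + t
      omega

theorem exists_append_of_getElem? {w : List ℤ} {n : ℕ} {x : ℤ} (h : w[n]? = some x) :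
    ∃ w1 w2, w = w1 ++ x :: w2 ∧ w1.length = n := by
  obtain ⟨hn, rfl⟩ := List.getElem?_eq_some_iff.1 h
  exact ⟨w.take n, w.drop (n + 1), by simp, by simp; omega⟩

theorem exists_append_of_infix {l w : List ℤ} (h : l <:+: w) : ∃ s u, w = s ++ (l ++ u) := by
  obtain ⟨s, u, h⟩ := h
  exact ⟨s, u, by rw [← h, List.append_assoc]⟩

theorem forall_two_le_of_append {a s l u : List ℤ} (ha : ∀ x ∈ a, 2 ≤ x) (h : a = s ++ (l ++ u)) :
    (∀ x ∈ s, 2 ≤ x) ∧ (∀ x ∈ u, 2 ≤ x) :=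
  ⟨fun x hx => ha x (by simp [h, hx]), fun x hx => ha x (by simp [h, hx])⟩

theorem dualAdj_split_two {a : List ℤ} (ha : ∀ x ∈ a, 2 ≤ x) {w1 w2 : List ℤ} {α : ℤ} (hα : 2 ≤ α)
    (h : dualAdj a = w1 ++ α :: w2) :
    ∃ a1 a2, a = a1 ++ 2 :: a2 ∧ dualAdj a1 = w1 ++ [1] := by
  obtain ⟨a1, a2, h1, h2, -⟩ := dualAdj_split ha (by omega) h
  obtain ⟨m, hm⟩ : ∃ m, (α - 1).toNat = m + 1 := ⟨(α - 2).toNat, by omega⟩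
  rw [hm] at h1
  exact ⟨a1, _, h1, h2⟩

theorem dualAdj_split_three {a : List ℤ} (ha : ∀ x ∈ a, 2 ≤ x) {w1 w2 : List ℤ}
    (h : dualAdj a = w1 ++ 3 :: w2) :
    ∃ a1 a2, a = a1 ++ ([2, 2] ++ a2) ∧ dualAdj a1 = w1 ++ [1] ∧ dualAdj a2 = 1 :: w2 :=
  dualAdj_split ha (by omega) h

theorem dualAdj_one_zeros {a : List ℤ} (ha : ∀ x ∈ a, 2 ≤ x) (k : ℕ) {w : List ℤ} {β : ℤ}
    (hβ : 1 ≤ β) (h : dualAdj a = 1 :: (List.replicate k 0 ++ β :: w)) :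
    ∃ a', a = ((k : ℤ) + 3) :: a' ∧ dualAdj a' = β :: w ∧ ∀ x ∈ a', 2 ≤ x := by
  obtain ⟨a', rfl, h'⟩ := dualAdj_split_zeros ha hβ h
  exact ⟨a', rfl, h', fun x hx => ha x (List.mem_cons_of_mem _ hx)⟩

theorem ne_nil_of_dualAdj_eq {a w : List ℤ} {x y : ℤ} (h : dualAdj a = x :: (w ++ [y])) :
    0 < a.length := by
  rcases a with _ | ⟨z, a⟩
  · simp [dualAdj] at h
  · simp

section ListConditions

variable {k : ℕ} {a : Fin k → List ℤ}

theorem le_three_of_dualAdj (ha : ∀ i, ∀ x ∈ a i, 2 ≤ x)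
    (h22 : ∀ i₁ i₂ s₁ s₂ u₁ u₂, a i₁ = s₁ ++ ([2] ++ u₁) → a i₂ = s₂ ++ ([2] ++ u₂) →
      ¬ (i₁ = i₂ → s₁.length + 1 < s₂.length ∨ s₂.length + 1 < s₁.length))
    {i : Fin k} {x : ℤ} (hx : x ∈ dualAdj (a i)) : x ≤ 3 := by
  by_contra! h
  obtain ⟨w1, w2, hw⟩ := List.append_of_mem hx
  obtain ⟨a1, a2, h1, -⟩ := dualAdj_split (ha i) (by omega) hw
  obtain ⟨m, hm⟩ : ∃ m, (x - 1).toNat = m + 3 := ⟨(x - 4).toNat, by omega⟩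
  rw [hm] at h1
  refine h22 i i a1 (a1 ++ [2, 2]) _ (List.replicate m 2 ++ a2) h1 ?_ (by simp)
  rw [h1]
  simp [List.replicate_succ]

theorem eq_of_one_lt_of_dualAdj (ha : ∀ i, ∀ x ∈ a i, 2 ≤ x)
    (h22 : ∀ i₁ i₂ s₁ s₂ u₁ u₂, a i₁ = s₁ ++ ([2] ++ u₁) → a i₂ = s₂ ++ ([2] ++ u₂) →
      ¬ (i₁ = i₂ → s₁.length + 1 < s₂.length ∨ s₂.length + 1 < s₁.length))
    {i j : Fin k} {x y : ℤ} (hx : 1 < x) (hy : 1 < y) {m n : ℕ} (hi : (dualAdj (a i))[m]? = some x)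
    (hj : (dualAdj (a j))[n]? = some y) : i = j ∧ m = n := by
  have key (i : Fin k) (x y : ℤ) (hx : 1 < x) (hy : 1 < y) (m n : ℕ)
      (hi : (dualAdj (a i))[m]? = some x) (hj : (dualAdj (a i))[n]? = some y) : ¬ m < n := by
    intro hmn
    obtain ⟨w1, w2, h1, rfl⟩ := exists_append_of_getElem? hj
    rw [h1, List.getElem?_append_left hmn] at hi
    obtain ⟨v1, v2, rfl, -⟩ := exists_append_of_getElem? hi
    obtain ⟨a1, a2, h2, h3⟩ := dualAdj_split_two (ha i) hy h1
    rw [List.append_assoc, List.cons_append] at h3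
    have ha1 : ∀ z ∈ a1, 2 ≤ z := fun z hz => ha i z (by simp [h2, hz])
    obtain ⟨b1, b2, h4, -, h5⟩ := dualAdj_split ha1 (by omega) h3
    have h6 := ne_nil_of_dualAdj_eq h5
    obtain ⟨r, hr⟩ : ∃ r, (x - 1).toNat = r + 1 := ⟨(x - 2).toNat, by omega⟩
    rw [hr] at h4
    refine h22 i i b1 a1 (List.replicate r 2 ++ b2 ++ 2 :: a2) a2 ?_ h2 fun _ => Or.inl ?_
    · rw [h2, h4]; simp [List.replicate_succ]
    · rw [h4]; simp; omega
  have hij : i = j := by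
    by_contra hij
    obtain ⟨w1, w2, h1, -⟩ := exists_append_of_getElem? hi
    obtain ⟨v1, v2, h2, -⟩ := exists_append_of_getElem? hj
    obtain ⟨a1, a2, h3, -⟩ := dualAdj_split_two (ha i) hx h1
    obtain ⟨b1, b2, h4, -⟩ := dualAdj_split_two (ha j) hy h2
    exact h22 i j a1 b1 a2 b2 h3 h4 fun h => absurd h hij
  subst hij
  have h1 := key i x y hx hy m n hi hj
  have h2 := key i y x hy hx n m hj hi
  exact ⟨rfl, by omega⟩

theorem not_one_one_of_dualAdj (ha : ∀ i, ∀ x ∈ a i, 2 ≤ x)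
    (h322 : ∀ i₁ i₂ s₁ s₂ u₁ u₂, a i₁ = s₁ ++ ([3] ++ u₁) → a i₂ = s₂ ++ ([2, 2] ++ u₂) →
      ¬ (i₁ = i₂ → s₁.length + 1 < s₂.length ∨ s₂.length + 2 < s₁.length))
    {i j : Fin k} (hi : 3 ∈ dualAdj (a i)) : ¬ [1, 1] <:+: dualAdj (a j) := by
  intro h
  obtain ⟨w1, w2, hw⟩ := exists_append_of_infix h
  obtain ⟨a1, a2, h1, h2, h3⟩ := dualAdj_split (ha j) le_rfl hw
  obtain ⟨ha1, ha2⟩ := forall_two_le_of_append (ha j) h1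
  obtain ⟨a3, rfl, h4, ha3⟩ := dualAdj_one_zeros ha2 0 le_rfl h3
  replace h1 : a j = a1 ++ ([3] ++ a3) := h1
  by_cases hij : i = j
  · subst hij
    rw [hw] at hi
    simp only [List.cons_append, List.nil_append, List.mem_append, List.mem_cons] at hi
    rcases hi with hi | hi | hi | hi
    · obtain ⟨v1, v2, rfl⟩ := List.append_of_mem hi
      rw [List.append_assoc, List.cons_append] at h2
      obtain ⟨b1, b2, h5, -, h6⟩ := dualAdj_split_three ha1 h2
      have h7 := ne_nil_of_dualAdj_eq h6
      refine h322 i i a1 b1 a3 (b2 ++ ([3] ++ a3)) h1 ?_ fun _ => Or.inr ?_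
      · rw [h1, h5]; simp
      · rw [h5]; simp; omega
    · norm_num at hi
    · norm_num at hi
    · obtain ⟨v1, v2, rfl⟩ := List.append_of_mem hi
      obtain ⟨b1, b2, h5, h6, -⟩ := dualAdj_split_three (w1 := 1 :: v1) ha3 h4
      have h7 := ne_nil_of_dualAdj_eq h6
      refine h322 i i a1 (a1 ++ ([3] ++ b1)) a3 b2 h1 ?_ fun _ => Or.inl ?_
      · rw [h1, h5]; simp
      · simp; omega
  · obtain ⟨v1, v2, hv⟩ := List.append_of_mem hi
    obtain ⟨b1, b2, h5, -⟩ := dualAdj_split_three (ha i) hv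
    exact h322 j i a1 b1 a3 b2 h1 h5 fun h => absurd h.symm hij

end ListConditions

theorem infix_of_dualAdj_three_positive {a : List ℤ} (ha : ∀ x ∈ a, 2 ≤ x) {x y z : ℤ} (hx : 0 < x)
    (hy : 0 < y) (hz : 0 < z) (h : [x, y, z] <:+: dualAdj a) :
    [3] ++ (List.replicate (y - 1).toNat 2 ++ [3]) <:+: a := by
  obtain ⟨w1, w2, hw⟩ := exists_append_of_infix h
  obtain ⟨a1, a2, rfl, -, h3⟩ := dualAdj_split ha hx hw
  obtain ⟨-, ha2⟩ := forall_two_le_of_append ha rfl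
  obtain ⟨a3, rfl, h4, ha3⟩ := dualAdj_one_zeros ha2 0 hy h3
  obtain ⟨a4, rfl, h5⟩ := dualAdj_split_head ha3 hy h4
  obtain ⟨a5, rfl, -, -⟩ :=
    dualAdj_one_zeros (fun x hx => ha3 x (List.mem_append_right _ hx)) 0 hz h5
  exact ⟨a1 ++ List.replicate (x - 1).toNat 2, a5, by simp⟩

theorem infix_of_dualAdj_chain {a : List ℤ} (ha : ∀ x ∈ a, 2 ≤ x) {α : ℤ} (hα : 1 ≤ α) (k : ℕ)
    (h : α :: (List.replicate k 0 ++ [1]) <:+: dualAdj a) :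
    List.replicate (α - 1).toNat 2 ++ [(k : ℤ) + 3] <:+: a := by
  obtain ⟨w1, w2, hw⟩ := exists_append_of_infix h
  obtain ⟨a1, a2, rfl, -, h3⟩ := dualAdj_split ha hα hw
  obtain ⟨-, ha2⟩ := forall_two_le_of_append ha rfl
  obtain ⟨a3, rfl, -, -⟩ := dualAdj_one_zeros ha2 k (w := w2) le_rfl (by rw [h3]; simp)
  exact ⟨a1, a3, by simp⟩

theorem infix_of_dualAdj_chain_reverse {a : List ℤ} (ha : ∀ x ∈ a, 2 ≤ x) {α : ℤ} (hα : 1 ≤ α)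
    (k : ℕ) (h : (1 :: (List.replicate k 0 ++ [α])) <:+: dualAdj a) :
    ((k : ℤ) + 3) :: List.replicate (α - 1).toNat 2 <:+: a := by
  obtain ⟨w1, w2, hw⟩ := exists_append_of_infix h
  obtain ⟨a1, a2, rfl, -, h3⟩ := dualAdj_split ha le_rfl hw
  obtain ⟨-, ha2⟩ := forall_two_le_of_append ha rfl
  obtain ⟨a3, rfl, h4, ha3⟩ := dualAdj_one_zeros ha2 k (w := w2) hα (by rw [h3]; simp)
  obtain ⟨a4, rfl, -⟩ := dualAdj_split_head ha3 hα h4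
  exact ⟨a1, a4, by simp⟩

theorem infix_of_dualAdj_110012 {a : List ℤ} (ha : ∀ x ∈ a, 2 ≤ x)
    (h : [1, 1, 0, 0, 1, 2] <:+: dualAdj a) : [3, 5, 3, 2] <:+: a := by
  obtain ⟨w1, w2, hw⟩ := exists_append_of_infix h
  obtain ⟨a1, a2, rfl, -, h3⟩ := dualAdj_split ha le_rfl hw
  obtain ⟨-, ha2⟩ := forall_two_le_of_append ha rfl
  obtain ⟨a3, rfl, h4, ha3⟩ := dualAdj_one_zeros ha2 0 le_rfl h3
  obtain ⟨a4, rfl, h5, ha4⟩ := dualAdj_one_zeros ha3 2 le_rfl h4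
  obtain ⟨a5, rfl, h6, ha5⟩ := dualAdj_one_zeros ha4 0 (by norm_num) h5
  obtain ⟨a6, rfl, -⟩ := dualAdj_split_head ha5 (by norm_num) h6
  exact ⟨a1, a6, by simp⟩

theorem infix_of_dualAdj_210011 {a : List ℤ} (ha : ∀ x ∈ a, 2 ≤ x)
    (h : [2, 1, 0, 0, 1, 1] <:+: dualAdj a) : [2, 3, 5, 3] <:+: a := by
  obtain ⟨w1, w2, hw⟩ := exists_append_of_infix h
  obtain ⟨a1, a2, rfl, -, h3⟩ := dualAdj_split ha (by norm_num) hw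
  obtain ⟨-, ha2⟩ := forall_two_le_of_append ha rfl
  obtain ⟨a3, rfl, h4, ha3⟩ := dualAdj_one_zeros ha2 0 le_rfl h3
  obtain ⟨a4, rfl, h5, ha4⟩ := dualAdj_one_zeros ha3 2 le_rfl h4
  obtain ⟨a5, rfl, -, -⟩ := dualAdj_one_zeros ha4 0 le_rfl h5
  exact ⟨a1, a5, by simp⟩

theorem infix_of_dualAdj_31001 {a : List ℤ} (ha : ∀ x ∈ a, 2 ≤ x)
    (h : [3, 1, 0, 0, 1] <:+: dualAdj a) : [2, 2, 3, 5] <:+: a := by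
  obtain ⟨w1, w2, hw⟩ := exists_append_of_infix h
  obtain ⟨a1, a2, rfl, -, h3⟩ := dualAdj_split_three ha hw
  obtain ⟨-, ha2⟩ := forall_two_le_of_append ha rfl
  obtain ⟨a3, rfl, h4, ha3⟩ := dualAdj_one_zeros ha2 0 le_rfl h3
  obtain ⟨a4, rfl, -, -⟩ := dualAdj_one_zeros ha3 2 le_rfl h4
  exact ⟨a1, a4, by simp⟩

theorem infix_of_dualAdj_10013 {a : List ℤ} (ha : ∀ x ∈ a, 2 ≤ x)
    (h : [1, 0, 0, 1, 3] <:+: dualAdj a) : [5, 3, 2, 2] <:+: a := by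
  obtain ⟨w1, w2, hw⟩ := exists_append_of_infix h
  obtain ⟨a1, a2, rfl, -, h3⟩ := dualAdj_split ha le_rfl hw
  obtain ⟨-, ha2⟩ := forall_two_le_of_append ha rfl
  obtain ⟨a3, rfl, h4, ha3⟩ := dualAdj_one_zeros ha2 2 le_rfl h3
  obtain ⟨a4, rfl, h5, ha4⟩ := dualAdj_one_zeros ha3 0 (by norm_num) h4
  obtain ⟨a5, rfl, -⟩ := dualAdj_split_head ha4 (by norm_num) h5
  exact ⟨a1, a5, by simp⟩

theorem linearPlumbing_neighborSet_ncard {k : ℕ} (c : Fin k → List ℤ)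
    (v : Σ i : Fin k, Fin (c i).length) :
    (((linearPlumbing c).graph.neighborSet v).ncard : ℤ) =
      (if 0 < (v.2 : ℕ) then 1 else 0) + if (v.2 : ℕ) + 1 < (c v.1).length then 1 else 0 := by
  obtain ⟨i, j⟩ := v
  have key (n : ℕ) : ({u | u.1 = i ∧ (u.2 : ℕ) = n} :
      Set (Σ i : Fin k, Fin (c i).length)) = if h : n < (c i).length then {⟨i, n, h⟩} else ∅ := by
    ext ⟨i', j'⟩
    split_ifs with h
    · simp only [Set.mem_ofPred_eq, Set.mem_singleton_iff]
      constructor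
      · rintro ⟨rfl, rfl⟩
        rfl
      · intro h
        cases h
        exact ⟨rfl, rfl⟩
    · simp only [Set.mem_ofPred_eq, Set.mem_empty_iff_false, iff_false]
      rintro ⟨rfl, rfl⟩
      exact h j'.2
  have h1 : (linearPlumbing c).graph.neighborSet ⟨i, j⟩ =
      (if 0 < (j : ℕ) then {u | u.1 = i ∧ (u.2 : ℕ) = j - 1} else ∅) ∪
        {u | u.1 = i ∧ (u.2 : ℕ) = j + 1} := by
    ext u
    change (i = u.1 ∧ ((j : ℕ) + 1 = u.2 ∨ (u.2 : ℕ) + 1 = j)) ↔ _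
    split_ifs with h
    · simp only [Set.mem_union, Set.mem_ofPred_eq, eq_comm (a := i), ← and_or_left]
      refine and_congr_right fun _ => by omega
    · simp only [Set.empty_union, Set.mem_ofPred_eq, eq_comm (a := i)]
      refine and_congr_right fun _ => by omega
  have hj := j.2
  rw [h1, key, key]
  simp only
  split_ifs with h2 h3 h4 h5 h6 <;> first | omega | simp
  rw [Set.ncard_pair]
  · rfl
  · intro h
    have := congrArg (fun u : (Σ i : Fin k, Fin (c i).length) => (u.2 : ℕ)) h
    simp only at this
    omega

namespace WeightedGraph

/-- The weighted graph with opposite weights. -/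
def negWeight {V : Type*} (Γ : WeightedGraph V) : WeightedGraph V where
  graph := Γ.graph
  weight v := -Γ.weight v

theorem latticeForm_negWeight {V : Type*} [Fintype V] (Γ : WeightedGraph V) :
    Γ.negWeight.latticeForm = -Γ.intersectionForm := by
  classical
  rw [latticeForm, intersectionForm, ← map_neg]
  congr 1
  ext u v
  simp only [latticeMatrix, negWeight, Matrix.of_apply, Matrix.neg_apply]
  split_ifs <;> simp_all

theorem isLinearUnion_negWeight_canonicalPlumbing {k : ℕ} (b : Fin k → List ℤ) :
    (canonicalPlumbing b).negWeight.IsLinearUnion := by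
  have hlen (i) : ((b i).map fun x => -x).length = (b i).length := List.length_map _
  refine ⟨k, b, ⟨Equiv.sigmaCongrRight fun i => finCongr (hlen i), ?_⟩, ?_⟩
  · rintro ⟨i, j⟩ ⟨i', j'⟩
    rfl
  · rintro ⟨i, j⟩
    have hj := j.2
    change (b i)[(j : ℕ)]'(by simpa using hj) = -((b i).map fun x => -x)[(j : ℕ)]
    rw [List.getElem_map, neg_neg]

theorem getElem?_dualAdj_eq_adjWeight {k : ℕ} {a b : Fin k → List ℤ}
    (hb : ∀ i, b i = addDegree (dualAdj (a i)))
    (v : Σ i : Fin k, Fin ((b i).map fun x => -x).length) :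
    (dualAdj (a v.1))[(v.2 : ℕ)]? = some ((canonicalPlumbing b).negWeight.adjWeight v) := by
  have hlen : ((b v.1).map fun x => -x).length = (dualAdj (a v.1)).length := by
    rw [List.length_map, hb, length_addDegree]
  have hj := v.2.2
  have hj' : (v.2 : ℕ) < (dualAdj (a v.1)).length := by omega
  have hj2 : (v.2 : ℕ) < (b v.1).length := by simpa using hj
  have e : (canonicalPlumbing b).negWeight.weight v = (b v.1)[(v.2 : ℕ)] := by
    change -((b v.1).map fun x => -x)[(v.2 : ℕ)] = _
    rw [List.getElem_map, neg_neg]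
  rw [List.getElem?_eq_getElem hj', adjWeight, e]
  simp only [hb v.1]
  rw [getElem_addDegree _ _ _ hj']
  have h := linearPlumbing_neighborSet_ncard (fun i => (b i).map fun x => -x) v
  have h' : (((canonicalPlumbing b).negWeight.graph.neighborSet v).ncard : ℤ) = _ := h
  have e' : ((v.2 : ℕ) + 1 < ((b v.1).map fun x => -x).length) =
      ((v.2 : ℕ) + 1 < (dualAdj (a v.1)).length) := propext (by omega)
  rw [h']
  simp only [e']
  congr 1
  ring

theorem workingConditions_negWeight_canonicalPlumbing {k : ℕ} {a b : Fin k → List ℤ}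
    (ha : ∀ i, ∀ x ∈ a i, 2 ≤ x) (hb2 : ∀ i, ∀ x ∈ b i, 2 ≤ x)
    (hb : ∀ i, b i = addDegree (dualAdj (a i)))
    (hf : ∀ H ∈ forbiddenConfigurations,
      ¬ (canonicalPlumbing a).ContainsInduced (linearPlumbing H.get)) :
    (canonicalPlumbing b).negWeight.WorkingConditions := by
  have hW := getElem?_dualAdj_eq_adjWeight hb
  have hmem (v) : (canonicalPlumbing b).negWeight.adjWeight v ∈ dualAdj (a v.1) :=
    List.mem_of_getElem? (hW v)
  have hs (l : List ℤ) (hl : [l] ∈ forbiddenConfigurations) (i : Fin k) :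
      ¬ l.map (fun x => -x) <:+: a i ∧ ¬ (l.map (fun x => -x)).reverse <:+: a i :=
    ⟨fun h => hf _ hl (containsInduced_of_infix (Or.inl h)),
      fun h => hf _ hl (containsInduced_of_infix (Or.inr h))⟩
  have h22 : ∀ i₁ i₂ s₁ s₂ u₁ u₂, a i₁ = s₁ ++ ([2] ++ u₁) → a i₂ = s₂ ++ ([2] ++ u₂) →
      ¬ (i₁ = i₂ → s₁.length + 1 < s₂.length ∨ s₂.length + 1 < s₁.length) :=
    fun _ _ _ _ _ _ h₁ h₂ h => hf [[-2], [-2]] (by simp [forbiddenConfigurations])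
      (containsInduced_pair (l₁ := [-2]) (l₂ := [-2]) h₁ h₂ h)
  have h322 : ∀ i₁ i₂ s₁ s₂ u₁ u₂, a i₁ = s₁ ++ ([3] ++ u₁) → a i₂ = s₂ ++ ([2, 2] ++ u₂) →
      ¬ (i₁ = i₂ → s₁.length + 1 < s₂.length ∨ s₂.length + 2 < s₁.length) :=
    fun _ _ _ _ _ _ h₁ h₂ h => hf [[-3], [-2, -2]] (by simp [forbiddenConfigurations])
      (containsInduced_pair (l₁ := [-3]) (l₂ := [-2, -2]) h₁ h₂ h)
  have hinf {l : List ℤ} (hl : l ≠ []) (h : (canonicalPlumbing b).negWeight.HasAdjPath l) :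
      ∃ i, l <:+: dualAdj (a i) ∨ l.reverse <:+: dualAdj (a i) := by
    refine h.infix (comp := Sigma.fst) (idx := fun v => v.2) (fun u v => Iff.rfl) ?_
      (W := fun i => dualAdj (a i)) hW hl
    rintro ⟨i, j⟩ ⟨i', j'⟩ rfl h
    exact congrArg (Sigma.mk i) (Fin.ext h)
  have hle {i : Fin k} {x : ℤ} (hx : x ∈ dualAdj (a i)) : x ≤ 3 := le_three_of_dualAdj ha h22 hx
  constructor
  · intro v
    refine hb2 v.1 _ ?_
    have hj : (v.2 : ℕ) < (b v.1).length := by simpa using v.2.2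
    have e : (canonicalPlumbing b).negWeight.weight v = (b v.1)[(v.2 : ℕ)] := by
      change -((b v.1).map fun x => -x)[(v.2 : ℕ)] = _
      rw [List.getElem_map, neg_neg]
    rw [e]
    exact List.getElem_mem hj
  · exact fun v => hle (hmem v)
  · rintro ⟨i, j⟩ ⟨i', j'⟩ hu hv
    obtain ⟨rfl, h⟩ := eq_of_one_lt_of_dualAdj ha h22 hu hv (hW ⟨i, j⟩) (hW ⟨i', j'⟩)
    exact congrArg (Sigma.mk i) (Fin.ext h)
  · intro x y z hx hy hz h
    have key (i : Fin k) (x z : ℤ) (hx : 0 < x) (hz : 0 < z) (h : [x, y, z] <:+: dualAdj (a i)) :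
        False := by
      have hy3 := hle (h.subset (by simp : y ∈ [x, y, z]))
      have := infix_of_dualAdj_three_positive (ha i) hx hy hz h
      obtain rfl | rfl | rfl : y = 1 ∨ y = 2 ∨ y = 3 := by omega
      · exact (hs [-3, -3] (by simp [forbiddenConfigurations]) i).1
          (by simpa [List.replicate] using this)
      · exact (hs [-3, -2, -3] (by simp [forbiddenConfigurations]) i).1
          (by simpa [List.replicate] using this)
      · exact (hs [-3, -2, -2, -3] (by simp [forbiddenConfigurations]) i).1
          (by simpa [List.replicate] using this)
    obtain ⟨i, h | h⟩ := hinf (by simp) h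
    · exact key i x z hx hz h
    · exact key i z x hz hx h
  · rintro ⟨v, hv⟩ h
    obtain ⟨j, h⟩ := hinf (by simp) h
    exact not_one_one_of_dualAdj ha h322 (hv ▸ hmem v) (h.elim id id)
  · intro α m hα hm h
    by_contra! hlt
    obtain ⟨i, h⟩ := hinf (by simp) h
    have hα3 : α ≤ 3 := hle (i := i) (h.elim (fun h => h.subset (by simp))
      fun h => h.subset (by simp))
    rcases h with h | h
    · have h1 := infix_of_dualAdj_chain (ha i) hα m h
      obtain rfl | rfl | rfl : m = 1 ∨ m = 2 ∨ m = 3 := by omega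
      · exact (hs [-4] (by simp [forbiddenConfigurations]) i).1
          ((List.suffix_append _ _).isInfix.trans h1)
      · refine (hs [-5, -2] (by simp [forbiddenConfigurations]) i).2
          (List.IsInfix.trans (List.IsSuffix.isInfix ?_) h1)
        obtain rfl | rfl : α = 2 ∨ α = 3 := by omega
        · exact ⟨[], rfl⟩
        · exact ⟨[2], rfl⟩
      · obtain rfl : α = 3 := by omega
        exact (hs [-6, -2, -2] (by simp [forbiddenConfigurations]) i).2
          (by simpa [List.replicate] using h1)
    · have h1 := infix_of_dualAdj_chain_reverse (ha i) hα m (by simpa using h)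
      obtain rfl | rfl | rfl : m = 1 ∨ m = 2 ∨ m = 3 := by omega
      · exact (hs [-4] (by simp [forbiddenConfigurations]) i).1
          (List.IsInfix.trans (List.IsPrefix.isInfix ⟨_, rfl⟩) h1)
      · refine (hs [-5, -2] (by simp [forbiddenConfigurations]) i).1
          (List.IsInfix.trans (List.IsPrefix.isInfix ?_) h1)
        obtain rfl | rfl : α = 2 ∨ α = 3 := by omega
        · exact ⟨[], rfl⟩
        · exact ⟨[2], rfl⟩
      · obtain rfl : α = 3 := by omega
        exact (hs [-6, -2, -2] (by simp [forbiddenConfigurations]) i).1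
          (by simpa [List.replicate] using h1)
  · intro h
    obtain ⟨i, h | h⟩ := hinf (by simp) h
    · exact (hs [-3, -5, -3, -2] (by simp [forbiddenConfigurations]) i).1
        (by simpa using infix_of_dualAdj_110012 (ha i) h)
    · exact (hs [-3, -5, -3, -2] (by simp [forbiddenConfigurations]) i).2
        (by simpa using infix_of_dualAdj_210011 (ha i) h)
  · intro h
    obtain ⟨i, h | h⟩ := hinf (by simp) h
    · exact (hs [-2, -2, -3, -5] (by simp [forbiddenConfigurations]) i).1
        (by simpa using infix_of_dualAdj_31001 (ha i) h)
    · exact (hs [-2, -2, -3, -5] (by simp [forbiddenConfigurations]) i).2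
        (by simpa using infix_of_dualAdj_10013 (ha i) h)

end WeightedGraph

end Auxiliary

theorem theorem4 :
    (∀ {V : Type*} [Fintype V] (Γ : WeightedGraph V),
      Γ.IsLinearUnion → Γ.WorkingConditions →
        (∀ (N : ℕ) (φ : V → Fin N → ℤ), Γ.IsEmbedding φ → Γ.IsStandard φ) ∧
        Γ.IsRigid ∧
        IsRigidLattice Γ.latticeForm) ∧
    (∀ (k : ℕ) (p q : Fin k → ℕ) (a b : Fin k → List ℤ),
      (∀ i, 0 < q i ∧ q i < p i ∧ (p i).Coprime (q i)) →
      (∀ i, IsHJExpansion (p i) (q i) (a i)) →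
      (∀ i, IsHJExpansion (p i) (p i - q i) (b i)) →
      (∀ H ∈ forbiddenConfigurations,
        ¬ (canonicalPlumbing a).ContainsInduced (linearPlumbing H.get)) →
      IsRigidLattice (-(canonicalPlumbing b).intersectionForm)) := by
  refine ⟨fun Γ hlin hΓ => ⟨fun N φ hφ => hΓ.isStandard hlin hφ, hΓ.isRigid hlin,
    (hΓ.isRigid hlin).isRigidLattice⟩, fun k p q a b hpq ha hb hf => ?_⟩
  rw [← WeightedGraph.latticeForm_negWeight]
  exact ((WeightedGraph.workingConditions_negWeight_canonicalPlumbing (fun i => (ha i).2.1)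
    (fun i => (hb i).2.1)
    (fun i => IsHJExpansion.eq_addDegree_dualAdj (hpq i).1 (hpq i).2.1 (ha i) (hb i)) hf).isRigid
    (WeightedGraph.isLinearUnion_negWeight_canonicalPlumbing b)).isRigidLattice
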